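/- Let $G=\mathrm{SL}(3,\mathbb{R})$ and let $P\subset G$ be its minimal parabolic subgroup of upper triangular matrices. Call an element of $G$ semisimple if it is diagonalizable over $\mathbb{C}$, and call a semisimple element singular if it has a repeated complex eigenvalue, i.e. if its three complex eigenvalues, counted with multiplicity, are not pairwise distinct. Let $\Gamma$ be a discrete subgroup of $G$ that is Zariski-dense, i.e. every real polynomial in the matrix entries that vanishes on $\Gamma$ vanishes on $G$. Suppose that $\Gamma$ contains a subgroup $\Delta$ isomorphic to $\mathbb{Z}^2$ such that no element of $\Delta\setminus\{1\}$ is singular semisimple. Then $\Gamma$ acts minimally on $G/P$, i.e. every $\Gamma$-orbit in $G/P$ is dense. -/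

import Mathlib

open scoped MatrixGroups

/-- The minimal parabolic subgroup `P` of `SL(3, ℝ)`: the upper triangular matrices of
determinant one, i.e. the stabilizer of the standard complete flag. The Furstenberg boundary
`G/P` is the coset space `SL(3, ℝ) ⧸ minimalParabolic` with the quotient topology. -/
def minimalParabolic : Subgroup SL(3, ℝ) where
  carrier := {g | ∀ i j : Fin 3, j < i → (g : Matrix (Fin 3) (Fin 3) ℝ) i j = 0}
  one_mem' := by
    intro i j hij
    simp [Matrix.one_apply_ne hij.ne']
  mul_mem' := by
    intro a b ha hb i j hij
    have h : Matrix.BlockTriangular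
        ((a : Matrix (Fin 3) (Fin 3) ℝ) * (b : Matrix (Fin 3) (Fin 3) ℝ)) id :=
      Matrix.BlockTriangular.mul (fun i j h => ha i j h) (fun i j h => hb i j h)
    simpa using h hij
  inv_mem' := by
    intro a ha i j hij
    have hji : i = 1 ∧ j = 0 ∨ i = 2 ∧ j = 0 ∨ i = 2 ∧ j = 1 := by
      revert i j; decide
    have h10 := ha 1 0 (by decide)
    have h20 := ha 2 0 (by decide)
    have h21 := ha 2 1 (by decide)
    rw [Matrix.SpecialLinearGroup.coe_inv, Matrix.adjugate_fin_three]
    rcases hji with ⟨rfl, rfl⟩ | ⟨rfl, rfl⟩ | ⟨rfl, rfl⟩ <;> simp [h10, h20, h21]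

/-- A subset of `SL(3, ℝ)` is Zariski-dense if every real polynomial in the nine matrix entries
that vanishes on it vanishes on all of `SL(3, ℝ)`. -/
def IsZariskiDense (S : Set SL(3, ℝ)) : Prop :=
  ∀ f : MvPolynomial (Fin 3 × Fin 3) ℝ,
    (∀ g ∈ S, MvPolynomial.eval (fun ij => (g : Matrix (Fin 3) (Fin 3) ℝ) ij.1 ij.2) f = 0) →
    ∀ g : SL(3, ℝ), MvPolynomial.eval (fun ij => (g : Matrix (Fin 3) (Fin 3) ℝ) ij.1 ij.2) f = 0

/-- `g` is semisimple: it acts semisimply on `ℝ³` (equivalently, it is diagonalizable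
over `ℂ`). -/
def IsSemisimpleElement (g : SL(3, ℝ)) : Prop :=
  Module.End.IsSemisimple (Matrix.toLin' (g : Matrix (Fin 3) (Fin 3) ℝ))

/-- `g` is regular: its three complex eigenvalues, counted with multiplicity, are pairwise
distinct. -/
def IsRegularElement (g : SL(3, ℝ)) : Prop :=
  ((g : Matrix (Fin 3) (Fin 3) ℝ).map Complex.ofReal).charpoly.roots.Nodup

/-- `g` is a singular semisimple element: it is semisimple and not regular. -/
def IsSingularSemisimple (g : SL(3, ℝ)) : Prop :=
  IsSemisimpleElement g ∧ ¬ IsRegularElement g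

section

open Matrix Filter Topology

/-! A point of G/P is a flag (line, plane) in ℝ³, stored as a vector `p` and a linear form `φ` with
`φ ⬝ᵥ p = 0`, each up to a nonzero scalar. A circle is the set of all flags with one fixed plane.

Minimality follows once every nonempty closed invariant set of flags contains a circle, both for Γ
and for its image under inverse transpose, which exchanges lines and planes. Apply this three times
(`IsFlagSet.mem_of_hasCircle`). The flags of X whose whole circle lies in X form a closed invariant
set X₁. The flags of X₁ all of whose planes through the same line stay in X₁ form another, X₂.
Finally X₂ contains the circle over some plane ψ. Any plane φ meets ψ in a line q, so (q, φ) lies in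
X₁, and hence every flag with plane φ lies in X.

To produce a circle, conjugate Δ ≅ ℤ² to a normal form and push a flag in general position
(available by Zariski density) to a limit. The normal form is read off from the real centralizer of
one element. Distinct real eigenvalues give diagonal matrices (`hasCircle_of_diagonal`), a double
eigenvalue gives `hasCircle_of_shear`, a full Jordan block gives `hasCircle_of_jordan`. If all
elements satisfy (g - 1)² = 0, there are two families (`hasCircle_of_translations`,
`hasCircle_of_central`). A nonreal eigenvalue cannot occur, because the centralizer is then a
compact group times ℝ and contains no discrete ℤ². Excluding singular semisimple elements makes
characters such as the logarithm of a ratio of two eigenvalues injective on ℤ². Discreteness makes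
them unbounded in a second direction. Together they allow one character to approach any prescribed
value while the other tends to infinity (`exists_seq_tendsto_atTop`).

In the diagonal case these limits give only arcs, half of a circle up to closure. If no circle were
present, some g in Γ and its inverse would, after one diagonal rescaling, both have entries of
constant sign. This is impossible because their product has a zero off-diagonal entry. -/

/-- Real `3 × 3` matrices. -/
abbrev Mat3 := Matrix (Fin 3) (Fin 3) ℝ

/-- Real vectors with three entries. -/
abbrev Vec3 := Fin 3 → ℝ

/-! ### Polynomial functions on SL(3, ℝ) and Zariski density. -/

/-- The algebra of real functions on `SL(3, ℝ)` that are polynomial in the matrix entries. -/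
noncomputable def polyFun : Subalgebra ℝ (SL(3, ℝ) → ℝ) :=
  (MvPolynomial.aeval (R := ℝ)
    (fun (ij : Fin 3 × Fin 3) (g : SL(3, ℝ)) => (g : Mat3) ij.1 ij.2)).range

theorem aeval_entries_apply (P : MvPolynomial (Fin 3 × Fin 3) ℝ) (g : SL(3, ℝ)) :
    (MvPolynomial.aeval (R := ℝ)
      (fun (ij : Fin 3 × Fin 3) (g : SL(3, ℝ)) => (g : Mat3) ij.1 ij.2)) P g =
      MvPolynomial.eval (fun ij => (g : Mat3) ij.1 ij.2) P := by
  induction P using MvPolynomial.induction_on with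
  | C a => simp
  | add p q hp hq => simp [hp, hq]
  | mul_X p n hp => simp [hp]

theorem entry_mem_polyFun (i j : Fin 3) : (fun g : SL(3, ℝ) => (g : Mat3) i j) ∈ polyFun :=
  ⟨MvPolynomial.X (i, j), by simp⟩

theorem const_mem_polyFun (c : ℝ) : (fun _ : SL(3, ℝ) => c) ∈ polyFun :=
  polyFun.algebraMap_mem c

theorem mul_mem_polyFun {f h : SL(3, ℝ) → ℝ} (hf : f ∈ polyFun) (hh : h ∈ polyFun) :
    (fun g => f g * h g) ∈ polyFun := polyFun.mul_mem hf hh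

theorem add_mem_polyFun {f h : SL(3, ℝ) → ℝ} (hf : f ∈ polyFun) (hh : h ∈ polyFun) :
    (fun g => f g + h g) ∈ polyFun := polyFun.add_mem hf hh

theorem sub_mem_polyFun {f h : SL(3, ℝ) → ℝ} (hf : f ∈ polyFun) (hh : h ∈ polyFun) :
    (fun g => f g - h g) ∈ polyFun := polyFun.sub_mem hf hh

theorem prod_mem_polyFun {ι : Type*} (s : Finset ι) {f : ι → SL(3, ℝ) → ℝ}
    (hf : ∀ i ∈ s, f i ∈ polyFun) : (fun g => ∏ i ∈ s, f i g) ∈ polyFun := by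
  have := polyFun.prod_mem hf
  convert this using 1
  ext g; simp

theorem sum_mem_polyFun {ι : Type*} (s : Finset ι) {f : ι → SL(3, ℝ) → ℝ}
    (hf : ∀ i ∈ s, f i ∈ polyFun) : (fun g => ∑ i ∈ s, f i g) ∈ polyFun := by
  have := polyFun.sum_mem hf
  convert this using 1
  ext g; simp

theorem inv_entry_mem_polyFun (i j : Fin 3) :
    (fun g : SL(3, ℝ) => ((g⁻¹ : SL(3, ℝ)) : Mat3) i j) ∈ polyFun := by
  have key : ∀ a b c d a' b' c' d' : Fin 3, (fun g : SL(3, ℝ) =>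
      (g : Mat3) a b * (g : Mat3) c d - (g : Mat3) a' b' * (g : Mat3) c' d') ∈ polyFun :=
    fun a b c d a' b' c' d' =>
    sub_mem_polyFun (mul_mem_polyFun (entry_mem_polyFun _ _) (entry_mem_polyFun _ _))
      (mul_mem_polyFun (entry_mem_polyFun _ _) (entry_mem_polyFun _ _))
  have key2 : ∀ a b c d a' b' c' d' : Fin 3, (fun g : SL(3, ℝ) =>
      -((g : Mat3) a b * (g : Mat3) c d) + (g : Mat3) a' b' * (g : Mat3) c' d') ∈ polyFun := by
    intro a b c d a' b' c' d'
    convert key a' b' c' d' a b c d using 2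
    ring
  have e : (fun g : SL(3, ℝ) => ((g⁻¹ : SL(3, ℝ)) : Mat3) i j) =
      fun g : SL(3, ℝ) => (adjugate (g : Mat3)) i j := by
    ext g; rw [Matrix.SpecialLinearGroup.coe_inv]
  rw [e]
  simp only [adjugate_fin_three]
  fin_cases i <;> fin_cases j <;>
    first | exact key _ _ _ _ _ _ _ _ | exact key2 _ _ _ _ _ _ _ _

theorem comp_mem_polyFun {f : SL(3, ℝ) → ℝ} (hf : f ∈ polyFun) {θ : SL(3, ℝ) → SL(3, ℝ)}
    (hθ : ∀ i j, (fun g => (θ g : Mat3) i j) ∈ polyFun) : (fun g => f (θ g)) ∈ polyFun := by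
  obtain ⟨P, rfl⟩ := hf
  induction P using MvPolynomial.induction_on with
  | C a => simpa using const_mem_polyFun a
  | add p q hp hq =>
    simp only [map_add]
    exact add_mem_polyFun hp hq
  | mul_X p n hp =>
    simp only [map_mul]
    exact mul_mem_polyFun hp (by simpa using hθ n.1 n.2)

theorem mulVec_mem_polyFun (p : Vec3) (i : Fin 3) :
    (fun g : SL(3, ℝ) => ((g : Mat3) *ᵥ p) i) ∈ polyFun :=
  sum_mem_polyFun Finset.univ (f := fun j g => (g : Mat3) i j * p j) fun j _ =>
    mul_mem_polyFun (entry_mem_polyFun i j) (const_mem_polyFun (p j))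

theorem vecMul_inv_mem_polyFun (φ : Vec3) (i : Fin 3) :
    (fun g : SL(3, ℝ) => (φ ᵥ* ((g⁻¹ : SL(3, ℝ)) : Mat3)) i) ∈ polyFun :=
  sum_mem_polyFun Finset.univ
    (f := fun j g => φ j * ((g⁻¹ : SL(3, ℝ)) : Mat3) j i) fun j _ =>
    mul_mem_polyFun (const_mem_polyFun (φ j)) (inv_entry_mem_polyFun j i)

theorem IsZariskiDense.eq_zero {S : Set SL(3, ℝ)} (h : IsZariskiDense S) {f : SL(3, ℝ) → ℝ}
    (hf : f ∈ polyFun) (h0 : ∀ g ∈ S, f g = 0) (g : SL(3, ℝ)) : f g = 0 := by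
  obtain ⟨P, rfl⟩ := hf
  have := h P (fun g hg => by rw [← aeval_entries_apply]; exact h0 g hg) g
  rw [← aeval_entries_apply] at this
  exact this

theorem IsZariskiDense.exists_ne_zero {S : Set SL(3, ℝ)} (h : IsZariskiDense S)
    {f : SL(3, ℝ) → ℝ} (hf : f ∈ polyFun) (g₀ : SL(3, ℝ)) (h0 : f g₀ ≠ 0) :
    ∃ g ∈ S, f g ≠ 0 := by
  by_contra! hc
  exact h0 (h.eq_zero hf hc g₀)

theorem IsZariskiDense.map {Γ : Subgroup SL(3, ℝ)} (h : IsZariskiDense (Γ : Set SL(3, ℝ)))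
    (θ : SL(3, ℝ) ≃* SL(3, ℝ)) (hθ : ∀ i j, (fun g => (θ g : Mat3) i j) ∈ polyFun) :
    IsZariskiDense (Γ.map θ.toMonoidHom : Set SL(3, ℝ)) := by
  intro f hf g
  have h1 := h.eq_zero (comp_mem_polyFun ⟨f, rfl⟩ hθ) (fun γ hγ => by
    have := hf _ ⟨γ, hγ, rfl⟩
    rw [← aeval_entries_apply] at this
    exact this) (θ.symm g)
  rw [← aeval_entries_apply]
  simpa using h1

/-! ### Closed invariant sets of flags and flags in general position. -/

/-- A nonempty-fibre cone over a closed `Γ`-invariant set of flags in `ℝ³`: the flag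
`(line, plane)` is recorded by a pair `(p, φ)` of a vector spanning the line and a linear form
cutting out the plane. -/
structure IsFlagSet (Γ : Subgroup SL(3, ℝ)) (X : Set (Vec3 × Vec3)) : Prop where
  left_ne : ∀ {p φ}, (p, φ) ∈ X → p ≠ 0
  right_ne : ∀ {p φ}, (p, φ) ∈ X → φ ≠ 0
  dot : ∀ {p φ}, (p, φ) ∈ X → φ ⬝ᵥ p = 0
  smul : ∀ {p φ}, (p, φ) ∈ X → ∀ {a b : ℝ}, a ≠ 0 → b ≠ 0 → (a • p, b • φ) ∈ X
  inv : ∀ {p φ}, (p, φ) ∈ X → ∀ {g : SL(3, ℝ)}, g ∈ Γ →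
    ((g : Mat3) *ᵥ p, φ ᵥ* ((g⁻¹ : SL(3, ℝ)) : Mat3)) ∈ X
  closed : ∀ {p φ : ℕ → Vec3} {p' φ' : Vec3}, (∀ n, (p n, φ n) ∈ X) → Tendsto p atTop (𝓝 p') →
    Tendsto φ atTop (𝓝 φ') → p' ≠ 0 → φ' ≠ 0 → (p', φ') ∈ X

/-- Every nonempty closed `Γ`-invariant set of flags contains all flags with a given plane. -/
def HasCircle (Γ : Subgroup SL(3, ℝ)) : Prop :=
  ∀ X, IsFlagSet Γ X → X.Nonempty → ∃ φ : Vec3, φ ≠ 0 ∧ ∀ p : Vec3, p ≠ 0 → φ ⬝ᵥ p = 0 → (p, φ) ∈ X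

/-- A limit of multiples of flags in a flag set. -/
theorem IsFlagSet.limit {Γ : Subgroup SL(3, ℝ)} {X : Set (Vec3 × Vec3)} (hX : IsFlagSet Γ X)
    {g : ℕ → SL(3, ℝ)} (hg : ∀ n, g n ∈ Γ) {p φ : Vec3} (h : (p, φ) ∈ X) {a b : ℕ → ℝ}
    (ha : ∀ n, a n ≠ 0) (hb : ∀ n, b n ≠ 0) {p' φ' : Vec3}
    (hp : Tendsto (fun n => a n • ((g n : Mat3) *ᵥ p)) atTop (𝓝 p'))
    (hφ : Tendsto (fun n => b n • (φ ᵥ* (((g n)⁻¹ : SL(3, ℝ)) : Mat3))) atTop (𝓝 φ'))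
    (hp' : p' ≠ 0) (hφ' : φ' ≠ 0) : (p', φ') ∈ X :=
  hX.closed (fun n => hX.smul (hX.inv h (hg n)) (ha n) (hb n)) hp hφ hp' hφ'

theorem tendsto_vec3 {ι : Type*} {l : Filter ι} {f : ι → Vec3} {v : Vec3}
    (h0 : Tendsto (fun n => f n 0) l (𝓝 (v 0))) (h1 : Tendsto (fun n => f n 1) l (𝓝 (v 1)))
    (h2 : Tendsto (fun n => f n 2) l (𝓝 (v 2))) : Tendsto f l (𝓝 v) := by
  rw [tendsto_pi_nhds]
  intro i
  fin_cases i <;> assumption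

/-- A matrix of determinant one sending the standard flag to the flag `(p, φ)`. -/
noncomputable def flagMatrix (p φ : Vec3) : Mat3 :=
  !![p 0, φ 1 * p 2 - φ 2 * p 1, φ 0 / ((p ⬝ᵥ p) * (φ ⬝ᵥ φ));
     p 1, φ 2 * p 0 - φ 0 * p 2, φ 1 / ((p ⬝ᵥ p) * (φ ⬝ᵥ φ));
     p 2, φ 0 * p 1 - φ 1 * p 0, φ 2 / ((p ⬝ᵥ p) * (φ ⬝ᵥ φ))]

theorem dot_self_pos {p : Vec3} (hp : p ≠ 0) : 0 < p ⬝ᵥ p := by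
  have h := dotProduct_self_eq_zero (v := p)
  have h2 : 0 ≤ p ⬝ᵥ p := by
    simp only [dotProduct, Fin.sum_univ_three]
    nlinarith [mul_self_nonneg (p 0), mul_self_nonneg (p 1), mul_self_nonneg (p 2)]
  exact lt_of_le_of_ne h2 fun h3 => hp (h.1 h3.symm)

/-- The middle column is the cross product φ × p, so the three columns are orthogonal and positively
oriented. Without the denominator the determinant would be |p|²|φ|². -/
theorem det_flagMatrix {p φ : Vec3} (hp : p ≠ 0) (hφ : φ ≠ 0) (h : φ ⬝ᵥ p = 0) :
    (flagMatrix p φ).det = 1 := by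
  have h1 := (dot_self_pos hp).ne'
  have h2 := (dot_self_pos hφ).ne'
  have h3 : (p ⬝ᵥ p) * (φ ⬝ᵥ φ) ≠ 0 := mul_ne_zero h1 h2
  rw [flagMatrix, det_fin_three]
  generalize hk : (p ⬝ᵥ p) * (φ ⬝ᵥ φ) = k at h3
  simp only [dotProduct, Fin.sum_univ_three] at h hk
  simp
  field_simp
  rw [← hk]
  linear_combination -(φ 0 * p 0 + φ 1 * p 1 + φ 2 * p 2) * h

theorem continuousAt_flagMatrix {p φ : Vec3} (hp : p ≠ 0) (hφ : φ ≠ 0) :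
    ContinuousAt (fun x : Vec3 × Vec3 => flagMatrix x.1 x.2) (p, φ) := by
  have h1 := (dot_self_pos hp).ne'
  have h2 := (dot_self_pos hφ).ne'
  have h3 : (p ⬝ᵥ p) * (φ ⬝ᵥ φ) ≠ 0 := mul_ne_zero h1 h2
  simp only [dotProduct, Fin.sum_univ_three] at h3
  refine tendsto_pi_nhds.2 fun i => tendsto_pi_nhds.2 fun j => ?_
  fin_cases i <;> fin_cases j <;> simp [flagMatrix, dotProduct, Fin.sum_univ_three] <;>
    (refine ContinuousAt.tendsto ?_; fun_prop (disch := simpa using h3))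

theorem exists_coe_eq {M : Mat3} (h : M.det = 1) : ∃ g : SL(3, ℝ), (g : Mat3) = M :=
  ⟨⟨M, h⟩, rfl⟩

theorem exists_flag_map {p φ : Vec3} (hp : p ≠ 0) (hφ : φ ≠ 0) (h : φ ⬝ᵥ p = 0) :
    ∃ g : SL(3, ℝ), (g : Mat3) = flagMatrix p φ ∧ (g : Mat3) *ᵥ ![1, 0, 0] = p ∧
      ![0, 0, 1] ᵥ* ((g⁻¹ : SL(3, ℝ)) : Mat3) = (p ⬝ᵥ p) • φ := by
  obtain ⟨g, hg⟩ := exists_coe_eq (det_flagMatrix hp hφ h)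
  refine ⟨g, hg, ?_, ?_⟩
  · rw [hg]
    ext i
    fin_cases i <;> simp [flagMatrix, mulVec, dotProduct, Fin.sum_univ_three]
  · rw [Matrix.SpecialLinearGroup.coe_inv, hg, adjugate_fin_three]
    simp only [dotProduct, Fin.sum_univ_three] at h
    ext i
    fin_cases i <;> simp [flagMatrix, vecMul, dotProduct, Fin.sum_univ_three]
    · linear_combination (-p 0) * h
    · linear_combination (-p 1) * h
    · linear_combination (-p 2) * h

theorem exists_flag_transport {p φ q ψ : Vec3} (hp : p ≠ 0) (hφ : φ ≠ 0) (h : φ ⬝ᵥ p = 0)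
    (hq : q ≠ 0) (hψ : ψ ≠ 0) (h' : ψ ⬝ᵥ q = 0) :
    ∃ g : SL(3, ℝ), (g : Mat3) *ᵥ p = q ∧ ∃ c : ℝ, c ≠ 0 ∧
      φ ᵥ* ((g⁻¹ : SL(3, ℝ)) : Mat3) = c • ψ := by
  obtain ⟨a, -, ha1, ha2⟩ := exists_flag_map hp hφ h
  obtain ⟨b, -, hb1, hb2⟩ := exists_flag_map hq hψ h'
  have ea : ((a⁻¹ : SL(3, ℝ)) : Mat3) * (a : Mat3) = 1 := by
    rw [← Matrix.SpecialLinearGroup.coe_mul]; simp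
  refine ⟨b * a⁻¹, ?_, (p ⬝ᵥ p)⁻¹ * (q ⬝ᵥ q),
    mul_ne_zero (inv_ne_zero (dot_self_pos hp).ne') (dot_self_pos hq).ne', ?_⟩
  · rw [← ha1, Matrix.SpecialLinearGroup.coe_mul, mulVec_mulVec, mul_assoc, ea, mul_one, hb1]
  · have e2 : φ = (p ⬝ᵥ p)⁻¹ • (![0, 0, 1] ᵥ* ((a⁻¹ : SL(3, ℝ)) : Mat3)) := by
      rw [ha2, smul_smul, inv_mul_cancel₀ (dot_self_pos hp).ne', one_smul]
    rw [_root_.mul_inv_rev, inv_inv, Matrix.SpecialLinearGroup.coe_mul, mul_smul, ← hb2]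
    conv_lhs => rw [e2]
    rw [smul_vecMul, vecMul_vecMul, ← mul_assoc, ea, one_mul]

/-- A flag set contains a flag in general position: no coordinate vanishes, and a prescribed
finite set of linear relations between two coordinates is avoided. -/
theorem IsFlagSet.exists_generic {Γ : Subgroup SL(3, ℝ)}
    (hd : IsZariskiDense (Γ : Set SL(3, ℝ))) {X : Set (Vec3 × Vec3)} (hX : IsFlagSet Γ X)
    (hne : X.Nonempty) (N : ℕ) :
    ∃ p φ, (p, φ) ∈ X ∧ (∀ i, p i ≠ 0) ∧ (∀ i, φ i ≠ 0) ∧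
      ∀ k j : ℤ, |k| ≤ N → |j| ≤ N → (k ≠ 0 ∨ j ≠ 0) → k * p 1 + j * p 2 ≠ 0 := by
  obtain ⟨⟨p, φ⟩, h⟩ := hne
  let s : Finset (ℤ × ℤ) := (Finset.Icc (-N : ℤ) N ×ˢ Finset.Icc (-N : ℤ) N).filter
    (fun x => x.1 ≠ 0 ∨ x.2 ≠ 0)
  let f : SL(3, ℝ) → ℝ := fun g =>
    ((∏ i, ((g : Mat3) *ᵥ p) i) * ∏ i, (φ ᵥ* ((g⁻¹ : SL(3, ℝ)) : Mat3)) i) *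
      ∏ x ∈ s, ((x.1 : ℝ) * ((g : Mat3) *ᵥ p) 1 + x.2 * ((g : Mat3) *ᵥ p) 2)
  have hf : f ∈ polyFun := by
    refine mul_mem_polyFun (mul_mem_polyFun ?_ ?_) ?_
    · exact prod_mem_polyFun _ fun i _ => mulVec_mem_polyFun p i
    · exact prod_mem_polyFun _ fun i _ => vecMul_inv_mem_polyFun φ i
    · exact prod_mem_polyFun _ fun x _ => add_mem_polyFun
        (mul_mem_polyFun (const_mem_polyFun _) (mulVec_mem_polyFun p 1))
        (mul_mem_polyFun (const_mem_polyFun _) (mulVec_mem_polyFun p 2))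
  -- G is transitive on flags, so it is enough to exhibit one good flag. With coordinates N + 1 and
  -- 1, a relation k(N + 1) + j = 0 with |k|, |j| ≤ N forces k = j = 0.
  obtain ⟨g₀, hg1, c, hc, hg2⟩ := exists_flag_transport (hX.left_ne h) (hX.right_ne h) (hX.dot h)
    (q := ![1, N + 1, 1]) (ψ := ![1, 1, -(N + 2)]) (by simp) (by simp)
    (by simp [dotProduct, Fin.sum_univ_three]; ring)
  have hN : (0 : ℝ) ≤ N := N.cast_nonneg
  have h0 : f g₀ ≠ 0 := by
    simp only [f, hg1, hg2]
    refine mul_ne_zero (mul_ne_zero ?_ ?_) ?_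
    · simp [Fin.prod_univ_three]; positivity
    · simp [Fin.prod_univ_three, hc]
      linarith
    · refine Finset.prod_ne_zero_iff.2 ?_
      rintro ⟨k, j⟩ hkj
      simp only [s, Finset.mem_filter, Finset.mem_product, Finset.mem_Icc] at hkj
      simp only [cons_val_one, cons_val_two, cons_val]
      intro h0
      have h1 : k * ((N : ℤ) + 1) + j = 0 := by
        have : ((k * ((N : ℤ) + 1) + j : ℤ) : ℝ) = 0 := by 
          simp at h0
          push_cast
          linarith
        exact_mod_cast this
      by_cases hk : k = 0
      · subst hk
        simp at h1
        simp [h1] at hkj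
      · obtain ⟨⟨⟨h2, h3⟩, h4, h5⟩, -⟩ := hkj
        rcases lt_or_gt_of_ne hk with h6 | h6 <;> nlinarith
  obtain ⟨γ, hγ, hγ0⟩ := hd.exists_ne_zero hf g₀ h0
  refine ⟨_, _, hX.inv h hγ, ?_, ?_, ?_⟩
  · have := left_ne_zero_of_mul (left_ne_zero_of_mul hγ0)
    rw [Finset.prod_ne_zero_iff] at this
    exact fun i => this i (Finset.mem_univ i)
  · have := right_ne_zero_of_mul (left_ne_zero_of_mul hγ0)
    rw [Finset.prod_ne_zero_iff] at this
    exact fun i => this i (Finset.mem_univ i)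
  · intro k j hk hj hkj
    have := right_ne_zero_of_mul hγ0
    rw [Finset.prod_ne_zero_iff] at this
    refine this (k, j) ?_
    simp only [s, Finset.mem_filter, Finset.mem_product, Finset.mem_Icc]
    exact ⟨⟨abs_le.1 hk, abs_le.1 hj⟩, hkj⟩

/-! ### Inverse transpose and projective duality. -/

theorem coe_inv_mul_coe (g : SL(3, ℝ)) : ((g⁻¹ : SL(3, ℝ)) : Mat3) * (g : Mat3) = 1 := by
  rw [← Matrix.SpecialLinearGroup.coe_mul, inv_mul_cancel, Matrix.SpecialLinearGroup.coe_one]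

theorem coe_mul_coe_inv (g : SL(3, ℝ)) : (g : Mat3) * ((g⁻¹ : SL(3, ℝ)) : Mat3) = 1 := by
  rw [← Matrix.SpecialLinearGroup.coe_mul, mul_inv_cancel, Matrix.SpecialLinearGroup.coe_one]

theorem inv_mulVec_mulVec (g : SL(3, ℝ)) (p : Vec3) :
    ((g⁻¹ : SL(3, ℝ)) : Mat3) *ᵥ ((g : Mat3) *ᵥ p) = p := by
  rw [mulVec_mulVec, coe_inv_mul_coe, one_mulVec]

theorem mulVec_inv_mulVec (g : SL(3, ℝ)) (p : Vec3) :
    (g : Mat3) *ᵥ (((g⁻¹ : SL(3, ℝ)) : Mat3) *ᵥ p) = p := by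
  rw [mulVec_mulVec, coe_mul_coe_inv, one_mulVec]

theorem vecMul_inv_vecMul (g : SL(3, ℝ)) (p : Vec3) :
    (p ᵥ* ((g⁻¹ : SL(3, ℝ)) : Mat3)) ᵥ* (g : Mat3) = p := by
  rw [vecMul_vecMul, coe_inv_mul_coe, vecMul_one]

theorem vecMul_vecMul_inv (g : SL(3, ℝ)) (p : Vec3) :
    (p ᵥ* (g : Mat3)) ᵥ* ((g⁻¹ : SL(3, ℝ)) : Mat3) = p := by
  rw [vecMul_vecMul, coe_mul_coe_inv, vecMul_one]

theorem mulVec_ne_zero (g : SL(3, ℝ)) {p : Vec3} (hp : p ≠ 0) : (g : Mat3) *ᵥ p ≠ 0 := by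
  intro h
  apply hp
  rw [← inv_mulVec_mulVec g p, h, mulVec_zero]

theorem vecMul_ne_zero (g : SL(3, ℝ)) {p : Vec3} (hp : p ≠ 0) : p ᵥ* (g : Mat3) ≠ 0 := by
  intro h
  apply hp
  rw [← vecMul_vecMul_inv g p, h, zero_vecMul]

theorem inv_transpose_inv (g : SL(3, ℝ)) :
    ((g⁻¹).transpose)⁻¹ = Matrix.SpecialLinearGroup.transpose g := by
  refine inv_eq_of_mul_eq_one_right ?_
  apply Subtype.ext
  rw [Matrix.SpecialLinearGroup.coe_mul, Matrix.SpecialLinearGroup.coe_transpose,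
    Matrix.SpecialLinearGroup.coe_transpose, ← transpose_mul, coe_mul_coe_inv, transpose_one,
    Matrix.SpecialLinearGroup.coe_one]

theorem transpose_transpose_coe (g : SL(3, ℝ)) : (g.transpose).transpose = g := by
  apply Subtype.ext
  rw [Matrix.SpecialLinearGroup.coe_transpose, Matrix.SpecialLinearGroup.coe_transpose,
    transpose_transpose]

/-- The inverse transpose automorphism of `SL(3, ℝ)`. -/
def dualEquiv : SL(3, ℝ) ≃* SL(3, ℝ) where
  toFun g := (g⁻¹).transpose
  invFun g := (g⁻¹).transpose
  left_inv g := by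
    change (((g⁻¹).transpose)⁻¹).transpose = g
    rw [inv_transpose_inv, transpose_transpose_coe]
  right_inv g := by
    change (((g⁻¹).transpose)⁻¹).transpose = g
    rw [inv_transpose_inv, transpose_transpose_coe]
  map_mul' g h := by
    apply Subtype.ext
    simp [Matrix.SpecialLinearGroup.coe_transpose]

theorem coe_dualEquiv (g : SL(3, ℝ)) :
    (dualEquiv g : Mat3) = ((g⁻¹ : SL(3, ℝ)) : Mat3)ᵀ := rfl

theorem dualEquiv_dualEquiv (g : SL(3, ℝ)) : dualEquiv (dualEquiv g) = g :=
  dualEquiv.left_inv g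

theorem coe_dualEquiv_inv (g : SL(3, ℝ)) :
    (((dualEquiv g)⁻¹ : SL(3, ℝ)) : Mat3) = (g : Mat3)ᵀ := by
  rw [← map_inv, coe_dualEquiv, inv_inv]

/-- The image of `Γ` under the inverse transpose. -/
def dualGroup (Γ : Subgroup SL(3, ℝ)) : Subgroup SL(3, ℝ) := Γ.map dualEquiv.toMonoidHom

theorem mem_dualGroup {Γ : Subgroup SL(3, ℝ)} {g : SL(3, ℝ)} (hg : g ∈ Γ) :
    dualEquiv g ∈ dualGroup Γ := ⟨g, hg, rfl⟩

theorem dualGroup_dualGroup (Γ : Subgroup SL(3, ℝ)) : dualGroup (dualGroup Γ) = Γ := by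
  ext g
  constructor
  · rintro ⟨-, ⟨g, hg, rfl⟩, rfl⟩
    change dualEquiv (dualEquiv g) ∈ Γ
    rw [dualEquiv_dualEquiv]
    exact hg
  · intro hg
    rw [← dualEquiv_dualEquiv g]
    exact mem_dualGroup (mem_dualGroup hg)

theorem IsFlagSet.swap {Γ : Subgroup SL(3, ℝ)} {X : Set (Vec3 × Vec3)} (hX : IsFlagSet Γ X) :
    IsFlagSet (dualGroup Γ) (Prod.swap ⁻¹' X) where
  left_ne h := hX.right_ne h
  right_ne h := hX.left_ne h
  dot h := by rw [dotProduct_comm]; exact hX.dot h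
  smul h _ _ ha hb := hX.smul h hb ha
  inv := by
    rintro p φ h - ⟨g, hg, rfl⟩
    have := hX.inv h hg
    change (φ ᵥ* (((dualEquiv g)⁻¹ : SL(3, ℝ)) : Mat3), (dualEquiv g : Mat3) *ᵥ p) ∈ X
    rw [coe_dualEquiv_inv, coe_dualEquiv, mulVec_transpose, vecMul_transpose]
    exact this
  closed h hp hφ h0 h1 := hX.closed h hφ hp h1 h0

/-! ### From circles to all flags. -/

theorem IsFlagSet.closed_eventually {Γ : Subgroup SL(3, ℝ)} {X : Set (Vec3 × Vec3)}
    (hX : IsFlagSet Γ X) {p φ : ℕ → Vec3} {p' φ' : Vec3} (h : ∀ᶠ n in atTop, (p n, φ n) ∈ X)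
    (hp : Tendsto p atTop (𝓝 p')) (hφ : Tendsto φ atTop (𝓝 φ')) (hp' : p' ≠ 0) (hφ' : φ' ≠ 0) :
    (p', φ') ∈ X := by
  obtain ⟨N, hN⟩ := eventually_atTop.1 h
  exact hX.closed (p := fun n => p (n + N)) (φ := fun n => φ (n + N))
    (fun n => hN _ (Nat.le_add_left N n)) ((tendsto_add_atTop_iff_nat N).2 hp)
    ((tendsto_add_atTop_iff_nat N).2 hφ) hp' hφ'

/-- Being again a flag set is what allows `HasCircle` to be applied repeatedly. -/
theorem IsFlagSet.circles {Γ : Subgroup SL(3, ℝ)} {X : Set (Vec3 × Vec3)} (hX : IsFlagSet Γ X) :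
    IsFlagSet Γ {x | x ∈ X ∧ ∀ p : Vec3, p ≠ 0 → x.2 ⬝ᵥ p = 0 → (p, x.2) ∈ X} where
  left_ne h := hX.left_ne h.1
  right_ne h := hX.right_ne h.1
  dot h := hX.dot h.1
  smul := by
    rintro p φ ⟨h, h'⟩ a b ha hb
    refine ⟨hX.smul h ha hb, fun q hq hqφ => ?_⟩
    have := hX.smul (h' q hq (by simpa [hb] using hqφ)) one_ne_zero hb
    simpa using this
  inv := by
    rintro p φ ⟨h, h'⟩ g hg
    refine ⟨hX.inv h hg, fun q hq hqφ => ?_⟩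
    have h1 := hX.inv (h' (((g⁻¹ : SL(3, ℝ)) : Mat3) *ᵥ q) (mulVec_ne_zero _ hq)
      (by rw [dotProduct_mulVec]; exact hqφ)) hg
    rwa [mulVec_inv_mulVec] at h1
  closed := by
    intro p φ p' φ' h hp hφ hp' hφ'
    refine ⟨hX.closed (fun n => (h n).1) hp hφ hp' hφ', fun q hq hqφ => ?_⟩
    have hc : ∀ n, φ n ≠ 0 := fun n => hX.right_ne (h n).1
    -- A vector q of the limit plane is approximated by its orthogonal projections to the planes `φ
    -- n`.
    have hlim : Tendsto (fun n => q - ((φ n ⬝ᵥ q) / (φ n ⬝ᵥ φ n)) • φ n) atTop (𝓝 q) := by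
      have h1 : Tendsto (fun n => φ n ⬝ᵥ q) atTop (𝓝 (φ' ⬝ᵥ q)) :=
        ((Continuous.dotProduct continuous_id continuous_const).tendsto φ').comp hφ
      have h2 : Tendsto (fun n => φ n ⬝ᵥ φ n) atTop (𝓝 (φ' ⬝ᵥ φ')) :=
        ((Continuous.dotProduct continuous_id continuous_id).tendsto φ').comp hφ
      have h3 := (h1.div h2 (dot_self_pos hφ').ne').smul hφ
      have h4 := (tendsto_const_nhds (x := q)).sub h3
      simp only [hqφ, zero_div, zero_smul, sub_zero] at h4
      exact h4
    refine hX.closed_eventually (p := fun n => q - ((φ n ⬝ᵥ q) / (φ n ⬝ᵥ φ n)) • φ n)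
      (φ := φ) ?_ hlim hφ hq hφ'
    filter_upwards [hlim.eventually_ne hq] with n hn
    refine (h n).2 _ hn ?_
    have := (dot_self_pos (hc n)).ne'
    simp only [dotProduct_sub, dotProduct_smul, smul_eq_mul]
    field_simp
    ring

theorem exists_perp (φ ψ : Vec3) : ∃ p : Vec3, p ≠ 0 ∧ φ ⬝ᵥ p = 0 ∧ ψ ⬝ᵥ p = 0 := by
  obtain ⟨p, hp, h⟩ := Matrix.exists_mulVec_eq_zero_iff.2
    (show (Matrix.of ![φ, ψ, 0] : Mat3).det = 0 from
      Matrix.det_eq_zero_of_row_eq_zero 2 (fun j => rfl))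
  exact ⟨p, hp, congrFun h 0, congrFun h 1⟩

/-- Any flag is joined to a circle over some plane ψ by changing the plane around a line q of ψ, and
then the line inside the new plane. The sets `X₁` and `X₂` record that these two moves stay inside
X. -/
theorem IsFlagSet.mem_of_hasCircle {Γ : Subgroup SL(3, ℝ)} (h1 : HasCircle Γ)
    (h2 : HasCircle (dualGroup Γ)) {X : Set (Vec3 × Vec3)} (hX : IsFlagSet Γ X)
    (hne : X.Nonempty) {p φ : Vec3} (hp : p ≠ 0) (hφ : φ ≠ 0) (h : φ ⬝ᵥ p = 0) :
    (p, φ) ∈ X := by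
  set X₁ := {x | x ∈ X ∧ ∀ p : Vec3, p ≠ 0 → x.2 ⬝ᵥ p = 0 → (p, x.2) ∈ X} with hX₁
  have hF₁ : IsFlagSet Γ X₁ := hX.circles
  have hne₁ : X₁.Nonempty := by
    obtain ⟨ψ, hψ, hc⟩ := h1 X hX hne
    obtain ⟨q, hq, hq1, -⟩ := exists_perp ψ ψ
    exact ⟨(q, ψ), hc q hq hq1, hc⟩
  set X₂ := {x | x ∈ Prod.swap ⁻¹' X₁ ∧
    ∀ p : Vec3, p ≠ 0 → x.2 ⬝ᵥ p = 0 → (p, x.2) ∈ Prod.swap ⁻¹' X₁} with hX₂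
  have hF₂ : IsFlagSet (dualGroup Γ) X₂ := hF₁.swap.circles
  have hne₂ : (Prod.swap ⁻¹' X₂).Nonempty := by
    obtain ⟨x, hx⟩ := hne₁
    obtain ⟨ψ, hψ, hc⟩ := h2 _ hF₁.swap ⟨x.swap, by simpa using hx⟩
    obtain ⟨q, hq, hq1, -⟩ := exists_perp ψ ψ
    exact ⟨(ψ, q), hc q hq hq1, hc⟩
  have hF₃ := hF₂.swap
  rw [dualGroup_dualGroup] at hF₃
  obtain ⟨ψ, hψ, hc⟩ := h1 _ hF₃ hne₂
  -- Two planes in ℝ³ always share a line.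
  obtain ⟨q, hq, hq1, hq2⟩ := exists_perp ψ φ
  have h3 := hc q hq hq1
  have h4 : (q, φ) ∈ X₁ := h3.2 φ hφ (by rw [dotProduct_comm]; exact hq2)
  exact h4.2 p hp h

/-! ### Identification of G/P with the space of flags. -/

/-- The cone over the set of flags corresponding to a subset of `G/P`. -/
def flagCone (Y : Set (SL(3, ℝ) ⧸ minimalParabolic)) : Set (Vec3 × Vec3) :=
  {x | x.1 ≠ 0 ∧ x.2 ≠ 0 ∧ x.2 ⬝ᵥ x.1 = 0 ∧ ∃ g : SL(3, ℝ), (g : SL(3, ℝ) ⧸ minimalParabolic) ∈ Y ∧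
    ∃ a b : ℝ, a ≠ 0 ∧ b ≠ 0 ∧ (g : Mat3) *ᵥ ![1, 0, 0] = a • x.1 ∧
      ![0, 0, 1] ᵥ* ((g⁻¹ : SL(3, ℝ)) : Mat3) = b • x.2}

/-- A matrix whose first column is a multiple of the first basis vector and whose last row is a
multiple of the last coordinate form is upper triangular. -/
theorem mk_eq_mk_of_flag_eq {g h : SL(3, ℝ)} {a b : ℝ} (hb : b ≠ 0)
    (h1 : (h : Mat3) *ᵥ ![1, 0, 0] = a • (g : Mat3) *ᵥ ![1, 0, 0])
    (h2 : ![0, 0, 1] ᵥ* ((h⁻¹ : SL(3, ℝ)) : Mat3) = b • ![0, 0, 1] ᵥ* ((g⁻¹ : SL(3, ℝ)) : Mat3)) :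
    (g : SL(3, ℝ) ⧸ minimalParabolic) = h := by
  rw [QuotientGroup.eq]
  have e1 : ((g⁻¹ * h : SL(3, ℝ)) : Mat3) *ᵥ ![1, 0, 0] = a • ![1, 0, 0] := by
    rw [Matrix.SpecialLinearGroup.coe_mul, ← mulVec_mulVec, h1, mulVec_smul, inv_mulVec_mulVec]
  have e2 : b • (![0, 0, 1] ᵥ* ((g⁻¹ * h : SL(3, ℝ)) : Mat3)) = ![0, 0, 1] := by
    rw [Matrix.SpecialLinearGroup.coe_mul, ← vecMul_vecMul, ← smul_vecMul, ← h2,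
      vecMul_inv_vecMul]
  generalize (g⁻¹ * h : SL(3, ℝ)) = k at e1 e2
  intro i j hij
  have hji : i = 1 ∧ j = 0 ∨ i = 2 ∧ j = 0 ∨ i = 2 ∧ j = 1 := by
    revert i j; decide
  rcases hji with ⟨rfl, rfl⟩ | ⟨rfl, rfl⟩ | ⟨rfl, rfl⟩
  · simpa [mulVec, dotProduct, Fin.sum_univ_three] using congrFun e1 1
  · simpa [mulVec, dotProduct, Fin.sum_univ_three] using congrFun e1 2
  · simpa [vecMul, dotProduct, Fin.sum_univ_three, hb] using congrFun e2 1

theorem mk_mem_of_mem_flagCone {Y : Set (SL(3, ℝ) ⧸ minimalParabolic)} {p φ : Vec3}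
    (h : (p, φ) ∈ flagCone Y) {g : SL(3, ℝ)} {a b : ℝ} (hb : b ≠ 0)
    (h1 : (g : Mat3) *ᵥ ![1, 0, 0] = a • p)
    (h2 : ![0, 0, 1] ᵥ* ((g⁻¹ : SL(3, ℝ)) : Mat3) = b • φ) :
    (g : SL(3, ℝ) ⧸ minimalParabolic) ∈ Y := by
  obtain ⟨-, -, -, k, hk, c, d, hc, hd, h3, h4⟩ := h
  have := mk_eq_mk_of_flag_eq (g := k) (h := g) (a := a * c⁻¹) (b := b * d⁻¹)
    (mul_ne_zero hb (inv_ne_zero hd))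
    (by rw [h3, h1, smul_smul, mul_assoc, inv_mul_cancel₀ hc, mul_one])
    (by rw [h4, h2, smul_smul, mul_assoc, inv_mul_cancel₀ hd, mul_one])
  rwa [← this]

theorem isFlagSet_flagCone {Γ : Subgroup SL(3, ℝ)} {Y : Set (SL(3, ℝ) ⧸ minimalParabolic)}
    (hY : IsClosed Y) (hinv : ∀ γ ∈ Γ, ∀ y ∈ Y, γ • y ∈ Y) : IsFlagSet Γ (flagCone Y) where
  left_ne h := h.1
  right_ne h := h.2.1
  dot h := h.2.2.1
  smul := by
    rintro p φ ⟨h1, h2, h3, g, hg, c, d, hc, hd, h4, h5⟩ a b ha hb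
    refine ⟨smul_ne_zero ha h1, smul_ne_zero hb h2, by simp_all, g, hg, c * a⁻¹, d * b⁻¹,
      mul_ne_zero hc (inv_ne_zero ha), mul_ne_zero hd (inv_ne_zero hb), ?_, ?_⟩
    · rw [h4, smul_smul, mul_assoc, inv_mul_cancel₀ ha, mul_one]
    · rw [h5, smul_smul, mul_assoc, inv_mul_cancel₀ hb, mul_one]
  inv := by
    rintro p φ ⟨h1, h2, h3, k, hk, c, d, hc, hd, h4, h5⟩ g hg
    refine ⟨mulVec_ne_zero _ h1, vecMul_ne_zero _ h2, ?_, g * k, hinv g hg _ hk, c, d, hc, hd,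
      ?_, ?_⟩
    · change (φ ᵥ* ((g⁻¹ : SL(3, ℝ)) : Mat3)) ⬝ᵥ ((g : Mat3) *ᵥ p) = 0
      rw [← dotProduct_mulVec, inv_mulVec_mulVec]
      exact h3
    · rw [Matrix.SpecialLinearGroup.coe_mul, ← mulVec_mulVec, h4, mulVec_smul]
    · rw [_root_.mul_inv_rev, Matrix.SpecialLinearGroup.coe_mul, ← vecMul_vecMul, h5, smul_vecMul]
  closed := by
    intro p φ p' φ' h hp hφ hp' hφ'
    have hdot : φ' ⬝ᵥ p' = 0 := by
      have h1 : Tendsto (fun n => φ n ⬝ᵥ p n) atTop (𝓝 (φ' ⬝ᵥ p')) :=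
        ((Continuous.dotProduct continuous_fst continuous_snd).tendsto (φ', p')).comp
          (hφ.prodMk_nhds hp)
      refine tendsto_nhds_unique h1 ?_
      simp only [(h _).2.2.1]
      exact tendsto_const_nhds
    obtain ⟨k, hk, hk1, hk2⟩ := exists_flag_map hp' hφ' hdot
    choose g hg hg1 hg2 using fun n => exists_flag_map (h n).1 (h n).2.1 (h n).2.2.1
    refine ⟨hp', hφ', hdot, k, ?_, 1, _, one_ne_zero, (dot_self_pos hp').ne',
      by rw [one_smul]; exact hk1, hk2⟩
    -- `flagMatrix` is a continuous lift from pairs (p, φ) to matrices, so convergence of flags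
    -- gives convergence of cosets.
    have hlim : Tendsto g atTop (𝓝 k) := by
      refine tendsto_subtype_rng.2 ?_
      have h1 : Tendsto (fun n => flagMatrix (p n) (φ n)) atTop (𝓝 (flagMatrix p' φ')) :=
        (continuousAt_flagMatrix hp' hφ').tendsto.comp (hp.prodMk_nhds hφ)
      have e : (fun n => (g n).1) = fun n => flagMatrix (p n) (φ n) := funext hg
      rw [e]
      rw [hk]
      exact h1
    have hlim' : Tendsto (fun n => (g n : SL(3, ℝ) ⧸ minimalParabolic)) atTop (𝓝 k) :=
      (QuotientGroup.continuous_mk.tendsto k).comp hlim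
    refine hY.mem_of_tendsto hlim' (Eventually.of_forall fun n => ?_)
    exact mk_mem_of_mem_flagCone (h n) (dot_self_pos (h n).1).ne'
      (by rw [one_smul]; exact hg1 n) (hg2 n)

theorem isMinimal_of_hasCircle {Γ : Subgroup SL(3, ℝ)} (h1 : HasCircle Γ)
    (h2 : HasCircle (dualGroup Γ)) : MulAction.IsMinimal Γ (SL(3, ℝ) ⧸ minimalParabolic) := by
  refine ⟨fun x => ?_⟩
  set Y := closure (MulAction.orbit Γ x) with hYdef
  have hinv : ∀ γ ∈ Γ, ∀ y ∈ Y, γ • y ∈ Y := by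
    intro γ hγ y hy
    have hc : Continuous fun z : SL(3, ℝ) ⧸ minimalParabolic => γ • z := continuous_const_smul γ
    refine map_mem_closure hc hy ?_
    rintro - ⟨δ, rfl⟩
    exact ⟨⟨γ, hγ⟩ * δ, mul_smul _ _ _⟩
  have hX := isFlagSet_flagCone isClosed_closure hinv
  have key : ∀ g : SL(3, ℝ), (g : Mat3) *ᵥ ![1, 0, 0] ≠ 0 ∧
      ![0, 0, 1] ᵥ* ((g⁻¹ : SL(3, ℝ)) : Mat3) ≠ 0 ∧
      (![0, 0, 1] ᵥ* ((g⁻¹ : SL(3, ℝ)) : Mat3)) ⬝ᵥ ((g : Mat3) *ᵥ ![1, 0, 0]) = 0 := by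
    intro g
    refine ⟨mulVec_ne_zero _ (by simp), vecMul_ne_zero _ (by simp), ?_⟩
    rw [← dotProduct_mulVec, inv_mulVec_mulVec]
    simp [dotProduct, Fin.sum_univ_three]
  intro y
  change y ∈ Y
  obtain ⟨g, rfl⟩ := QuotientGroup.mk_surjective y
  refine mk_mem_of_mem_flagCone (hX.mem_of_hasCircle h1 h2 ?_ (key g).1 (key g).2.1 (key g).2.2)
    one_ne_zero (one_smul ℝ _).symm (one_smul ℝ _).symm
  obtain ⟨k, rfl⟩ := QuotientGroup.mk_surjective x
  exact ⟨((k : Mat3) *ᵥ ![1, 0, 0], ![0, 0, 1] ᵥ* ((k⁻¹ : SL(3, ℝ)) : Mat3)), (key k).1, (key k).2.1, (key k).2.2, k,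
    subset_closure (MulAction.mem_orbit_self _), 1, 1, one_ne_zero, one_ne_zero,
    by rw [one_smul], by rw [one_smul]⟩

/-! ### Homomorphisms from ℤ² to ℝ. -/

theorem addMonoidHom_int_prod_apply (ψ : ℤ × ℤ →+ ℝ) (w : ℤ × ℤ) :
    ψ w = w.1 * ψ (1, 0) + w.2 * ψ (0, 1) := by
  have h : w = w.1 • ((1, 0) : ℤ × ℤ) + w.2 • ((0, 1) : ℤ × ℤ) := by ext <;> simp
  conv_lhs => rw [h, map_add, map_zsmul, map_zsmul, zsmul_eq_mul, zsmul_eq_mul]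

/-- A homomorphism from `ℤ²` to `ℝ` takes arbitrarily small values infinitely often. -/
theorem infinite_setOf_abs_le (ψ : ℤ × ℤ →+ ℝ) {ε : ℝ} (hε : 0 < ε) :
    {w | |ψ w| ≤ ε}.Infinite := by
  -- Some bounded interval has infinitely many preimages: for each first coordinate n, rounding
  -- supplies a second coordinate that keeps ψ bounded.
  have hbdd : ∃ C : ℝ, {w | |ψ w| ≤ C}.Infinite := by
    by_cases hb : ψ (0, 1) = 0
    · refine ⟨0, Set.infinite_of_injective_forall_mem (f := fun n : ℤ => ((0 : ℤ), n)) ?_ ?_⟩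
      · intro m n h
        simpa using h
      · intro n
        simp [addMonoidHom_int_prod_apply ψ (0, n), hb]
    · refine ⟨|ψ (0, 1)|, Set.infinite_of_injective_forall_mem
        (f := fun n : ℤ => (n, -round (n * ψ (1, 0) / ψ (0, 1)))) ?_ ?_⟩
      · intro m n h
        simpa using congrArg Prod.fst h
      · intro n
        have h1 := abs_sub_round (n * ψ (1, 0) / ψ (0, 1))
        have h2 : ψ (n, -round (n * ψ (1, 0) / ψ (0, 1))) =
            (n * ψ (1, 0) / ψ (0, 1) - round (n * ψ (1, 0) / ψ (0, 1))) * ψ (0, 1) := by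
          rw [addMonoidHom_int_prod_apply]
          push_cast
          field_simp
          ring
        change |ψ _| ≤ _
        rw [h2, abs_mul]
        nlinarith [abs_nonneg (ψ (0, 1))]
  obtain ⟨C, hC⟩ := hbdd
  by_contra hfin
  rw [Set.not_infinite] at hfin
  apply hC
  -- Pigeonhole: two points in the same bin of width ε have a difference w with |ψ w| ≤ ε, so
  -- finitely many small values would make every bin finite.
  have hsub : {w | |ψ w| ≤ C} ⊆ ⋃ j ∈ Finset.Icc ⌊-C / ε⌋ ⌊C / ε⌋,
      {w | |ψ w| ≤ C ∧ ⌊ψ w / ε⌋ = j} := by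
    intro w hw
    have hw' : -C ≤ ψ w ∧ ψ w ≤ C := abs_le.1 hw
    simp only [Set.mem_iUnion, Finset.mem_Icc, Set.mem_ofPred_eq]
    refine ⟨⌊ψ w / ε⌋, ⟨Int.floor_le_floor ?_, Int.floor_le_floor ?_⟩, hw, rfl⟩
    · exact div_le_div_of_nonneg_right hw'.1 hε.le
    · exact div_le_div_of_nonneg_right hw'.2 hε.le
  refine (Set.Finite.biUnion (Finset.finite_toSet _) fun j _ => ?_).subset hsub
  rcases Set.eq_empty_or_nonempty {w | |ψ w| ≤ C ∧ ⌊ψ w / ε⌋ = j} with h | ⟨w₀, hw₀⟩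
  · rw [h]; exact Set.finite_empty
  · refine (hfin.image fun w => w + w₀).subset fun w hw => ⟨w - w₀, ?_, by simp⟩
    have h1 := Int.floor_le (ψ w / ε)
    have h2 := Int.lt_floor_add_one (ψ w / ε)
    have h3 := Int.floor_le (ψ w₀ / ε)
    have h4 := Int.lt_floor_add_one (ψ w₀ / ε)
    rw [hw.2] at h1 h2
    rw [hw₀.2] at h3 h4
    rw [le_div_iff₀ hε] at h1 h3
    rw [div_lt_iff₀ hε] at h2 h4
    change |ψ (w - w₀)| ≤ ε
    rw [map_sub, abs_le]
    constructor <;> linarith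

/-- An injective homomorphism `u` from `ℤ²` to `ℝ` takes values close to any given number at
points where a second homomorphism `s`, properly independent of `u`, is large. -/
theorem exists_near_and_large (u s : ℤ × ℤ →+ ℝ) (hu : ∀ w, u w = 0 → w = 0)
    (hfin : ∀ C, {w | |u w| ≤ C ∧ |s w| ≤ C}.Finite) (x : ℝ) {ε : ℝ} (hε : 0 < ε) (M : ℝ) :
    ∃ w, |u w - x| < ε ∧ M < s w := by
  -- Multiples of a nonzero small value of u come close to every real number.
  have hd : ∃ d, |u d - x| ≤ ε / 4 := by
    obtain ⟨e, he, he0⟩ : ∃ e, |u e| ≤ ε / 4 ∧ e ≠ 0 := by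
      by_contra! hc
      exact infinite_setOf_abs_le u (show 0 < ε / 4 by linarith)
        ((Set.finite_singleton 0).subset fun w hw => hc w hw)
    have hue : u e ≠ 0 := fun h => he0 (hu e h)
    refine ⟨round (x / u e) • e, ?_⟩
    have h1 := abs_sub_round (x / u e)
    have h2 : u (round (x / u e) • e) - x = -((x / u e - round (x / u e)) * u e) := by
      rw [map_zsmul, zsmul_eq_mul]
      field_simp
      ring
    rw [h2, abs_neg, abs_mul]
    nlinarith [abs_nonneg (u e)]
  obtain ⟨d, hd⟩ := hd
  -- Among the infinitely many e with u e small, properness forces |s e| to be large. Adding or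
  -- subtracting e, according to the sign of s e, barely moves u.
  obtain ⟨e, he1, he2⟩ : ∃ e, |u e| ≤ ε / 4 ∧ |M| + |s d| < |s e| := by
    by_contra! hc
    refine infinite_setOf_abs_le u (show 0 < ε / 4 by linarith)
      ((hfin (max (ε / 4) (|M| + |s d|))).subset fun w hw => ⟨?_, ?_⟩)
    · exact le_trans hw (le_max_left _ _)
    · exact le_trans (hc w hw) (le_max_right _ _)
  have h3 := le_abs_self M
  have h4 := neg_abs_le (s d)
  rw [abs_le] at hd he1
  rcases le_total 0 (s e) with h | h
  · rw [abs_of_nonneg h] at he2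
    refine ⟨d + e, ?_, ?_⟩
    · rw [map_add, abs_lt]; constructor <;> linarith
    · rw [map_add]; linarith
  · rw [abs_of_nonpos h] at he2
    refine ⟨d - e, ?_, ?_⟩
    · rw [map_sub, abs_lt]; constructor <;> linarith
    · rw [map_sub]; linarith

theorem exists_seq_tendsto_atTop (u s : ℤ × ℤ →+ ℝ) (hu : ∀ w, u w = 0 → w = 0)
    (hfin : ∀ C, {w | |u w| ≤ C ∧ |s w| ≤ C}.Finite) (x : ℝ) :
    ∃ w : ℕ → ℤ × ℤ, Tendsto (fun n => u (w n)) atTop (𝓝 x) ∧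
      Tendsto (fun n => s (w n)) atTop atTop := by
  choose w hw1 hw2 using fun n : ℕ => exists_near_and_large u s hu hfin x
    (show (0 : ℝ) < 1 / (n + 1) by positivity) n
  refine ⟨w, ?_, ?_⟩
  · rw [tendsto_iff_dist_tendsto_zero]
    refine squeeze_zero (fun _ => dist_nonneg) (fun n => ?_)
      tendsto_one_div_add_atTop_nhds_zero_nat
    rw [Real.dist_eq]
    exact (hw1 n).le
  · exact tendsto_atTop_mono (fun n => (hw2 n).le) tendsto_natCast_atTop_atTop

/-! ### Discrete planes, their duals and conjugates. -/

/-- A homomorphism from `ℤ²` onto a discrete subgroup of `Γ` without nontrivial elements that are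
annihilated by a real quadratic polynomial with distinct real roots. -/
structure IsDiscretePlane (Γ : Subgroup SL(3, ℝ)) (D : ℤ × ℤ → SL(3, ℝ)) : Prop where
  mem : ∀ w, D w ∈ Γ
  add : ∀ v w, D (v + w) = D v * D w
  fin : ∀ C : ℝ, {w | ∀ i j, |(D w : Mat3) i j| ≤ C}.Finite
  regular : ∀ w (a b : ℝ), a ≠ b →
    (D w : Mat3) * (D w : Mat3) - (a + b) • (D w : Mat3) + (a * b) • (1 : Mat3) = 0 → w = 0

theorem exists_bound_of_continuous {F : Mat3 → Mat3} (hF : Continuous F) (C : ℝ) :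
    ∃ C' : ℝ, ∀ M : Mat3, (∀ i j, |M i j| ≤ C) → ∀ i j, |F M i j| ≤ C' := by
  have hK : IsCompact (Set.pi Set.univ fun _ : Fin 3 =>
      Set.pi Set.univ fun _ : Fin 3 => Set.Icc (-C) C) :=
    isCompact_univ_pi fun _ => isCompact_univ_pi fun _ => isCompact_Icc
  have hc : Continuous fun M : Fin 3 → Fin 3 → ℝ => ∑ i, ∑ j, |F M i j| :=
    continuous_finsetSum _ fun i _ => continuous_finsetSum _ fun j _ =>
      (hF.matrix_elem i j).abs
  obtain ⟨C', hC'⟩ := hK.bddAbove_image hc.continuousOn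
  refine ⟨C', fun M hM i j => ?_⟩
  have h1 := hC' ⟨M, fun i _ j _ => abs_le.1 (hM i j), rfl⟩
  refine le_trans ?_ h1
  refine le_trans ?_ (Finset.single_le_sum (f := fun i => ∑ j, |F M i j|)
    (fun i _ => Finset.sum_nonneg fun j _ => abs_nonneg _) (Finset.mem_univ i))
  exact Finset.single_le_sum (f := fun j => |F M i j|) (fun j _ => abs_nonneg _)
    (Finset.mem_univ j)

/-- `F` recovers g continuously from θ g, so a bounded set of images comes from a bounded set of
elements. `hreg` pulls the forbidden quadratic relation back. -/
theorem IsDiscretePlane.map {Γ : Subgroup SL(3, ℝ)} {D : ℤ × ℤ → SL(3, ℝ)}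
    (h : IsDiscretePlane Γ D) (θ : SL(3, ℝ) ≃* SL(3, ℝ)) {F : Mat3 → Mat3} (hF : Continuous F)
    (hθ : ∀ g : SL(3, ℝ), (g : Mat3) = F (θ g))
    (hreg : ∀ (g : SL(3, ℝ)) (a b : ℝ), a ≠ b →
      (θ g : Mat3) * (θ g : Mat3) - (a + b) • (θ g : Mat3) + (a * b) • (1 : Mat3) = 0 →
      ∃ c d : ℝ, c ≠ d ∧ (g : Mat3) * (g : Mat3) - (c + d) • (g : Mat3) + (c * d) • (1 : Mat3) = 0) :
    IsDiscretePlane (Γ.map θ.toMonoidHom) (fun w => θ (D w)) where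
  mem w := ⟨D w, h.mem w, rfl⟩
  add v w := by rw [h.add, map_mul]
  fin C := by
    obtain ⟨C', hC'⟩ := exists_bound_of_continuous hF C
    refine (h.fin C').subset fun w hw => ?_
    intro i j
    rw [hθ]
    exact hC' _ hw i j
  regular w a b hab hw := by
    obtain ⟨c, d, hcd, h'⟩ := hreg _ a b hab hw
    exact h.regular w c d hcd h'

theorem IsDiscretePlane.dual {Γ : Subgroup SL(3, ℝ)} {D : ℤ × ℤ → SL(3, ℝ)}
    (h : IsDiscretePlane Γ D) : IsDiscretePlane (dualGroup Γ) (fun w => dualEquiv (D w)) := by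
  refine h.map dualEquiv (F := fun M => (adjugate M)ᵀ)
    (Continuous.matrix_transpose (Continuous.matrix_adjugate continuous_id)) ?_ ?_
  · intro g
    rw [← Matrix.SpecialLinearGroup.coe_inv, coe_dualEquiv_inv, transpose_transpose]
  · intro g a b hab hg
    have h1 : ((g⁻¹ : SL(3, ℝ)) : Mat3) * ((g⁻¹ : SL(3, ℝ)) : Mat3) -
        (a + b) • ((g⁻¹ : SL(3, ℝ)) : Mat3) + (a * b) • (1 : Mat3) = 0 := by
      have := congrArg transpose hg
      rw [coe_dualEquiv] at this
      simpa using this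
    have h2 : (1 : Mat3) - (a + b) • (g : Mat3) + (a * b) • ((g : Mat3) * (g : Mat3)) = 0 := by
      have e : (((g⁻¹ : SL(3, ℝ)) : Mat3) * ((g⁻¹ : SL(3, ℝ)) : Mat3) -
        (a + b) • ((g⁻¹ : SL(3, ℝ)) : Mat3) + (a * b) • (1 : Mat3)) * ((g : Mat3) * (g : Mat3)) =
          0 := by rw [h1, zero_mul]
      have e2 : ((g⁻¹ : SL(3, ℝ)) : Mat3) * ((g : Mat3) * (g : Mat3)) = g := by
        rw [← mul_assoc, coe_inv_mul_coe, one_mul]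
      rw [add_mul, sub_mul, mul_assoc, smul_mul_assoc, smul_mul_assoc, e2, one_mul,
        coe_inv_mul_coe] at e
      exact e
    -- The annihilating roots of g are the reciprocals of a and b. If one of a, b is zero, g is
    -- scalar, and c⁻¹ + 1 serves as an arbitrary second root.
    have hscal : ∀ c : ℝ, c ≠ 0 → (1 : Mat3) - c • (g : Mat3) = 0 → ∃ c d : ℝ, c ≠ d ∧
        (g : Mat3) * (g : Mat3) - (c + d) • (g : Mat3) + (c * d) • (1 : Mat3) = 0 := by
      intro c hc h3
      have h4 : (g : Mat3) = c⁻¹ • (1 : Mat3) := by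
        rw [sub_eq_zero.1 h3, smul_smul, inv_mul_cancel₀ hc, one_smul]
      refine ⟨c⁻¹, c⁻¹ + 1, by simp, ?_⟩
      rw [h4]
      simp only [smul_mul_assoc, mul_smul_comm, one_mul, smul_smul]
      rw [← sub_smul, ← add_smul]
      ring_nf
      simp
    rcases eq_or_ne a 0 with rfl | ha
    · exact hscal b hab.symm (by simpa using h2)
    rcases eq_or_ne b 0 with rfl | hb
    · exact hscal a hab (by simpa using h2)
    refine ⟨a⁻¹, b⁻¹, fun h => hab (inv_injective h), ?_⟩
    have h3 : (a * b)⁻¹ • ((1 : Mat3) - (a + b) • (g : Mat3) +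
        (a * b) • ((g : Mat3) * (g : Mat3))) = 0 := by rw [h2, smul_zero]
    rw [smul_add, smul_sub, smul_smul, smul_smul, inv_mul_cancel₀ (mul_ne_zero ha hb),
      one_smul] at h3
    rw [← h3]
    have e1 : (a * b)⁻¹ * (a + b) = a⁻¹ + b⁻¹ := by field_simp; ring
    rw [e1, ← mul_inv]
    abel

theorem isZariskiDense_dualGroup {Γ : Subgroup SL(3, ℝ)}
    (h : IsZariskiDense (Γ : Set SL(3, ℝ))) : IsZariskiDense (dualGroup Γ : Set SL(3, ℝ)) :=
  h.map dualEquiv fun i j => inv_entry_mem_polyFun j i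

/-- The conjugate `B⁻¹ Γ B`. -/
def conjGroup (B : SL(3, ℝ)) (Γ : Subgroup SL(3, ℝ)) : Subgroup SL(3, ℝ) :=
  Γ.map (MulAut.conj B⁻¹).toMonoidHom

theorem conj_inv_apply (B g : SL(3, ℝ)) : MulAut.conj B⁻¹ g = B⁻¹ * g * B := by simp

theorem isZariskiDense_conjGroup (B : SL(3, ℝ)) {Γ : Subgroup SL(3, ℝ)}
    (h : IsZariskiDense (Γ : Set SL(3, ℝ))) : IsZariskiDense (conjGroup B Γ : Set SL(3, ℝ)) := by
  refine h.map (MulAut.conj B⁻¹) fun i j => ?_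
  simp only [conj_inv_apply, Matrix.SpecialLinearGroup.coe_mul]
  refine sum_mem_polyFun Finset.univ
    (f := fun k g => (((B⁻¹ : SL(3, ℝ)) : Mat3) * (g : Mat3)) i k * (B : Mat3) k j)
    fun k _ => mul_mem_polyFun ?_ (const_mem_polyFun _)
  exact sum_mem_polyFun Finset.univ
    (f := fun l g => ((B⁻¹ : SL(3, ℝ)) : Mat3) i l * (g : Mat3) l k)
    fun l _ => mul_mem_polyFun (const_mem_polyFun _) (entry_mem_polyFun _ _)

theorem IsDiscretePlane.conj (B : SL(3, ℝ)) {Γ : Subgroup SL(3, ℝ)} {D : ℤ × ℤ → SL(3, ℝ)}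
    (h : IsDiscretePlane Γ D) : IsDiscretePlane (conjGroup B Γ) (fun w => B⁻¹ * D w * B) := by
  have hB : ∀ M : Mat3, (B : Mat3) * (((B⁻¹ : SL(3, ℝ)) : Mat3) * M * (B : Mat3)) *
      ((B⁻¹ : SL(3, ℝ)) : Mat3) = M := by
    intro M
    rw [mul_assoc, mul_assoc, mul_assoc, coe_mul_coe_inv, mul_one, ← mul_assoc, coe_mul_coe_inv,
      one_mul]
  have e := h.map (MulAut.conj B⁻¹)
    (F := fun M => (B : Mat3) * M * ((B⁻¹ : SL(3, ℝ)) : Mat3)) (by fun_prop) ?_ ?_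
  · simp only [conj_inv_apply] at e
    exact e
  · intro g
    rw [conj_inv_apply, Matrix.SpecialLinearGroup.coe_mul, Matrix.SpecialLinearGroup.coe_mul,
      hB]
  · intro g a b hab hg
    refine ⟨a, b, hab, ?_⟩
    have h1 := congrArg (fun M => (B : Mat3) * M * ((B⁻¹ : SL(3, ℝ)) : Mat3)) hg
    simp only [conj_inv_apply, Matrix.SpecialLinearGroup.coe_mul] at h1
    rw [mul_zero, zero_mul] at h1
    rw [← h1]
    set b' := ((B⁻¹ : SL(3, ℝ)) : Mat3)
    have e1 : (B : Mat3) * b' = 1 := coe_mul_coe_inv B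
    have e2 : ∀ M : Mat3, (B : Mat3) * (b' * M) = M := fun M => by rw [← mul_assoc, e1, one_mul]
    simp only [mul_add, add_mul, mul_sub, sub_mul, smul_mul_assoc, mul_smul_comm, mul_assoc, e1,
      e2, mul_one]

theorem hasCircle_of_conjGroup (B : SL(3, ℝ)) {Γ : Subgroup SL(3, ℝ)}
    (h : HasCircle (conjGroup B Γ)) : HasCircle Γ := by
  intro X hX hne
  have hX' : IsFlagSet (conjGroup B Γ)
      {x | ((B : Mat3) *ᵥ x.1, x.2 ᵥ* ((B⁻¹ : SL(3, ℝ)) : Mat3)) ∈ X} :=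
    { left_ne := fun {p φ} hp h0 => hX.left_ne hp (by simp [h0])
      right_ne := fun {p φ} hp h0 => hX.right_ne hp (by simp [h0])
      dot := fun {p φ} hp => by
        have := hX.dot hp
        rwa [← dotProduct_mulVec, inv_mulVec_mulVec] at this
      smul := fun {p φ} hp {a b} ha hb => by
        have := hX.smul hp ha hb
        change ((B : Mat3) *ᵥ (a • p), (b • φ) ᵥ* ((B⁻¹ : SL(3, ℝ)) : Mat3)) ∈ X
        rwa [mulVec_smul, smul_vecMul]
      inv := by
        rintro p φ hp - ⟨g, hg, rfl⟩
        have := hX.inv hp hg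
        change ((B : Mat3) *ᵥ ((MulAut.conj B⁻¹ g : SL(3, ℝ)) : Mat3) *ᵥ p,
          (φ ᵥ* (((MulAut.conj B⁻¹ g)⁻¹ : SL(3, ℝ)) : Mat3)) ᵥ* ((B⁻¹ : SL(3, ℝ)) : Mat3)) ∈ X
        have e : B * MulAut.conj B⁻¹ g = g * B := by rw [conj_inv_apply]; group
        have e' : (MulAut.conj B⁻¹ g)⁻¹ * B⁻¹ = B⁻¹ * g⁻¹ := by rw [conj_inv_apply]; group
        rw [mulVec_mulVec, vecMul_vecMul, ← Matrix.SpecialLinearGroup.coe_mul,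
          ← Matrix.SpecialLinearGroup.coe_mul, e, e', Matrix.SpecialLinearGroup.coe_mul,
          Matrix.SpecialLinearGroup.coe_mul, ← mulVec_mulVec, ← vecMul_vecMul]
        exact this
      closed := by
        intro p φ p' φ' h1 hp hφ hp' hφ'
        refine hX.closed h1 ?_ ?_ (mulVec_ne_zero _ hp') (vecMul_ne_zero _ hφ')
        · exact ((Continuous.matrix_mulVec continuous_const continuous_id).tendsto p').comp hp
        · exact ((Continuous.matrix_vecMul continuous_id continuous_const).tendsto φ').comp hφ }
  obtain ⟨⟨p, φ⟩, hp⟩ := hne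
  obtain ⟨ψ, hψ, hc⟩ := h _ hX' ⟨(((B⁻¹ : SL(3, ℝ)) : Mat3) *ᵥ p, φ ᵥ* (B : Mat3)), by
    change ((B : Mat3) *ᵥ (((B⁻¹ : SL(3, ℝ)) : Mat3) *ᵥ p),
      (φ ᵥ* (B : Mat3)) ᵥ* ((B⁻¹ : SL(3, ℝ)) : Mat3)) ∈ X
    rwa [mulVec_inv_mulVec, vecMul_vecMul_inv]⟩
  refine ⟨_, vecMul_ne_zero B⁻¹ hψ, fun q hq hqψ => ?_⟩
  have := hc (((B⁻¹ : SL(3, ℝ)) : Mat3) *ᵥ q) (mulVec_ne_zero _ hq)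
    (by rw [dotProduct_mulVec]; exact hqψ)
  change ((B : Mat3) *ᵥ (((B⁻¹ : SL(3, ℝ)) : Mat3) *ᵥ q), ψ ᵥ* ((B⁻¹ : SL(3, ℝ)) : Mat3)) ∈ X
    at this
  rwa [mulVec_inv_mulVec] at this

theorem IsFlagSet.of_smul {Γ : Subgroup SL(3, ℝ)} {X : Set (Vec3 × Vec3)} (hX : IsFlagSet Γ X)
    {p φ : Vec3} {a b : ℝ} (ha : a ≠ 0) (hb : b ≠ 0) (h : (a • p, b • φ) ∈ X) : (p, φ) ∈ X := by
  have := hX.smul h (inv_ne_zero ha) (inv_ne_zero hb)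
  rwa [smul_smul, smul_smul, inv_mul_cancel₀ ha, inv_mul_cancel₀ hb, one_smul, one_smul] at this

theorem mulVec_apply_three (M : Mat3) (p : Vec3) (i : Fin 3) :
    (M *ᵥ p) i = M i 0 * p 0 + M i 1 * p 1 + M i 2 * p 2 := by
  simp [mulVec, dotProduct, Fin.sum_univ_three]

theorem vecMul_apply_three (φ : Vec3) (M : Mat3) (i : Fin 3) :
    (φ ᵥ* M) i = φ 0 * M 0 i + φ 1 * M 1 i + φ 2 * M 2 i := by
  simp [vecMul, dotProduct, Fin.sum_univ_three]

/-- Fills in the exceptional points of a circle that a limiting argument misses, since X is closed.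
-/
theorem IsFlagSet.mem_of_perturb {Γ : Subgroup SL(3, ℝ)} {X : Set (Vec3 × Vec3)}
    (hX : IsFlagSet Γ X) {p φ d : Vec3} (hp : p ≠ 0) (hφ : φ ≠ 0)
    (h : ∀ ε : ℝ, 0 < ε → p + ε • d ≠ 0 → (p + ε • d, φ) ∈ X) : (p, φ) ∈ X := by
  have h1 : Tendsto (fun n : ℕ => p + (1 / ((n : ℝ) + 1)) • d) atTop (𝓝 p) := by
    have := (tendsto_const_nhds (x := p)).add
      ((tendsto_one_div_add_atTop_nhds_zero_nat (𝕜 := ℝ)).smul_const d)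
    simpa using this
  refine hX.closed_eventually (φ := fun _ => φ) ?_ h1 tendsto_const_nhds hp hφ
  filter_upwards [h1.eventually_ne hp] with n hn
  exact h _ (by positivity) hn

theorem tendsto_round_div (x : ℝ) :
    Tendsto (fun n : ℕ => (round (((n : ℝ) + 1) * x) : ℝ) / ((n : ℝ) + 1)) atTop (𝓝 x) := by
  rw [tendsto_iff_dist_tendsto_zero]
  refine squeeze_zero (fun _ => dist_nonneg) (fun n => ?_)
    tendsto_one_div_add_atTop_nhds_zero_nat
  have h0 : (0 : ℝ) < n + 1 := by positivity
  have h1 := abs_sub_round (((n : ℝ) + 1) * x)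
  rw [Real.dist_eq, show (round (((n : ℝ) + 1) * x) : ℝ) / ((n : ℝ) + 1) - x =
    -((((n : ℝ) + 1) * x - round (((n : ℝ) + 1) * x)) / ((n : ℝ) + 1)) by field_simp; ring,
    abs_neg, abs_div, abs_of_pos h0]
  gcongr
  linarith

/-! ### Translations, and discrete planes containing a nontrivial shear. -/

/-- Taking w near nq with n → ∞ moves a general line to the direction q. The plane tends to z = 0
whenever q lies outside the initial plane; the remaining q are limits of such directions. -/
theorem hasCircle_of_translations {Γ : Subgroup SL(3, ℝ)}
    (hd : IsZariskiDense (Γ : Set SL(3, ℝ))) {D : ℤ × ℤ → SL(3, ℝ)} (hD : ∀ w, D w ∈ Γ)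
    (hf : ∀ w, (D w : Mat3) = !![1, 0, (w.1 : ℝ); 0, 1, (w.2 : ℝ); 0, 0, 1]) : HasCircle Γ := by
  intro X hX hne
  obtain ⟨p, φ, h, hp, hφ, -⟩ := hX.exists_generic hd hne 0
  have hinv : ∀ w, (((D w)⁻¹ : SL(3, ℝ)) : Mat3) =
      !![1, 0, -(w.1 : ℝ); 0, 1, -(w.2 : ℝ); 0, 0, 1] := by
    intro w
    rw [Matrix.SpecialLinearGroup.coe_inv, hf, adjugate_fin_three]
    simp
  have main : ∀ q : Vec3, q 2 = 0 → φ 0 * q 0 + φ 1 * q 1 ≠ 0 → (q, ![0, 0, 1]) ∈ X := by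
    intro q hq hq'
    have h0 : ∀ n : ℕ, ((n : ℝ) + 1) ≠ 0 := fun n => by positivity
    have hq0 : q ≠ 0 := by
      rintro rfl
      simp at hq'
    have hlim1 := tendsto_round_div (q 0)
    have hlim2 := tendsto_round_div (q 1)
    have hlim3 := tendsto_one_div_add_atTop_nhds_zero_nat (𝕜 := ℝ)
    refine hX.of_smul (one_ne_zero) (neg_ne_zero.2 hq') ?_
    rw [one_smul]
    refine hX.limit (g := fun n => D (round (((n : ℝ) + 1) * q 0), round (((n : ℝ) + 1) * q 1)))
      (fun n => hD _) h
      (a := fun n => (((n : ℝ) + 1) * p 2)⁻¹) (b := fun n => ((n : ℝ) + 1)⁻¹)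
      (fun n => inv_ne_zero (mul_ne_zero (h0 n) (hp 2))) (fun n => inv_ne_zero (h0 n)) ?_ ?_
      hq0 (by simpa using fun h => hq' (by linarith))
    · refine tendsto_vec3 ?_ ?_ ?_
      · refine (((hlim3.const_mul (p 0 / p 2)).add hlim1).congr fun n => ?_).trans_eq ?_
        · have := h0 n
          have := hp 2
          rw [Pi.smul_apply, mulVec_apply_three]
          simp [hf]
          field_simp
        · simp
      · refine (((hlim3.const_mul (p 1 / p 2)).add hlim2).congr fun n => ?_).trans_eq ?_
        · have := h0 n
          have := hp 2
          rw [Pi.smul_apply, mulVec_apply_three]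
          simp [hf]
          field_simp
        · simp
      · refine (hlim3.congr fun n => ?_).trans_eq ?_
        · have := h0 n
          have := hp 2
          rw [Pi.smul_apply, mulVec_apply_three]
          simp [hf]
          field_simp
        · simp [hq]
    · refine tendsto_vec3 ?_ ?_ ?_
      · refine ((hlim3.const_mul (φ 0)).congr fun n => ?_).trans_eq ?_
        · rw [Pi.smul_apply, vecMul_apply_three]
          simp [hinv]
          ring
        · simp
      · refine ((hlim3.const_mul (φ 1)).congr fun n => ?_).trans_eq ?_
        · rw [Pi.smul_apply, vecMul_apply_three]
          simp [hinv]
          ring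
        · simp
      · refine ((((hlim1.const_mul (-φ 0)).add (hlim2.const_mul (-φ 1))).add
          (hlim3.const_mul (φ 2))).congr fun n => ?_).trans_eq ?_
        · have := h0 n
          rw [Pi.smul_apply, vecMul_apply_three]
          simp [hinv]
          field_simp
        · simp
          ring_nf
  refine ⟨![0, 0, 1], by simp, fun q hq hq' => ?_⟩
  have hq2 : q 2 = 0 := by simpa [dotProduct, Fin.sum_univ_three] using hq'
  by_cases hc : φ 0 * q 0 + φ 1 * q 1 = 0
  · refine hX.mem_of_perturb (d := ![φ 0, φ 1, 0]) hq (by simp) fun ε hε _ => main _ ?_ ?_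
    · simp [hq2]
    · have := hφ 0
      have : φ 0 * (q + ε • ![φ 0, φ 1, 0]) 0 + φ 1 * (q + ε • ![φ 0, φ 1, 0]) 1 =
          ε * (φ 0 * φ 0 + φ 1 * φ 1) := by
        simp
        linear_combination hc
      rw [this]
      have := mul_self_pos.2 (hφ 0)
      have := mul_self_nonneg (φ 1)
      positivity
  · exact main q hq2 hc

theorem IsDiscretePlane.eq_zero_of_coe_eq_one {Γ : Subgroup SL(3, ℝ)} {D : ℤ × ℤ → SL(3, ℝ)}
    (hD : IsDiscretePlane Γ D) {w : ℤ × ℤ} (h : (D w : Mat3) = 1) : w = 0 := by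
  -- The second root 2 is arbitrary: the identity is annihilated by (x - 1)(x - b) for every b.
  refine hD.regular w 1 2 (by norm_num) ?_
  rw [h]
  ext i j
  fin_cases i <;> fin_cases j <;> simp

/-- If the third entry differs, the two values are the roots of a forbidden quadratic. If it agrees,
the matrix is a real scalar of determinant one, hence the identity. -/
theorem IsDiscretePlane.eq_zero_of_diagonal {Γ : Subgroup SL(3, ℝ)} {D : ℤ × ℤ → SL(3, ℝ)}
    (hD : IsDiscretePlane Γ D) {w : ℤ × ℤ} {d : Vec3} (h : (D w : Mat3) = diagonal d)
    {i j k : Fin 3} (hijk : ∀ l, l = i ∨ l = j ∨ l = k) (hij : d i = d j) : w = 0 := by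
  by_cases hc : d i = d k
  · have hdet := (D w).2
    have hall : ∀ l, d l = d i := by
      intro l
      rcases hijk l with rfl | rfl | rfl
      · rfl
      · exact hij.symm
      · exact hc.symm
    change (D w : Mat3).det = 1 at hdet
    rw [h, det_diagonal, Fin.prod_univ_three, hall 0, hall 1, hall 2] at hdet
    have h1 : d i = 1 := by
      have : (d i - 1) * ((d i + 1 / 2) ^ 2 + 3 / 4) = 0 := by linear_combination hdet
      rcases mul_eq_zero.1 this with h | h
      · linarith
      · nlinarith [sq_nonneg (d i + 1 / 2)]
    refine hD.eq_zero_of_coe_eq_one ?_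
    rw [h, ← diagonal_one]
    congr 1
    ext l
    rw [hall, h1]
  · refine hD.regular w (d i) (d k) hc ?_
    rw [h, diagonal_mul_diagonal, smul_one_eq_diagonal, ← diagonal_smul, diagonal_sub,
      diagonal_add, ← diagonal_zero]
    congr 1
    ext l
    simp only [Pi.smul_apply, smul_eq_mul]
    rcases hijk l with rfl | rfl | rfl
    · ring
    · rw [hij]; ring
    · ring

/-- The circle over the plane `z = 0` once it contains all points with `y ≠ 0`. -/
theorem IsFlagSet.circle_of_affine {Γ : Subgroup SL(3, ℝ)} {X : Set (Vec3 × Vec3)}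
    (hX : IsFlagSet Γ X) (h : ∀ r : ℝ, (![r, 1, 0], ![0, 0, 1]) ∈ X) :
    ∃ φ : Vec3, φ ≠ 0 ∧ ∀ p : Vec3, p ≠ 0 → φ ⬝ᵥ p = 0 → (p, φ) ∈ X := by
  have main : ∀ q : Vec3, q 2 = 0 → q 1 ≠ 0 → (q, ![0, 0, 1]) ∈ X := by
    intro q hq2 hq1
    have := hX.smul (h (q 0 / q 1)) hq1 one_ne_zero
    convert this using 2
    · ext i
      fin_cases i
      · simp; field_simp
      · simp
      · simp [hq2]
    · simp
  refine ⟨![0, 0, 1], by simp, fun q hq hq' => ?_⟩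
  have hq2 : q 2 = 0 := by simpa [dotProduct, Fin.sum_univ_three] using hq'
  by_cases hc : q 1 = 0
  · refine hX.mem_of_perturb (d := ![0, 1, 0]) hq (by simp) fun ε hε _ => main _ ?_ ?_
    · simp [hq2]
    · simp [hc, hε.ne']
  · exact main q hq2 hc

/-- Both β/α and log |α| are additive in w, and β/α is injective since β = 0 would leave a diagonal
matrix with a repeated entry. With log |α| → ∞ the plane tends to z = 0, while the line tends to
(p₀/p₁ + lim β/α, 1, 0), where the limit of β/α can be prescribed. -/
theorem hasCircle_of_shear {Γ : Subgroup SL(3, ℝ)}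
    (hd : IsZariskiDense (Γ : Set SL(3, ℝ))) {D : ℤ × ℤ → SL(3, ℝ)} (hD : IsDiscretePlane Γ D)
    {α β γ : ℤ × ℤ → ℝ}
    (hf : ∀ w, (D w : Mat3) = !![α w, β w, 0; 0, α w, 0; 0, 0, γ w]) : HasCircle Γ := by
  intro X hX hne
  obtain ⟨p, φ, h, hp, hφ, -⟩ := hX.exists_generic hd hne 0
  have hdet : ∀ w, α w * α w * γ w = 1 := by
    intro w
    have h1 : (D w : Mat3).det = 1 := (D w).2
    rw [hf, det_fin_three] at h1
    simpa using h1
  have hα : ∀ w, α w ≠ 0 := by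
    intro w h0
    have := hdet w
    simp [h0] at this
  have hγ : ∀ w, γ w = (α w)⁻¹ * (α w)⁻¹ := by
    intro w
    have := hdet w
    have := hα w
    field_simp
    linarith
  have hinv : ∀ w, (((D w)⁻¹ : SL(3, ℝ)) : Mat3) =
      !![α w * γ w, -(β w * γ w), 0; 0, α w * γ w, 0; 0, 0, α w * α w] := by
    intro w
    rw [Matrix.SpecialLinearGroup.coe_inv, hf, adjugate_fin_three]
    simp
  have hmul : ∀ v w, α (v + w) = α v * α w ∧ β (v + w) = α v * β w + β v * α w := by
    intro v w
    have h1 : (D (v + w) : Mat3) = (D v : Mat3) * (D w : Mat3) := by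
      rw [hD.add, Matrix.SpecialLinearGroup.coe_mul]
    rw [hf, hf, hf] at h1
    have h00 := congrFun (congrFun h1 0) 0
    have h01 := congrFun (congrFun h1 0) 1
    simp [Matrix.mul_apply, Fin.sum_univ_three] at h00 h01
    exact ⟨h00, h01⟩
  let u : ℤ × ℤ →+ ℝ := AddMonoidHom.mk' (fun w => β w / α w) (by
    intro v w
    have := hα v
    have := hα w
    rw [(hmul v w).1, (hmul v w).2]
    field_simp
    ring)
  let s : ℤ × ℤ →+ ℝ := AddMonoidHom.mk' (fun w => Real.log |α w|) (by
    intro v w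
    rw [(hmul v w).1, abs_mul, Real.log_mul (abs_ne_zero.2 (hα v)) (abs_ne_zero.2 (hα w))])
  have hu : ∀ w, u w = 0 → w = 0 := by
    intro w hw
    have hβ : β w = 0 := by
      have : β w / α w = 0 := hw
      simpa [hα w] using this
    refine hD.eq_zero_of_diagonal (d := ![α w, α w, γ w]) (i := 0) (j := 1) (k := 2) ?_
      (by decide) rfl
    rw [hf, hβ]
    ext i j
    fin_cases i <;> fin_cases j <;> simp
  have hfin : ∀ C, {w | |u w| ≤ C ∧ |s w| ≤ C}.Finite := by
    intro C
    have hb : ∀ w, |s w| ≤ C → |α w| ≤ Real.exp C ∧ |γ w| ≤ Real.exp C * Real.exp C := by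
      intro w hw
      have h1 : |α w| = Real.exp (s w) := (Real.exp_log (abs_pos.2 (hα w))).symm
      rw [abs_le] at hw
      refine ⟨h1.le.trans (Real.exp_le_exp.2 hw.2), ?_⟩
      rw [hγ, abs_mul, abs_inv, h1, ← Real.exp_neg]
      have h2 : Real.exp (-(s w)) ≤ Real.exp C := Real.exp_le_exp.2 (by linarith)
      gcongr
    refine (hD.fin (Real.exp C + Real.exp C * Real.exp C + C * Real.exp C)).subset ?_
    rintro w ⟨h1, h2⟩ i j
    obtain ⟨h3, h4⟩ := hb w h2
    have hC : 0 ≤ C := (abs_nonneg _).trans h1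
    have hE := Real.exp_pos C
    have h5 : |β w| ≤ C * Real.exp C := by
      have : β w = u w * α w := by
        change β w = β w / α w * α w
        rw [div_mul_cancel₀ _ (hα w)]
      rw [this, abs_mul]
      gcongr
    have h6 : 0 ≤ C * Real.exp C := by positivity
    have h7 : 0 ≤ Real.exp C * Real.exp C := by positivity
    rw [hf]
    fin_cases i <;> fin_cases j <;> simp <;> linarith
  refine hX.circle_of_affine fun r => ?_
  obtain ⟨w, hw1, hw2⟩ := exists_seq_tendsto_atTop u s hu hfin (r - p 0 / p 1)
  have hlim : Tendsto (fun n => (α (w n))⁻¹) atTop (𝓝 0) := by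
    rw [tendsto_zero_iff_abs_tendsto_zero]
    have h1 := Real.tendsto_exp_atTop.comp hw2
    refine (tendsto_inv_atTop_zero.comp h1).congr fun n => ?_
    have : |α (w n)| = Real.exp (s (w n)) := (Real.exp_log (abs_pos.2 (hα _))).symm
    simp [this]
  have hlim3 : Tendsto (fun n => (α (w n))⁻¹ ^ 3) atTop (𝓝 0) := by
    simpa using hlim.pow 3
  refine hX.of_smul one_ne_zero (hφ 2) ?_
  rw [one_smul]
  refine hX.limit (g := fun n => D (w n)) (fun n => hD.mem _) h
    (a := fun n => (p 1)⁻¹ * (α (w n))⁻¹) (b := fun n => (α (w n))⁻¹ * (α (w n))⁻¹)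
    (fun n => mul_ne_zero (inv_ne_zero (hp 1)) (inv_ne_zero (hα _)))
    (fun n => mul_ne_zero (inv_ne_zero (hα _)) (inv_ne_zero (hα _))) ?_ ?_
    (by simp) (by simpa using hφ 2)
  · refine tendsto_vec3 ?_ ?_ ?_
    · refine ((hw1.const_add (p 0 / p 1)).congr fun n => ?_).trans_eq ?_
      · have := hp 1
        have := hα (w n)
        change p 0 / p 1 + β (w n) / α (w n) = _
        rw [Pi.smul_apply, mulVec_apply_three]
        simp [hf]
        field_simp
      · simp
    · refine (tendsto_const_nhds (x := (1 : ℝ))).congr fun n => ?_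
      have := hp 1
      have := hα (w n)
      rw [Pi.smul_apply, mulVec_apply_three]
      simp [hf]
      field_simp
    · refine ((hlim3.const_mul (p 2 / p 1)).congr fun n => ?_).trans_eq ?_
      · rw [Pi.smul_apply, mulVec_apply_three]
        simp [hf, hγ]
        ring
      · simp
  · refine tendsto_vec3 ?_ ?_ ?_
    · refine ((hlim3.const_mul (φ 0)).congr fun n => ?_).trans_eq ?_
      · have := hα (w n)
        rw [Pi.smul_apply, vecMul_apply_three]
        simp [hinv, hγ]
        field_simp
      · simp
    · refine (((hw1.const_mul (-φ 0)).add_const (φ 1)).mul hlim3 |>.congr fun n => ?_).trans_eq ?_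
      · have := hα (w n)
        change (-φ 0 * (β (w n) / α (w n)) + φ 1) * _ = _
        rw [Pi.smul_apply, vecMul_apply_three]
        simp [hinv, hγ]
        field_simp
      · simp
    · refine ((tendsto_const_nhds (x := φ 2)).congr fun n => ?_).trans_eq ?_
      · have := hα (w n)
        rw [Pi.smul_apply, vecMul_apply_three]
        simp [hinv]
        field_simp
      · simp

/-! ### Planes containing a full unipotent Jordan block. -/

/-- A discrete homomorphism from `ℤ²` to `ℝ²` is within bounded distance of every point. -/
theorem exists_near_of_discrete (s t : ℤ × ℤ →+ ℝ) (hs : ∀ w, s w = 0 → w = 0)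
    (hfin : ∀ C, {w | |s w| ≤ C ∧ |t w| ≤ C}.Finite) :
    ∃ C, ∀ x y : ℝ, ∃ w, |s w - x| ≤ C ∧ |t w - y| ≤ C := by
  set s1 := s (1, 0) with hs1
  set s2 := s (0, 1) with hs2
  set t1 := t (1, 0) with ht1
  set t2 := t (0, 1) with ht2
  have hs2' : s2 ≠ 0 := fun h => by simpa using hs _ h
  -- Otherwise t is a multiple of s, and the infinitely many w with s w small would violate
  -- properness.
  have hdet : s1 * t2 - s2 * t1 ≠ 0 := by
    intro h0
    have h1 : ∀ w, t w = t2 / s2 * s w := by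
      intro w
      rw [addMonoidHom_int_prod_apply s, addMonoidHom_int_prod_apply t, ← hs1, ← hs2, ← ht1, ← ht2]
      field_simp
      linear_combination (-(w.1 : ℝ)) * h0
    refine infinite_setOf_abs_le s one_pos ((hfin (1 + |t2 / s2|)).subset fun w hw => ?_)
    have hw' : |s w| ≤ 1 := hw
    refine ⟨by linarith [abs_nonneg (t2 / s2)], ?_⟩
    rw [h1, abs_mul]
    nlinarith [abs_nonneg (t2 / s2)]
  refine ⟨|s1| + |s2| + |t1| + |t2|, fun x y => ?_⟩
  set α := (x * t2 - s2 * y) / (s1 * t2 - s2 * t1) with hα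
  set β := (s1 * y - x * t1) / (s1 * t2 - s2 * t1) with hβ
  have e1 : α * s1 + β * s2 = x := by
    rw [hα, hβ, div_mul_eq_mul_div, div_mul_eq_mul_div, ← add_div, div_eq_iff hdet]
    ring
  have e2 : α * t1 + β * t2 = y := by
    rw [hα, hβ, div_mul_eq_mul_div, div_mul_eq_mul_div, ← add_div, div_eq_iff hdet]
    ring
  refine ⟨(round α, round β), ?_, ?_⟩
  all_goals
    have hra := abs_sub_round α
    have hrb := abs_sub_round β
    rw [addMonoidHom_int_prod_apply]
  · have e : ((round α, round β) : ℤ × ℤ).1 * s (1, 0) + ((round α, round β) : ℤ × ℤ).2 * s (0, 1)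
        - x = -((α - round α) * s1) - (β - round β) * s2 := by
      rw [← e1, ← hs1, ← hs2]; ring
    rw [e]
    refine (abs_sub _ _).trans ?_
    rw [abs_neg, abs_mul, abs_mul]
    nlinarith [abs_nonneg s1, abs_nonneg s2, abs_nonneg t1, abs_nonneg t2]
  · have e : ((round α, round β) : ℤ × ℤ).1 * t (1, 0) + ((round α, round β) : ℤ × ℤ).2 * t (0, 1)
        - y = -((α - round α) * t1) - (β - round β) * t2 := by
      rw [← e2, ← ht1, ← ht2]; ring
    rw [e]
    refine (abs_sub _ _).trans ?_
    rw [abs_neg, abs_mul, abs_mul]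
    nlinarith [abs_nonneg s1, abs_nonneg s2, abs_nonneg t1, abs_nonneg t2]

/-- The additive coordinates are those of the matrix logarithm, s = σ and t = τ - σ²/2. As s → ∞ a
general line tends to (p₁/p₂ + lim τ/σ, 1, 0), so t must follow the parabola -s²/2 up to an error
linear in s. -/
theorem hasCircle_of_jordan {Γ : Subgroup SL(3, ℝ)}
    (hd : IsZariskiDense (Γ : Set SL(3, ℝ))) {D : ℤ × ℤ → SL(3, ℝ)} (hD : IsDiscretePlane Γ D)
    {σ τ : ℤ × ℤ → ℝ} (hf : ∀ w, (D w : Mat3) = !![1, σ w, τ w; 0, 1, σ w; 0, 0, 1])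
    (hσ : ∃ w, σ w ≠ 0) : HasCircle Γ := by
  intro X hX hne
  obtain ⟨p, φ, h, hp, hφ, -⟩ := hX.exists_generic hd hne 0
  have hinv : ∀ w, (((D w)⁻¹ : SL(3, ℝ)) : Mat3) =
      !![1, -σ w, σ w * σ w - τ w; 0, 1, -σ w; 0, 0, 1] := by
    intro w
    rw [Matrix.SpecialLinearGroup.coe_inv, hf, adjugate_fin_three]
    simp
  have hmul : ∀ v w, σ (v + w) = σ v + σ w ∧ τ (v + w) = τ v + τ w + σ v * σ w := by
    intro v w
    have h1 : (D (v + w) : Mat3) = (D v : Mat3) * (D w : Mat3) := by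
      rw [hD.add, Matrix.SpecialLinearGroup.coe_mul]
    rw [hf, hf, hf] at h1
    have h01 := congrFun (congrFun h1 0) 1
    have h02 := congrFun (congrFun h1 0) 2
    simp [Matrix.mul_apply, Fin.sum_univ_three] at h01 h02
    exact ⟨by linarith, by linarith⟩
  let s : ℤ × ℤ →+ ℝ := AddMonoidHom.mk' σ fun v w => (hmul v w).1
  let t : ℤ × ℤ →+ ℝ := AddMonoidHom.mk' (fun w => τ w - σ w * σ w / 2) (by
    intro v w
    rw [(hmul v w).1, (hmul v w).2]
    ring)
  have hτ : ∀ w, τ w = t w + s w * s w / 2 := by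
    intro w
    change τ w = τ w - σ w * σ w / 2 + σ w * σ w / 2
    ring
  have hσs : ∀ w, σ w = s w := fun w => rfl
  have hfin : ∀ C, {w | |s w| ≤ C ∧ |t w| ≤ C}.Finite := by
    intro C
    refine (hD.fin (1 + C + C * C)).subset ?_
    rintro w ⟨h1, h2⟩ i j
    have hC : 0 ≤ C := (abs_nonneg _).trans h1
    have h3 : |τ w| ≤ C + C * C := by
      rw [hτ]
      refine (abs_add_le _ _).trans ?_
      rw [abs_div, abs_mul, abs_two]
      have : |s w| * |s w| ≤ C * C := by gcongr
      nlinarith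
    have hC2 : 0 ≤ C * C := by positivity
    rw [hf, hσs]
    fin_cases i <;> fin_cases j <;> simp <;> linarith
  have main : ∀ (r : ℝ) (w : ℕ → ℤ × ℤ), Tendsto (fun n => (s (w n))⁻¹) atTop (𝓝 0) →
      (∀ n, s (w n) ≠ 0) → Tendsto (fun n => t (w n) / s (w n) + s (w n) / 2) atTop (𝓝 r) →
      (![p 1 / p 2 + r, 1, 0], ![0, 0, 1]) ∈ X := by
    intro r w hw hw0 hr
    have hw2 : Tendsto (fun n => (s (w n))⁻¹ ^ 2) atTop (𝓝 0) := by simpa using hw.pow 2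
    refine hX.of_smul one_ne_zero (hφ 0) ?_
    rw [one_smul]
    refine hX.limit (g := fun n => D (w n)) (fun n => hD.mem _) h
      (a := fun n => (p 2)⁻¹ * (s (w n))⁻¹) (b := fun n => (s (w n))⁻¹ ^ 2)
      (fun n => mul_ne_zero (inv_ne_zero (hp 2)) (inv_ne_zero (hw0 _)))
      (fun n => pow_ne_zero 2 (inv_ne_zero (hw0 n))) ?_ ?_
      (by simp) (by simpa using hφ 0)
    · refine tendsto_vec3 ?_ ?_ ?_
      · refine (((hw.const_mul (p 0 / p 2)).add (hr.const_add (p 1 / p 2))).congr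
          fun n => ?_).trans_eq ?_
        · have := hp 2
          have := hw0 n
          rw [Pi.smul_apply, mulVec_apply_three]
          simp [hf, hτ, hσs]
          field_simp
          ring
        · simp
      · refine (((hw.const_mul (p 1 / p 2)).const_add 1).congr fun n => ?_).trans_eq ?_
        · have := hp 2
          have := hw0 n
          rw [Pi.smul_apply, mulVec_apply_three]
          simp [hf, hσs]
          field_simp
          ring
        · simp
      · refine (hw.congr fun n => ?_).trans_eq ?_
        · have := hp 2
          have := hw0 n
          rw [Pi.smul_apply, mulVec_apply_three]
          simp [hf]
          field_simp
        · simp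
    · refine tendsto_vec3 ?_ ?_ ?_
      · refine ((hw2.const_mul (φ 0)).congr fun n => ?_).trans_eq ?_
        · rw [Pi.smul_apply, vecMul_apply_three]
          simp [hinv]
          ring
        · simp
      · refine (((hw.const_mul (-φ 0)).add (hw2.const_mul (φ 1))).congr fun n => ?_).trans_eq ?_
        · have := hw0 n
          rw [Pi.smul_apply, vecMul_apply_three]
          simp [hinv, hσs]
          field_simp
        · simp
      · refine (((((hr.mul hw).const_mul (-φ 0)).const_add (φ 0)).add
          ((hw.const_mul (-φ 1)).add (hw2.const_mul (φ 2)))).congr fun n => ?_).trans_eq ?_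
        · have := hw0 n
          rw [Pi.smul_apply, vecMul_apply_three]
          simp [hinv, hσs, hτ]
          field_simp
          ring
        · simp
  -- If s is injective, one limit flag is found and then spread by the action of ℤ² on the circle z
  -- = 0. Otherwise t can be corrected freely along the kernel of s.
  by_cases hinj : ∀ w, s w = 0 → w = 0
  · obtain ⟨r₀, hr₀⟩ : ∃ r₀ : ℝ, (![r₀, 1, 0], ![0, 0, 1]) ∈ X := by
      obtain ⟨C, hC⟩ := exists_near_of_discrete s t hinj hfin
      have hC0 : 0 ≤ C := by
        obtain ⟨w, hw, -⟩ := hC 0 0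
        exact (abs_nonneg _).trans hw
      -- Lattice points within C of the parabola. The shift C + 1 guarantees s ≥ n + 1.
      choose w hw1 hw2 using fun n : ℕ => hC (n + (C + 1)) (-(n + (C + 1)) ^ 2 / 2)
      have hpos : ∀ n : ℕ, (n : ℝ) + 1 ≤ s (w n) := by
        intro n
        have := (abs_le.1 (hw1 n)).1
        linarith
      have hlim : Tendsto (fun n => (s (w n))⁻¹) atTop (𝓝 0) := by
        refine tendsto_inv_atTop_zero.comp (tendsto_atTop_mono hpos ?_)
        exact tendsto_atTop_add_const_right _ _ tendsto_natCast_atTop_atTop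
      have hbd : ∀ n, |t (w n) / s (w n) + s (w n) / 2| ≤ 3 * C + C * C := by
        intro n
        have h1 := hpos n
        have hn : (0 : ℝ) ≤ n := n.cast_nonneg
        have hs0 : 0 < s (w n) := by linarith
        obtain ⟨a1, a2⟩ := abs_le.1 (hw1 n)
        have a3 := hw2 n
        set y := s (w n) with hy
        set m : ℝ := n + (C + 1) with hm
        have e : t (w n) / y + y / 2 = ((t (w n) - -m ^ 2 / 2) + (y - m) * (y + m) / 2) / y := by
          field_simp
          ring
        rw [e, abs_div, abs_of_pos hs0, div_le_iff₀ hs0]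
        refine (abs_add_le _ _).trans ?_
        have a4 : |(y - m) * (y + m) / 2| ≤ C * (2 * y + C) / 2 := by
          rw [abs_div, abs_mul, abs_two]
          have : |y + m| ≤ 2 * y + C := by
            rw [abs_le]; constructor <;> linarith
          have := abs_le.2 ⟨a1, a2⟩
          gcongr
        nlinarith [mul_nonneg hC0 hC0]
      obtain ⟨r, -, θ, hθ, hr⟩ := tendsto_subseq_of_bounded (Metric.isBounded_closedBall
        (x := (0 : ℝ)) (r := 3 * C + C * C)) (x := fun n => t (w n) / s (w n) + s (w n) / 2)
        (fun n => by simpa [Metric.mem_closedBall, Real.dist_eq] using hbd n)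
      exact ⟨_, main r (w ∘ θ) (hlim.comp hθ.tendsto_atTop)
        (fun n => by
          have := hpos (θ n)
          have hn : (0 : ℝ) ≤ (θ n : ℕ) := Nat.cast_nonneg _
          change s (w (θ n)) ≠ 0
          linarith) hr⟩
    refine hX.circle_of_affine fun r => ?_
    -- On the plane z = 0 the group translates the affine coordinate by s, whose values are dense.
    obtain ⟨w, hw1, -⟩ := exists_seq_tendsto_atTop s t hinj hfin (r - r₀)
    refine hX.limit (g := fun n => D (w n)) (fun n => hD.mem _) hr₀ (a := fun _ => 1)
      (b := fun _ => 1) (fun _ => one_ne_zero) (fun _ => one_ne_zero) ?_ ?_ (by simp) (by simp)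
    · refine tendsto_vec3 ?_ ?_ ?_
      · refine ((hw1.const_add r₀).congr fun n => ?_).trans_eq ?_
        · rw [Pi.smul_apply, mulVec_apply_three]
          simp [hf, hσs]
        · simp
      · refine (tendsto_const_nhds (x := (1 : ℝ))).congr fun n => ?_
        rw [Pi.smul_apply, mulVec_apply_three]
        simp [hf]
      · refine (tendsto_const_nhds (x := (0 : ℝ))).congr fun n => ?_
        rw [Pi.smul_apply, mulVec_apply_three]
        simp [hf]
    · refine tendsto_vec3 ?_ ?_ ?_
      all_goals
        refine tendsto_const_nhds.congr fun n => ?_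
        rw [Pi.smul_apply, vecMul_apply_three]
        simp [hinv]
  · push Not at hinj
    obtain ⟨v, hv, hv0⟩ := hinj
    have hk : t v ≠ 0 := by
      intro h0
      refine hv0 (hD.eq_zero_of_coe_eq_one ?_)
      rw [hf, hτ, hσs, hv, h0, Matrix.one_fin_three]
      simp
    obtain ⟨v', hv'⟩ := hσ
    rw [hσs] at hv'
    refine hX.circle_of_affine fun r => ?_
    -- Rounding brings t within |t v|/2 of the value that makes t/s + s/2 equal to r - p₁/p₂.
    -- Dividing by s makes this error vanish in the limit.
    set m : ℕ → ℤ := fun n =>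
      round (((r - p 1 / p 2) * ((n + 1) * s v') - ((n + 1) * s v') ^ 2 / 2 - (n + 1) * t v') / t v)
      with hm
    have hsw : ∀ n : ℕ, s (((n : ℤ) + 1) • v' + m n • v) = (n + 1) * s v' := by
      intro n
      rw [map_add, map_zsmul, map_zsmul, hv]
      simp
    have htw : ∀ n : ℕ, t (((n : ℤ) + 1) • v' + m n • v) = (n + 1) * t v' + m n * t v := by
      intro n
      rw [map_add, map_zsmul, map_zsmul]
      simp
    have h0 : ∀ n : ℕ, (n : ℝ) + 1 ≠ 0 := fun n => by positivity
    have := main (r - p 1 / p 2) (fun n => ((n : ℤ) + 1) • v' + m n • v) ?_ ?_ ?_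
    · convert this using 4
      ring
    · have hl := (tendsto_one_div_add_atTop_nhds_zero_nat (𝕜 := ℝ)).const_mul (s v')⁻¹
      rw [mul_zero] at hl
      refine hl.congr fun n => ?_
      rw [hsw]
      simp [mul_comm]
    · intro n
      rw [hsw]
      exact mul_ne_zero (h0 n) hv'
    · rw [tendsto_iff_dist_tendsto_zero]
      have hl := (tendsto_one_div_add_atTop_nhds_zero_nat (𝕜 := ℝ)).const_mul (|t v| / |s v'|)
      rw [mul_zero] at hl
      refine squeeze_zero (fun _ => dist_nonneg) (fun n => ?_) hl
      rw [hsw, htw, Real.dist_eq]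
      have h1 := abs_sub_round (((r - p 1 / p 2) * ((n + 1) * s v') - ((n + 1) * s v') ^ 2 / 2 -
        (n + 1) * t v') / t v)
      change |_ - (m n : ℝ)| ≤ _ at h1
      set z := ((r - p 1 / p 2) * ((n + 1) * s v') - ((n + 1) * s v') ^ 2 / 2 -
        (n + 1) * t v') / t v with hz
      have hz' : z * t v = (r - p 1 / p 2) * ((n + 1) * s v') - ((n + 1) * s v') ^ 2 / 2 -
        (n + 1) * t v' := by rw [hz, div_mul_cancel₀ _ hk]
      have e : ((n + 1) * t v' + m n * t v) / ((n + 1) * s v') + (n + 1) * s v' / 2 -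
          (r - p 1 / p 2) = -((z - m n) * t v) / ((n + 1) * s v') := by
        have := h0 n
        have h2 : -((z - m n) * t v) = m n * t v - z * t v := by ring
        rw [h2, hz']
        generalize p 1 / p 2 = ρ
        field_simp
        ring
      have hn : (0 : ℝ) < n + 1 := by positivity
      rw [e, abs_div, abs_neg, abs_mul, abs_mul, abs_of_pos hn, div_mul_div_comm, mul_one,
        mul_comm |s v'|]
      gcongr
      nlinarith [abs_nonneg (t v)]

/-! ### Unipotent planes with a common image line. -/

theorem finite_setOf_box (C : ℝ) : {w : ℤ × ℤ | |(w.1 : ℝ)| ≤ C ∧ |(w.2 : ℝ)| ≤ C}.Finite := by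
  have h : ∀ k : ℤ, |(k : ℝ)| ≤ C → k ∈ Set.Icc (-⌈C⌉) ⌈C⌉ := by
    intro k hk
    have h1 := abs_le.1 hk
    have h2 := Int.le_ceil C
    constructor
    · have : ((-⌈C⌉ : ℤ) : ℝ) ≤ k := by push_cast; linarith
      exact_mod_cast this
    · have : (k : ℝ) ≤ ⌈C⌉ := by linarith
      exact_mod_cast this
  exact ((Set.finite_Icc (-⌈C⌉) ⌈C⌉).prod (Set.finite_Icc (-⌈C⌉) ⌈C⌉)).subset
    fun w hw => ⟨h _ hw.1, h _ hw.2⟩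

/-- The group generated by two reals without small integral relations has small elements. -/
theorem exists_small_combination {N : ℕ} (hN : 0 < N) {y z : ℝ}
    (hyz : ∀ k j : ℤ, |k| ≤ N → |j| ≤ N → (k ≠ 0 ∨ j ≠ 0) → k * y + j * z ≠ 0) :
    ∃ k j : ℤ, k * y + j * z ≠ 0 ∧ |k * y + j * z| ≤ max |y| |z| / (N + 1) := by
  have key : ∀ y z : ℝ,
      (∀ k j : ℤ, |k| ≤ N → |j| ≤ N → (k ≠ 0 ∨ j ≠ 0) → k * y + j * z ≠ 0) → |y| ≤ |z| →
      ∃ k j : ℤ, k * y + j * z ≠ 0 ∧ |k * y + j * z| ≤ |z| / (N + 1) := by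
    intro y z hyz hle
    have hz : z ≠ 0 := by
      intro h0
      have := hyz 0 1 (by simp) (by simpa using Nat.one_le_iff_ne_zero.2 hN.ne') (by simp)
      simp [h0] at this
    -- Dirichlet approximation of y/z. The assumption |y| ≤ |z| keeps |j| ≤ N as well, so the
    -- combination is nonzero.
    obtain ⟨j, k, hk0, hkN, h⟩ := Real.exists_int_int_abs_mul_sub_le (y / z) hN
    have hN' : (0 : ℝ) < N + 1 := by positivity
    have hj : |j| ≤ N := by
      have h1 : |(k : ℝ) * (y / z)| ≤ N := by
        rw [abs_mul, abs_div]
        have h2 : |y| / |z| ≤ 1 := div_le_one_of_le₀ hle (abs_nonneg _)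
        have h3 : |(k : ℝ)| ≤ N := by
          rw [abs_of_pos (by exact_mod_cast hk0)]
          exact_mod_cast hkN
        calc |(k : ℝ)| * (|y| / |z|) ≤ N * 1 := by gcongr
          _ = N := mul_one _
      have h2 : |(j : ℝ)| < N + 1 := by
        have h4 : (1 : ℝ) / (N + 1) < 1 := by
          rw [div_lt_one hN']
          have : (0 : ℝ) < N := by exact_mod_cast hN
          linarith
        have h5 := abs_sub_abs_le_abs_sub (j : ℝ) (k * (y / z))
        rw [abs_sub_comm] at h5
        linarith
      have h3 : |j| < N + 1 := by exact_mod_cast h2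
      omega
    refine ⟨k, -j, hyz k (-j) ?_ (by rwa [abs_neg]) (Or.inl hk0.ne'), ?_⟩
    · rw [abs_of_pos hk0]
      exact hkN
    · have e : (k : ℝ) * y + ((-j : ℤ) : ℝ) * z = (k * (y / z) - j) * z := by
        push_cast
        field_simp
        ring
      rw [e, abs_mul]
      calc _ ≤ 1 / ((N : ℝ) + 1) * |z| := by gcongr
        _ = _ := by ring
  rcases le_total |y| |z| with h | h
  · rw [max_eq_right h]
    exact key y z hyz h
  · rw [max_eq_left h]
    obtain ⟨k, j, h1, h2⟩ := key z y (fun k j hk hj hkj => by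
      rw [add_comm]
      exact hyz j k hj hk hkj.symm) h
    exact ⟨j, k, by rwa [add_comm], by rwa [add_comm]⟩

/-- The group moves p only along the first axis, by integral combinations of p₁ and p₂, which need
not be dense. The circle is therefore obtained as a limit of finer and finer nets over varying
planes, and its plane is not fixed in advance. -/
theorem hasCircle_of_central {Γ : Subgroup SL(3, ℝ)}
    (hd : IsZariskiDense (Γ : Set SL(3, ℝ))) {D : ℤ × ℤ → SL(3, ℝ)} (hD : ∀ w, D w ∈ Γ)
    (hf : ∀ w, (D w : Mat3) = !![1, (w.1 : ℝ), (w.2 : ℝ); 0, 1, 0; 0, 0, 1]) : HasCircle Γ := by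
  intro X hX hne
  have hinv : ∀ w, (((D w)⁻¹ : SL(3, ℝ)) : Mat3) =
      !![1, -(w.1 : ℝ), -(w.2 : ℝ); 0, 1, 0; 0, 0, 1] := by
    intro w
    rw [Matrix.SpecialLinearGroup.coe_inv, hf, adjugate_fin_three]
    simp
  -- Along w → ∞ with w₁p₁ + w₂p₂ → 0 the line returns to p while the plane tends to the one spanned
  -- by p and the first axis. The offset (k, j) then shifts the line inside that plane.
  have stepA : ∀ p φ, (p, φ) ∈ X → (∀ i, p i ≠ 0) → (∀ i, φ i ≠ 0) → ∀ k j : ℤ,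
      (![p 0 + (k * p 1 + j * p 2), p 1, p 2], ![0, p 2, -p 1]) ∈ X := by
    intro p φ h hp hφ k j
    let ψ : ℤ × ℤ →+ ℝ := AddMonoidHom.mk' (fun w => w.1 * p 1 + w.2 * p 2) (by
      intro v w
      simp
      ring)
    have hψ : ∀ w, ψ w = w.1 * p 1 + w.2 * p 2 := fun w => rfl
    obtain ⟨w, hw1, hw2⟩ : ∃ w : ℕ → ℤ × ℤ, (∀ n, |ψ (w n)| ≤ 1 / ((n : ℝ) + 1)) ∧
        ∀ n, |(k : ℝ)| + n + 1 ≤ |((w n).1 : ℝ)| := by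
      have : ∀ n : ℕ, ∃ w : ℤ × ℤ, |ψ w| ≤ 1 / ((n : ℝ) + 1) ∧ |(k : ℝ)| + n + 1 ≤ |(w.1 : ℝ)| := by
        intro n
        have hn : (0 : ℝ) < 1 / (n + 1) := by positivity
        by_contra! hc
        refine infinite_setOf_abs_le ψ hn ((finite_setOf_box (max (|(k : ℝ)| + n + 1)
          ((1 / ((n : ℝ) + 1) + (|(k : ℝ)| + n + 1) * |p 1|) / |p 2|))).subset fun w hw => ?_)
        have h1 := hc w hw
        refine ⟨h1.le.trans (le_max_left _ _), le_trans ?_ (le_max_right _ _)⟩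
        rw [le_div_iff₀ (abs_pos.2 (hp 2)), ← abs_mul]
        have e : (w.2 : ℝ) * p 2 = ψ w - w.1 * p 1 := by rw [hψ]; ring
        rw [e]
        refine (abs_sub _ _).trans ?_
        rw [abs_mul]
        have hw' : |ψ w| ≤ 1 / ((n : ℝ) + 1) := hw
        gcongr
      exact ⟨fun n => (this n).choose, fun n => (this n).choose_spec.1,
        fun n => (this n).choose_spec.2⟩
    have hψlim : Tendsto (fun n => ψ (w n)) atTop (𝓝 0) :=
      squeeze_zero_norm hw1 tendsto_one_div_add_atTop_nhds_zero_nat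
    set m : ℕ → ℝ := fun n => (w n).1 + k with hm
    have hmn : ∀ n : ℕ, (n : ℝ) + 1 ≤ |m n| := by
      intro n
      have h1 := hw2 n
      have h2 := abs_sub_abs_le_abs_sub ((w n).1 : ℝ) (-k)
      rw [abs_neg, sub_neg_eq_add] at h2
      change _ ≤ |((w n).1 : ℝ) + k|
      linarith
    have hm0 : ∀ n, m n ≠ 0 := fun n h0 => by
      have := hmn n
      rw [h0, abs_zero] at this
      have hn : (0 : ℝ) ≤ n := n.cast_nonneg
      linarith
    have hmlim : Tendsto (fun n => (m n)⁻¹) atTop (𝓝 0) := by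
      refine squeeze_zero_norm (fun n => ?_) tendsto_one_div_add_atTop_nhds_zero_nat
      rw [Real.norm_eq_abs, abs_inv, ← one_div]
      gcongr
      exact hmn n
    have e2 : ∀ n, ((w n).2 : ℝ) = (ψ (w n) - (w n).1 * p 1) / p 2 := by
      intro n
      rw [hψ, eq_div_iff (hp 2)]
      ring
    have hc : -φ 0 / p 2 ≠ 0 := div_ne_zero (neg_ne_zero.2 (hφ 0)) (hp 2)
    refine hX.of_smul one_ne_zero hc ?_
    rw [one_smul]
    refine hX.limit (g := fun n => D (w n + (k, j))) (fun n => hD _) h (a := fun _ => 1)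
      (b := fun n => (m n)⁻¹) (fun _ => one_ne_zero) (fun n => inv_ne_zero (hm0 n)) ?_ ?_
      (by simp [hp]) (by simp [hp, hφ])
    · refine tendsto_vec3 ?_ ?_ ?_
      · refine ((hψlim.const_add (p 0 + (k * p 1 + j * p 2))).congr fun n => ?_).trans_eq ?_
        · rw [Pi.smul_apply, mulVec_apply_three]
          simp [hf, hψ]
          ring
        · simp
      · refine (tendsto_const_nhds (x := p 1)).congr fun n => ?_
        rw [Pi.smul_apply, mulVec_apply_three]
        simp [hf]
      · refine (tendsto_const_nhds (x := p 2)).congr fun n => ?_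
        rw [Pi.smul_apply, mulVec_apply_three]
        simp [hf]
    · refine tendsto_vec3 ?_ ?_ ?_
      · refine ((hmlim.const_mul (φ 0)).congr fun n => ?_).trans_eq ?_
        · rw [Pi.smul_apply, vecMul_apply_three]
          simp [hinv]
          ring
        · simp
      · refine (((hmlim.const_mul (φ 1)).const_add (-φ 0)).congr fun n => ?_).trans_eq ?_
        · have := hm0 n
          rw [Pi.smul_apply, vecMul_apply_three]
          simp [hinv]
          have h3 : -(k : ℝ) + -((w n).1 : ℝ) = -m n := by simp only [hm]; ring
          rw [h3]
          field_simp
        · have := hp 2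
          simp
          field_simp
      · refine (((((hψlim.add_const (k * p 1 + j * p 2)).const_mul (-φ 0 / p 2)).add_const
          (φ 2)).mul hmlim).const_add (φ 0 * p 1 / p 2) |>.congr fun n => ?_).trans_eq ?_
        · have h1 := hm0 n
          have h2 := hp 2
          rw [Pi.smul_apply, vecMul_apply_three]
          simp [hinv]
          rw [e2]
          have h3 : ((w n).1 : ℝ) = m n - k := by simp [hm]
          rw [h3]
          field_simp
          ring
        · have := hp 2
          simp
          field_simp
  -- A flag avoiding short integral relations yields a nonzero combination r that is small against
  -- max |p₁| |p₂|. Its multiples form a net of mesh at most 1/(N + 1) after normalization.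
  have stepB : ∀ N : ℕ, ∃ v : ℝ × ℝ, ‖v‖ = 1 ∧ ∀ x : ℝ, ∃ x', |x' - x| ≤ 1 / ((N : ℝ) + 1) ∧
      (![x', v.1, v.2], ![0, v.2, -v.1]) ∈ X := by
    intro N
    obtain ⟨p, φ, h, hp, hφ, hpN⟩ := hX.exists_generic hd hne (N + 1)
    obtain ⟨k, j, hr0, hr⟩ := exists_small_combination N.succ_pos
      (fun k j hk hj hkj => hpN k j hk hj hkj)
    set r := (k : ℝ) * p 1 + j * p 2 with hrdef
    set μ := max |p 1| |p 2| with hμdef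
    have hμ : 0 < μ := lt_of_lt_of_le (abs_pos.2 (hp 1)) (le_max_left _ _)
    refine ⟨(p 1 / μ, p 2 / μ), ?_, fun x => ?_⟩
    · rw [Prod.norm_def, Real.norm_eq_abs, Real.norm_eq_abs, abs_div, abs_div, abs_of_pos hμ,
        max_div_div_right hμ.le, div_self hμ.ne']
    · set t : ℤ := round ((x * μ - p 0) / r) with ht
      refine ⟨(p 0 + t * r) / μ, ?_, ?_⟩
      · have h1 := abs_sub_round ((x * μ - p 0) / r)
        rw [← ht] at h1
        have e : (p 0 + t * r) / μ - x = -(((x * μ - p 0) / r - t) * r) / μ := by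
          field_simp
          ring
        rw [e, abs_div, abs_neg, abs_mul, abs_of_pos hμ, div_le_iff₀ hμ]
        have hN : (0 : ℝ) ≤ N := N.cast_nonneg
        have h2 : |r| ≤ 1 / ((N : ℝ) + 1) * μ := by
          refine hr.trans ?_
          rw [div_eq_mul_one_div, mul_comm]
          gcongr
          linarith
        nlinarith [abs_nonneg r]
      · have h1 := hX.smul (stepA p φ h hp hφ (t * k) (t * j)) (inv_ne_zero hμ.ne')
          (inv_ne_zero hμ.ne')
        convert h1 using 2
        · ext i
          fin_cases i
          · simp [hrdef]
            field_simp
          · simp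
            ring
          · simp
            ring
        · ext i
          fin_cases i
          · simp
          · simp
            ring
          · simp
            ring
  choose v hv1 hv2 using stepB
  -- The normalized directions v converge along a subsequence, and the nets fill the circle over the
  -- limit plane.
  obtain ⟨⟨y, z⟩, hyz, θ, hθ, hlim⟩ := (isCompact_sphere (0 : ℝ × ℝ) 1).tendsto_subseq
    (x := v) (fun n => by simpa using hv1 n)
  have hne0 : y ≠ 0 ∨ z ≠ 0 := by
    by_contra! hc
    simp [hc.1, hc.2, Prod.norm_def] at hyz
  have hvec : ∀ x : ℝ, (![x, y, z] : Vec3) ≠ 0 := by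
    intro x h0
    have h1 := congrFun h0 1
    have h2 := congrFun h0 2
    simp at h1 h2
    rcases hne0 with h | h <;> contradiction
  have hφ0 : (![0, z, -y] : Vec3) ≠ 0 := by
    intro h0
    have h1 := congrFun h0 1
    have h2 := congrFun h0 2
    simp at h1 h2
    rcases hne0 with h | h <;> contradiction
  have hl1 : Tendsto (fun n => (v (θ n)).1) atTop (𝓝 y) :=
    (continuous_fst.tendsto (y, z)).comp hlim
  have hl2 : Tendsto (fun n => (v (θ n)).2) atTop (𝓝 z) :=
    (continuous_snd.tendsto (y, z)).comp hlim
  have main : ∀ x : ℝ, (![x, y, z], ![0, z, -y]) ∈ X := by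
    intro x
    choose x' hx1 hx2 using fun n => hv2 n x
    refine hX.closed (fun n => hx2 (θ n)) ?_ ?_ (hvec x) hφ0
    · refine tendsto_vec3 ?_ hl1 hl2
      have h1 : Tendsto x' atTop (𝓝 x) := by
        rw [tendsto_iff_dist_tendsto_zero]
        exact squeeze_zero (fun _ => dist_nonneg) hx1 tendsto_one_div_add_atTop_nhds_zero_nat
      exact h1.comp hθ.tendsto_atTop
    · exact tendsto_vec3 tendsto_const_nhds hl2 hl1.neg
  have main' : ∀ q : Vec3, z * q 1 - y * q 2 = 0 → y * q 1 + z * q 2 ≠ 0 →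
      (q, ![0, z, -y]) ∈ X := by
    intro q h1 h2
    have h3 : 0 < y * y + z * z := by
      rcases hne0 with h | h
      · have := mul_self_pos.2 h
        nlinarith [mul_self_nonneg z]
      · have := mul_self_pos.2 h
        nlinarith [mul_self_nonneg y]
    have h4 : (y * q 1 + z * q 2) / (y * y + z * z) ≠ 0 := div_ne_zero h2 h3.ne'
    have h5 := hX.smul (main (q 0 * (y * y + z * z) / (y * q 1 + z * q 2))) h4 one_ne_zero
    convert h5 using 2
    · ext i
      fin_cases i
      · simp
        rw [div_mul_div_comm, mul_comm (y * y + z * z), eq_div_iff (mul_ne_zero h2 h3.ne')]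
        ring
      · simp
        rw [div_mul_eq_mul_div, eq_div_iff h3.ne']
        linear_combination z * h1
      · simp
        rw [div_mul_eq_mul_div, eq_div_iff h3.ne']
        linear_combination (-y) * h1
    · simp
  refine ⟨_, hφ0, fun q hq hq' => ?_⟩
  have hq1 : z * q 1 - y * q 2 = 0 := by
    simp [dotProduct, Fin.sum_univ_three] at hq'
    linarith
  by_cases hc : y * q 1 + z * q 2 = 0
  · refine hX.mem_of_perturb (d := ![0, y, z]) hq hφ0 fun ε hε _ => main' _ ?_ ?_
    · simp
      linear_combination hq1
    · have e : y * (q + ε • ![0, y, z]) 1 + z * (q + ε • ![0, y, z]) 2 =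
          ε * (y * y + z * z) := by
        simp
        linear_combination hc
      rw [e]
      refine mul_ne_zero hε.ne' ?_
      rcases hne0 with h | h
      · have := mul_self_pos.2 h
        nlinarith [mul_self_nonneg z]
      · have := mul_self_pos.2 h
        nlinarith [mul_self_nonneg y]
  · exact main' q hq1 hc

/-! ### Diagonal planes. -/

/-- If a product of two affine functions with distinct zeros is nonnegative on the positive reals,
all coefficients of each of them have the same sign. -/
theorem mul_pos_of_forall_nonneg {a b c d : ℝ} (ha : a ≠ 0) (hc : c ≠ 0) (hb : b ≠ 0) (hd : d ≠ 0)
    (hdet : a * d - b * c ≠ 0) (h : ∀ t : ℝ, 0 < t → 0 ≤ (t * a + b) * (t * c + d)) :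
    0 < a * c ∧ 0 < a * b := by
  obtain ⟨x, rfl⟩ : ∃ x, b = -(a * x) := ⟨-b / a, by field_simp⟩
  obtain ⟨y, rfl⟩ : ∃ y, d = -(c * y) := ⟨-d / c, by field_simp⟩
  have hx : x ≠ 0 := by
    rintro rfl
    simp at hb
  have hy : y ≠ 0 := by
    rintro rfl
    simp at hd
  have hxy : x ≠ y := by
    rintro rfl
    apply hdet
    ring
  have h' : ∀ t : ℝ, 0 < t → 0 ≤ a * c * ((t - x) * (t - y)) := by
    intro t ht
    have := h t ht
    linarith
  have hac : 0 < a * c := by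
    by_contra hneg
    have hlt : a * c < 0 := lt_of_le_of_ne (not_lt.1 hneg) (mul_ne_zero ha hc)
    have h1 := h' (|x| + |y| + 1) (by positivity)
    have h2 : 0 < |x| + |y| + 1 - x := by linarith [le_abs_self x, abs_nonneg y]
    have h3 : 0 < |x| + |y| + 1 - y := by linarith [le_abs_self y, abs_nonneg x]
    nlinarith [mul_pos h2 h3]
  refine ⟨hac, ?_⟩
  -- A positive zero x would be a sign change. It is detected midway between x and y if x < y, and
  -- midway between max y 0 and x otherwise.
  have hx0 : x < 0 := by
    by_contra hpos
    have hxp : 0 < x := lt_of_le_of_ne (not_lt.1 hpos) hx.symm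
    rcases lt_or_gt_of_ne hxy with hlt | hlt
    · have h1 := h' ((x + y) / 2) (by linarith)
      have h2 : ((x + y) / 2 - x) * ((x + y) / 2 - y) = -((y - x) ^ 2 / 4) := by ring
      rw [h2] at h1
      have : 0 < (y - x) ^ 2 := by
        have : 0 < y - x := by linarith
        positivity
      nlinarith
    · have h1 := h' ((x + max y 0) / 2) (by
        have := le_max_right y 0
        linarith)
      have h2 : max y 0 < x := max_lt hlt hxp
      have h3 : (x + max y 0) / 2 - x < 0 := by linarith
      have h4 : 0 < (x + max y 0) / 2 - y := by
        have := le_max_left y 0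
        linarith
      nlinarith [mul_neg_of_neg_of_pos h3 h4]
  have := mul_self_pos.2 ha
  nlinarith

/-- A nonvanishing condition on matrices: all entries and all `2 × 2` minors are nonzero. -/
def IsGenericMatrix (M : Mat3) : Prop :=
  (∀ i j, M i j ≠ 0) ∧ ∀ l m i j, l ≠ m → i ≠ j → M l i * M m j - M l j * M m i ≠ 0

theorem isGenericMatrix_intCast {M : Fin 3 → Fin 3 → ℤ} (h0 : ∀ i j, M i j ≠ 0)
    (h : ∀ l m i j, l ≠ m → i ≠ j → M l i * M m j - M l j * M m i ≠ 0) :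
    IsGenericMatrix ((of M).map (Int.castRingHom ℝ)) := by
  refine ⟨fun i j => ?_, fun l m i j hlm hij => ?_⟩
  · simpa using h0 i j
  · have := h l m i j hlm hij
    simp only [map_apply, of_apply, eq_intCast]
    exact_mod_cast this

/-- The witness is the symmetric Pascal matrix: its entries and 2 × 2 minors are nonzero, and up to
sign the inverse exchanges the two. -/
theorem exists_generic_SL3 : ∃ g : SL(3, ℝ), IsGenericMatrix (g : Mat3) ∧
    IsGenericMatrix ((g⁻¹ : SL(3, ℝ)) : Mat3) := by
  let P : SL(3, ℤ) := ⟨!![1, 1, 1; 1, 2, 3; 1, 3, 6], by rw [det_fin_three]; decide⟩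
  let Q : SL(3, ℤ) := ⟨!![3, -3, 1; -3, 5, -2; 1, -2, 1], by rw [det_fin_three]; decide⟩
  have hPQ : P⁻¹ = Q := inv_eq_of_mul_eq_one_right (Subtype.ext (by decide))
  refine ⟨Matrix.SpecialLinearGroup.map (Int.castRingHom ℝ) P, ?_, ?_⟩
  · exact isGenericMatrix_intCast (M := ![![1, 1, 1], ![1, 2, 3], ![1, 3, 6]]) (by decide) (by decide)
  · rw [← map_inv, hPQ]
    exact isGenericMatrix_intCast (M := ![![3, -3, 1], ![-3, 5, -2], ![1, -2, 1]]) (by decide)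
      (by decide)

theorem exists_generic_matrix {Γ : Subgroup SL(3, ℝ)}
    (hd : IsZariskiDense (Γ : Set SL(3, ℝ))) :
    ∃ g ∈ Γ, IsGenericMatrix (g : Mat3) ∧ IsGenericMatrix ((g⁻¹ : SL(3, ℝ)) : Mat3) := by
  let s : Finset ((Fin 3 × Fin 3) × (Fin 3 × Fin 3)) :=
    Finset.univ.filter fun x => x.1.1 ≠ x.1.2 ∧ x.2.1 ≠ x.2.2
  let f : SL(3, ℝ) → ℝ := fun g => (∏ x : Fin 3 × Fin 3, (g : Mat3) x.1 x.2) *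
    ∏ x ∈ s, ((g : Mat3) x.1.1 x.2.1 * (g : Mat3) x.1.2 x.2.2 -
      (g : Mat3) x.1.1 x.2.2 * (g : Mat3) x.1.2 x.2.1)
  have hf : f ∈ polyFun := by
    refine mul_mem_polyFun (prod_mem_polyFun _ fun x _ => entry_mem_polyFun _ _)
      (prod_mem_polyFun _ fun x _ => sub_mem_polyFun ?_ ?_)
    · exact mul_mem_polyFun (entry_mem_polyFun _ _) (entry_mem_polyFun _ _)
    · exact mul_mem_polyFun (entry_mem_polyFun _ _) (entry_mem_polyFun _ _)
  have hiff : ∀ g : SL(3, ℝ), f g ≠ 0 ↔ IsGenericMatrix (g : Mat3) := by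
    intro g
    simp only [f, s, IsGenericMatrix, mul_ne_zero_iff, Finset.prod_ne_zero_iff, Finset.mem_univ,
      true_implies, Finset.mem_filter, Prod.forall, true_and, and_imp]
  obtain ⟨g₀, h₀, h₀'⟩ := exists_generic_SL3
  obtain ⟨g, hg, hfg⟩ := hd.exists_ne_zero
    (mul_mem_polyFun hf (comp_mem_polyFun hf inv_entry_mem_polyFun)) g₀
    (mul_ne_zero ((hiff _).2 h₀) ((hiff _).2 h₀'))
  exact ⟨g, hg, (hiff _).1 (left_ne_zero_of_mul hfg), (hiff _).1 (right_ne_zero_of_mul hfg)⟩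

theorem exists_third (i j : Fin 3) (h : i ≠ j) :
    ∃ k, k ≠ i ∧ k ≠ j ∧ ∀ l, l = i ∨ l = j ∨ l = k := by
  revert i j
  decide

theorem IsDiscretePlane.neg {Γ : Subgroup SL(3, ℝ)} {D : ℤ × ℤ → SL(3, ℝ)}
    (hD : IsDiscretePlane Γ D) (w : ℤ × ℤ) : D (-w) = (D w)⁻¹ := by
  have h0 : D 0 = 1 := by
    have := hD.add 0 0
    rw [add_zero] at this
    exact left_eq_mul.1 this
  rw [eq_inv_iff_mul_eq_one, ← hD.add, neg_add_cancel, h0]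

theorem single_add_single_eq {i j k : Fin 3} (hki : k ≠ i) (hkj : k ≠ j) (hij : i ≠ j)
    (hcov : ∀ l, l = i ∨ l = j ∨ l = k) {q : Vec3} (hq : q k = 0) :
    q = Pi.single i (q i) + Pi.single j (q j) := by
  ext l
  rcases hcov l with rfl | rfl | rfl
  · simp [hij]
  · simp [hij.symm]
  · simp [hki, hkj, hq]

/-- The closure of the orbit of a flag in general position under a discrete group of diagonal
matrices contains an arc of points on each coordinate line. -/
theorem IsFlagSet.arc_mem {Γ : Subgroup SL(3, ℝ)} {X : Set (Vec3 × Vec3)} (hX : IsFlagSet Γ X)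
    {D : ℤ × ℤ → SL(3, ℝ)} (hD : IsDiscretePlane Γ D) {d : ℤ × ℤ → Vec3}
    (hf : ∀ w, (D w : Mat3) = diagonal (d w)) {i j k : Fin 3} (hki : k ≠ i) (hkj : k ≠ j)
    (hij : i ≠ j) (hcov : ∀ l, l = i ∨ l = j ∨ l = k) {p φ : Vec3} (h : (p, φ) ∈ X)
    (hpj : p j ≠ 0) (hφk : φ k ≠ 0) {t : ℝ} (ht : 0 < t) :
    (Pi.single i (t * p i) + Pi.single j (p j), Pi.single k (1 : ℝ)) ∈ X := by
  have hsum : ∀ f : Fin 3 → ℝ, ∑ l, f l = f i + f j + f k := by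
    intro f
    rw [← Finset.sum_subset (Finset.subset_univ {i, j, k}) (fun x _ hx => by
      exfalso
      apply hx
      simpa using hcov x)]
    rw [Finset.sum_insert (by simp [hij, hki.symm]), Finset.sum_insert (by simp [hkj.symm]),
      Finset.sum_singleton]
    ring
  have hprod : ∀ w, ∏ l, d w l = 1 := by
    intro w
    have h1 : (D w : Mat3).det = 1 := (D w).2
    rwa [hf, det_diagonal] at h1
  have hd0 : ∀ w l, d w l ≠ 0 := by
    intro w l h0
    have := hprod w
    rw [Finset.prod_eq_zero (Finset.mem_univ l) h0] at this
    exact zero_ne_one this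
  have hmul : ∀ v w l, d (v + w) l = d v l * d w l := by
    intro v w l
    have h1 : (D (v + w) : Mat3) = (D v : Mat3) * (D w : Mat3) := by
      rw [hD.add, Matrix.SpecialLinearGroup.coe_mul]
    rw [hf, hf, hf, diagonal_mul_diagonal] at h1
    exact congrFun (diagonal_injective h1) l
  let L : Fin 3 → (ℤ × ℤ →+ ℝ) := fun l => AddMonoidHom.mk' (fun w => Real.log |d w l|) (by
    intro v w
    rw [hmul, abs_mul, Real.log_mul (abs_ne_zero.2 (hd0 v l)) (abs_ne_zero.2 (hd0 w l))])
  have hexp : ∀ w l, |d w l| = Real.exp (L l w) := fun w l =>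
    (Real.exp_log (abs_pos.2 (hd0 w l))).symm
  have hL : ∀ w, L i w + L j w + L k w = 0 := by
    intro w
    rw [← hsum fun l => L l w]
    change ∑ l, Real.log |d w l| = 0
    rw [← Real.log_prod (fun l _ => abs_ne_zero.2 (hd0 w l)), ← Finset.abs_prod, hprod]
    simp
  -- Passing to w + w squares the eigenvalues and so removes their signs.
  have hdd : ∀ w l, d (w + w) l = Real.exp (2 * L l w) := by
    intro w l
    rw [hmul, ← abs_mul_abs_self, hexp, ← Real.exp_add]
    ring_nf
  let u : ℤ × ℤ →+ ℝ := AddMonoidHom.mk' (fun w => 2 * L i w - 2 * L j w) (by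
    intro v w
    rw [map_add, map_add]
    ring)
  have hudef : ∀ w, u w = 2 * L i w - 2 * L j w := fun w => rfl
  have hu : ∀ w, u w = 0 → w = 0 := by
    intro w hw
    have h1 : w + w = 0 := by
      refine hD.eq_zero_of_diagonal (hf _) hcov ?_
      rw [hdd, hdd]
      congr 1
      rw [hudef] at hw
      linarith
    have h2 : (2 : ℤ) • w = 0 := by rw [two_zsmul]; exact h1
    exact (smul_eq_zero.1 h2).resolve_left (by norm_num)
  have hfin : ∀ C, {w | |u w| ≤ C ∧ |(-(L k)) w| ≤ C}.Finite := by
    intro C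
    refine (hD.fin (Real.exp C)).subset ?_
    rintro w ⟨h1, h2⟩
    have h3 := hL w
    rw [hudef] at h1
    rw [AddMonoidHom.neg_apply] at h2
    obtain ⟨h1, h1'⟩ := abs_le.1 h1
    obtain ⟨h2, h2'⟩ := abs_le.1 h2
    have hle : ∀ l, |d w l| ≤ Real.exp C := by
      intro l
      rw [hexp]
      refine Real.exp_le_exp.2 ?_
      rcases hcov l with rfl | rfl | rfl <;> linarith
    intro a b
    rw [hf]
    by_cases hab : a = b
    · subst hab
      rw [diagonal_apply_eq]
      exact hle a
    · rw [diagonal_apply_ne _ hab, abs_zero]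
      exact (Real.exp_pos C).le
  -- The ratio of the i and j eigenvalues tends to t while the k eigenvalue becomes negligible, so
  -- the plane tends to the coordinate plane x_k = 0.
  obtain ⟨w, hw1, hw2⟩ := exists_seq_tendsto_atTop u (-(L k)) hu hfin (Real.log t)
  have hw2' : Tendsto (fun n => 3 * L k (w n)) atTop atBot := by
    have h1 : Tendsto (fun n => -(3 * (-(L k)) (w n))) atTop atBot :=
      tendsto_neg_atTop_atBot.comp (hw2.const_mul_atTop (by norm_num : (0 : ℝ) < 3))
    refine h1.congr fun n => ?_
    rw [AddMonoidHom.neg_apply]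
    ring
  have hlimj : Tendsto (fun n => Real.exp (2 * L k (w n) - 2 * L j (w n))) atTop (𝓝 0) := by
    refine Real.tendsto_exp_atBot.comp ?_
    refine (hw2'.atBot_add (hw1.div_const 2)).congr fun n => ?_
    have := hL (w n)
    rw [hudef]
    linarith
  have hlimi : Tendsto (fun n => Real.exp (2 * L k (w n) - 2 * L i (w n))) atTop (𝓝 0) := by
    refine Real.tendsto_exp_atBot.comp ?_
    refine (hw2'.atBot_add (hw1.div_const 2).neg).congr fun n => ?_
    have := hL (w n)
    rw [hudef]
    linarith
  have hlimt : Tendsto (fun n => Real.exp (2 * L i (w n) - 2 * L j (w n))) atTop (𝓝 t) := by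
    have := (Real.continuous_exp.tendsto _).comp hw1
    rwa [Real.exp_log ht] at this
  have hinv : ∀ n, (((D (w n + w n))⁻¹ : SL(3, ℝ)) : Mat3) =
      diagonal fun l => Real.exp (-(2 * L l (w n))) := by
    intro n
    rw [← hD.neg, neg_add, hf]
    congr 1
    ext l
    rw [hdd, map_neg]
    ring_nf
  have hfw : ∀ n, (D (w n + w n) : Mat3) = diagonal fun l => Real.exp (2 * L l (w n)) := by
    intro n
    rw [hf]
    congr 1
    ext l
    rw [hdd]
  refine hX.of_smul one_ne_zero hφk ?_
  rw [one_smul]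
  refine hX.limit (g := fun n => D (w n + w n)) (fun n => hD.mem _) h
    (a := fun n => Real.exp (-(2 * L j (w n)))) (b := fun n => Real.exp (2 * L k (w n)))
    (fun n => (Real.exp_pos _).ne') (fun n => (Real.exp_pos _).ne') ?_ ?_ ?_ ?_
  · rw [tendsto_pi_nhds]
    intro l
    have hform : ∀ n, (Real.exp (-(2 * L j (w n))) • ((D (w n + w n) : Mat3) *ᵥ p)) l =
        Real.exp (2 * L l (w n) - 2 * L j (w n)) * p l := by
      intro n
      rw [Pi.smul_apply, hfw, mulVec_diagonal, smul_eq_mul, ← mul_assoc, ← Real.exp_add]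
      ring_nf
    simp only [hform]
    rcases hcov l with rfl | rfl | rfl
    · simpa [hij] using hlimt.mul_const (p l)
    · simp [hij.symm]
    · simpa [hki, hkj] using hlimj.mul_const (p l)
  · rw [tendsto_pi_nhds]
    intro l
    have hform : ∀ n, (Real.exp (2 * L k (w n)) • (φ ᵥ* (((D (w n + w n))⁻¹ : SL(3, ℝ)) : Mat3))) l
        = Real.exp (2 * L k (w n) - 2 * L l (w n)) * φ l := by
      intro n
      rw [Pi.smul_apply, hinv, vecMul_diagonal, smul_eq_mul, mul_comm (φ l), ← mul_assoc,
        ← Real.exp_add]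
      ring_nf
    simp only [hform]
    rcases hcov l with rfl | rfl | rfl
    · simpa [hki.symm] using hlimi.mul_const (φ l)
    · simpa [hkj.symm] using hlimj.mul_const (φ l)
    · simp
  · intro h0
    have := congrFun h0 j
    simp [hij.symm] at this
    exact hpj this
  · intro h0
    have := congrFun h0 k
    simp at this
    exact hφk this

/-- Argues by contradiction: without a circle, all flags of X obey the sign pattern of p, and Γ must
preserve that pattern. A generic g and its inverse would then both be of constant sign after
rescaling by p, which contradicts g g⁻¹ = 1. -/
theorem hasCircle_of_diagonal {Γ : Subgroup SL(3, ℝ)}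
    (hd : IsZariskiDense (Γ : Set SL(3, ℝ))) {D : ℤ × ℤ → SL(3, ℝ)} (hD : IsDiscretePlane Γ D)
    {d : ℤ × ℤ → Vec3} (hf : ∀ w, (D w : Mat3) = diagonal (d w)) : HasCircle Γ := by
  intro X hX hne
  obtain ⟨p, φ, h, hp, hφ, -⟩ := hX.exists_generic hd hne 0
  by_contra hno
  -- A flag of the opposite sign would supply the other arc over x_k = 0. The two arcs and their
  -- common endpoints make up a full circle.
  have hsign : ∀ q ψ, (q, ψ) ∈ X → ∀ i j k : Fin 3, k ≠ i → k ≠ j → i ≠ j →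
      (∀ l, l = i ∨ l = j ∨ l = k) → ψ k ≠ 0 → 0 ≤ q i * q j * (p i * p j) := by
    intro q ψ hq i j k hki hkj hij hcov hψk
    by_contra hneg
    push Not at hneg
    apply hno
    have hqi : q i ≠ 0 := fun h0 => by simp [h0] at hneg
    have hqj : q j ≠ 0 := fun h0 => by simp [h0] at hneg
    have main : ∀ v : Vec3, v k = 0 → v i ≠ 0 → v j ≠ 0 → (v, Pi.single k (1 : ℝ)) ∈ X := by
      intro v hvk hvi hvj
      have aux : ∀ q ψ, (q, ψ) ∈ X → ψ k ≠ 0 → q i ≠ 0 → q j ≠ 0 → 0 < v i * v j * (q i * q j) →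
          (v, Pi.single k (1 : ℝ)) ∈ X := by
        intro q ψ hq hψk hqi hqj hpos
        have ht : 0 < v i * q j / (v j * q i) := by
          have e : v i * q j / (v j * q i) = v i * v j * (q i * q j) / (v j * q i) ^ 2 := by
            field_simp
          rw [e]
          have := mul_ne_zero hvj hqi
          positivity
        have h1 := hX.arc_mem hD hf hki hkj hij hcov hq hqj hψk ht
        have h2 := hX.smul h1 (div_ne_zero hvj hqj) one_ne_zero
        rw [one_smul] at h2
        convert h2 using 2
        rw [smul_add, ← Pi.single_smul, ← Pi.single_smul]
        conv_lhs => rw [single_add_single_eq hki hkj hij hcov hvk]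
        congr 2
        · simp only [smul_eq_mul]
          field_simp
        · simp only [smul_eq_mul]
          field_simp
      rcases lt_or_gt_of_ne (mul_ne_zero (mul_ne_zero hvi hvj) (mul_ne_zero (hp i) (hp j)))
        with h3 | h3
      · refine aux q ψ hq hψk hqi hqj ?_
        by_contra h4
        have h4' : v i * v j * (q i * q j) < 0 := lt_of_le_of_ne (not_lt.1 h4)
          (mul_ne_zero (mul_ne_zero hvi hvj) (mul_ne_zero hqi hqj))
        have h5 := mul_pos_of_neg_of_neg h3 h4'
        have h6 : 0 < (v i * v j) ^ 2 := by
          have := mul_ne_zero hvi hvj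
          positivity
        nlinarith
      · exact aux p φ h (hφ k) (hp i) (hp j) h3
    refine ⟨Pi.single k 1, by simp, fun v hv hvk => ?_⟩
    rw [single_one_dotProduct] at hvk
    by_cases hvi : v i = 0
    · by_cases hvj : v j = 0
      · exfalso
        apply hv
        ext l
        rcases hcov l with rfl | rfl | rfl <;> assumption
      · refine hX.mem_of_perturb (d := Pi.single i (v j)) hv (by simp) fun ε hε _ =>
          main _ ?_ ?_ ?_
        · simp [hvk, hki]
        · simp [hvi, hvj, hε.ne']
        · simp [hvj, hij.symm]
    · by_cases hvj : v j = 0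
      · refine hX.mem_of_perturb (d := Pi.single j (v i)) hv (by simp) fun ε hε _ =>
          main _ ?_ ?_ ?_
        · simp [hvk, hkj]
        · simp [hvi, hij]
        · simp [hvj, hvi, hε.ne']
      · exact main v hvk hvi hvj
  -- Applying g to the arc with parameter t gives coordinates affine in t. Their products keep one
  -- sign for all t > 0, so the numbers p_l g_li p_i agree in sign along rows and columns.
  have hpos : ∀ g ∈ Γ, IsGenericMatrix (g : Mat3) →
      (∀ i j, ((g⁻¹ : SL(3, ℝ)) : Mat3) i j ≠ 0) → ∀ l m i j, l ≠ m → i ≠ j →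
      0 < (p l * (g : Mat3) l i * p i) * (p m * (g : Mat3) m i * p i) ∧
      0 < (p l * (g : Mat3) l i * p i) * (p l * (g : Mat3) l j * p j) := by
    intro g hg hgen hginv l m i j hlm hij
    obtain ⟨k, hki, hkj, hcov⟩ := exists_third i j hij
    obtain ⟨n, hnl, hnm, hcov'⟩ := exists_third l m hlm
    have hne0 : ∀ l i, p l * (g : Mat3) l i * p i ≠ 0 := fun l i =>
      mul_ne_zero (mul_ne_zero (hp l) (hgen.1 l i)) (hp i)
    refine mul_pos_of_forall_nonneg (hne0 l i) (hne0 m i) (hne0 l j) (d := p m * (g : Mat3) m j * p j)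
      (hne0 m j) ?_ ?_
    · have h1 := hgen.2 l m i j hlm hij
      have h2 : p l * (g : Mat3) l i * p i * (p m * (g : Mat3) m j * p j) -
          p l * (g : Mat3) l j * p j * (p m * (g : Mat3) m i * p i) = p l * p m * p i * p j *
          ((g : Mat3) l i * (g : Mat3) m j - (g : Mat3) l j * (g : Mat3) m i) := by ring
      rw [h2]
      exact mul_ne_zero (mul_ne_zero (mul_ne_zero (mul_ne_zero (hp l) (hp m)) (hp i)) (hp j)) h1
    · intro t ht
      have h1 := hX.inv (hX.arc_mem hD hf hki hkj hij hcov h (hp j) (hφ k) ht) hg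
      have h2 := hsign _ _ h1 l m n hnl hnm hlm hcov' (by
        rw [single_one_vecMul]
        exact hginv k n)
      rw [mulVec_add, Pi.add_apply, Pi.add_apply, mulVec_single, mulVec_single] at h2
      simp at h2
      linarith
  obtain ⟨g, hg, hg1, hg2⟩ := exists_generic_matrix hd
  have h1 := hpos g hg hg1 hg2.1
  have h2 := hpos g⁻¹ (Γ.inv_mem hg) hg2 (by rw [inv_inv]; exact hg1.1)
  have h3 := congrFun (congrFun (coe_mul_coe_inv g) 0) 1
  rw [Matrix.mul_apply, Fin.sum_univ_three] at h3
  simp only [ne_eq, zero_ne_one, not_false_eq_true, one_apply_ne] at h3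
  set G := (g : Mat3)
  set H := ((g⁻¹ : SL(3, ℝ)) : Mat3)
  -- The three terms of the (0, 1) entry of g g⁻¹ are nonzero of equal sign, yet they sum to zero.
  have hx : ∀ i j, i ≠ j → 0 < (G 0 i * H i 1) * (G 0 j * H j 1) := by
    intro i j hij
    have h4 := (h1 0 1 i j (by decide) hij).2
    have h5 := (h2 i j 1 0 hij (by decide)).1
    have h6 := mul_pos h4 h5
    have h7 : 0 < (p 0 * p 1 * p i * p i * (p j * p j)) ^ 2 / (p i ^ 2 * p j ^ 2) := by
      have := hp 0
      have := hp 1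
      have := hp i
      have := hp j
      positivity
    have h8 : p 0 * G 0 i * p i * (p 0 * G 0 j * p j) * (p i * H i 1 * p 1 * (p j * H j 1 * p 1)) =
        (p 0 * p 1 * p i * p i * (p j * p j)) ^ 2 / (p i ^ 2 * p j ^ 2) *
          ((G 0 i * H i 1) * (G 0 j * H j 1)) := by
      have := hp i
      have := hp j
      field_simp
    rw [h8] at h6
    exact (pos_iff_pos_of_mul_pos h6).1 h7
  have h01 := hx 0 1 (by decide)
  have h02 := hx 0 2 (by decide)
  have e : G 0 0 * H 0 1 * (G 0 0 * H 0 1) + G 0 0 * H 0 1 * (G 0 1 * H 1 1) +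
      G 0 0 * H 0 1 * (G 0 2 * H 2 1) = 0 := by linear_combination (G 0 0 * H 0 1) * h3
  linarith [mul_self_nonneg (G 0 0 * H 0 1)]

/-! ### Normal forms from the centralizer of one element. -/

theorem exists_cube_eq (x : ℝ) : ∃ c : ℝ, c ^ 3 = x := by
  rcases le_total 0 x with h | h
  · exact ⟨x ^ ((3 : ℕ) : ℝ)⁻¹, Real.rpow_inv_natCast_pow h (by norm_num)⟩
  · refine ⟨-(-x) ^ ((3 : ℕ) : ℝ)⁻¹, ?_⟩
    rw [Odd.neg_pow (by decide), Real.rpow_inv_natCast_pow (by linarith) (by norm_num), neg_neg]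

theorem mulVec_eq_sum_cols (v₀ v₁ v₂ w : Vec3) :
    (Matrix.of ![v₀, v₁, v₂])ᵀ *ᵥ w = w 0 • v₀ + w 1 • v₁ + w 2 • v₂ := by
  ext i
  simp [mulVec_apply_three]
  ring

/-- Change of basis by an element of `SL(3, ℝ)`. -/
theorem exists_conj_of_basis {v₀ v₁ v₂ : Vec3}
    (h : ∀ a b c : ℝ, a • v₀ + b • v₁ + c • v₂ = 0 → a = 0 ∧ b = 0 ∧ c = 0) :
    ∃ B : SL(3, ℝ), ∀ (g : SL(3, ℝ)) (N : Mat3),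
      (g : Mat3) *ᵥ v₀ = N 0 0 • v₀ + N 1 0 • v₁ + N 2 0 • v₂ →
      (g : Mat3) *ᵥ v₁ = N 0 1 • v₀ + N 1 1 • v₁ + N 2 1 • v₂ →
      (g : Mat3) *ᵥ v₂ = N 0 2 • v₀ + N 1 2 • v₁ + N 2 2 • v₂ →
      ((B⁻¹ * g * B : SL(3, ℝ)) : Mat3) = N := by
  set V : Mat3 := (Matrix.of ![v₀, v₁, v₂])ᵀ with hV
  have hdet : V.det ≠ 0 := by
    intro h0
    obtain ⟨w, hw, hw0⟩ := Matrix.exists_mulVec_eq_zero_iff.2 h0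
    rw [hV, mulVec_eq_sum_cols] at hw0
    obtain ⟨h1, h2, h3⟩ := h _ _ _ hw0
    apply hw
    ext i
    fin_cases i <;> assumption
  -- Rescaling all basis vectors by c gives determinant one and does not change the conjugated
  -- matrix.
  obtain ⟨c, hc⟩ := exists_cube_eq (V.det)⁻¹
  have hB : (c • V).det = 1 := by
    rw [det_smul, Fintype.card_fin, hc, inv_mul_cancel₀ hdet]
  obtain ⟨B, hB⟩ := exists_coe_eq hB
  refine ⟨B, fun g N h0 h1 h2 => ?_⟩
  have key : (g : Mat3) * V = V * N := by
    ext i j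
    have e1 : ((g : Mat3) * V) i j = ((g : Mat3) *ᵥ (fun k => V k j)) i := rfl
    have e2 : (V * N) i j = (V *ᵥ fun k => N k j) i := rfl
    rw [e1, e2, hV, mulVec_eq_sum_cols]
    fin_cases j
    · exact congrFun h0 i
    · exact congrFun h1 i
    · exact congrFun h2 i
  rw [Matrix.SpecialLinearGroup.coe_mul, Matrix.SpecialLinearGroup.coe_mul, mul_assoc]
  have e : (g : Mat3) * (B : Mat3) = (B : Mat3) * N := by
    rw [hB, mul_smul_comm, key, smul_mul_assoc]
  rw [e, ← mul_assoc, coe_inv_mul_coe, one_mul]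

theorem exists_mulVec_ne_zero {M : Mat3} (h : M ≠ 0) : ∃ x, M *ᵥ x ≠ 0 := by
  by_contra! hc
  apply h
  ext i j
  have := congrFun (hc (Pi.single j 1)) i
  simpa using this

theorem exists_cubic_root (b c d : ℝ) : ∃ x : ℝ, x ^ 3 + b * x ^ 2 + c * x + d = 0 := by
  set R := 1 + |b| + |c| + |d| with hR
  have hR1 : 1 ≤ R := by
    have := abs_nonneg b
    have := abs_nonneg c
    have := abs_nonneg d
    linarith
  have hb := abs_le.1 (le_refl |b|)
  have hc := abs_le.1 (le_refl |c|)
  have hd := abs_le.1 (le_refl |d|)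
  have hRR : R ≤ R ^ 2 := by nlinarith
  have hb2 : -(|b| * R ^ 2) ≤ b * R ^ 2 ∧ b * R ^ 2 ≤ |b| * R ^ 2 := by
    constructor <;> nlinarith [sq_nonneg R]
  have hc2 : |c * R| ≤ |c| * R ^ 2 := by
    rw [abs_mul, abs_of_pos (by linarith : 0 < R)]
    exact mul_le_mul_of_nonneg_left hRR (abs_nonneg c)
  have hc3 := abs_le.1 hc2
  have hd2 : |d| ≤ |d| * R ^ 2 := by nlinarith [abs_nonneg d]
  have hR3 : R ^ 3 = R ^ 2 + |b| * R ^ 2 + |c| * R ^ 2 + |d| * R ^ 2 := by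
    rw [show R ^ 3 = R * R ^ 2 by ring]
    nth_rewrite 1 [hR]
    ring
  have hcont : ContinuousOn (fun x : ℝ => x ^ 3 + b * x ^ 2 + c * x + d) (Set.Icc (-R) R) := by
    fun_prop
  have h0 : (0 : ℝ) ∈ Set.Icc ((fun x : ℝ => x ^ 3 + b * x ^ 2 + c * x + d) (-R))
      ((fun x : ℝ => x ^ 3 + b * x ^ 2 + c * x + d) R) := by
    constructor
    · change (-R) ^ 3 + b * (-R) ^ 2 + c * (-R) + d ≤ 0
      have : (-R) ^ 3 = -R ^ 3 := by ring
      rw [this, neg_sq]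
      linarith
    · change 0 ≤ R ^ 3 + b * R ^ 2 + c * R + d
      linarith
  obtain ⟨x, -, hx⟩ := intermediate_value_Icc (by linarith) hcont h0
  exact ⟨x, hx⟩

/-- The factorization of a real cubic characteristic polynomial, with the Cayley-Hamilton
theorem. -/
theorem exists_charpoly_factor (M : Mat3) :
    (∃ a b c : ℝ, (∀ x : ℝ, (x • (1 : Mat3) - M).det = (x - a) * (x - b) * (x - c)) ∧
      (M - a • 1) * (M - b • 1) * (M - c • 1) = 0) ∨
    ∃ a μ ν : ℝ, ν ≠ 0 ∧ (∀ x : ℝ, (x • (1 : Mat3) - M).det = (x - a) * ((x - μ) ^ 2 + ν ^ 2)) ∧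
      ((M - μ • 1) * (M - μ • 1) + ν ^ 2 • 1) * (M - a • 1) = 0 := by
  have hdet : ∀ x : ℝ, (x • (1 : Mat3) - M).det = M.charpoly.eval x := by
    intro x
    rw [Matrix.eval_charpoly, smul_one_eq_diagonal, scalar_apply]
  obtain ⟨T, S, d, hTSd⟩ : ∃ T S d : ℝ, ∀ x : ℝ, (x • (1 : Mat3) - M).det =
      x ^ 3 + T * x ^ 2 + S * x + d := by
    refine ⟨-(M 0 0 + M 1 1 + M 2 2), M 0 0 * M 1 1 - M 0 1 * M 1 0 + M 0 0 * M 2 2 -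
      M 0 2 * M 2 0 + M 1 1 * M 2 2 - M 1 2 * M 2 1, -M.det, fun x => ?_⟩
    rw [det_fin_three, det_fin_three]
    simp
    ring
  obtain ⟨a, ha⟩ := exists_cubic_root T S d
  set β := a + T with hβ
  set κ := a ^ 2 + T * a + S with hκ
  have hfac : ∀ x : ℝ, (x • (1 : Mat3) - M).det = (x - a) * (x ^ 2 + β * x + κ) := by
    intro x
    rw [hTSd, hβ, hκ]
    linear_combination ha
  by_cases hdisc : 0 ≤ β ^ 2 - 4 * κ
  · left
    set r := Real.sqrt (β ^ 2 - 4 * κ) with hr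
    have hr2 : r ^ 2 = β ^ 2 - 4 * κ := Real.sq_sqrt hdisc
    have hfac' : ∀ x : ℝ, (x • (1 : Mat3) - M).det =
        (x - a) * (x - (-β + r) / 2) * (x - (-β - r) / 2) := by
      intro x
      rw [hfac]
      linear_combination (x - a) / 4 * hr2
    refine ⟨a, (-β + r) / 2, (-β - r) / 2, hfac', ?_⟩
    have hpoly : M.charpoly = (Polynomial.X - Polynomial.C a) *
        (Polynomial.X - Polynomial.C ((-β + r) / 2)) *
        (Polynomial.X - Polynomial.C ((-β - r) / 2)) := by
      refine Polynomial.funext fun x => ?_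
      rw [← hdet, hfac']
      simp
    have := Matrix.aeval_self_charpoly M
    rw [hpoly] at this
    simpa [Algebra.algebraMap_eq_smul_one] using this
  · right
    have hpos : 0 < κ - β ^ 2 / 4 := by
      push Not at hdisc
      linarith
    set r := Real.sqrt (κ - β ^ 2 / 4) with hr
    have hr2 : r ^ 2 = κ - β ^ 2 / 4 := Real.sq_sqrt hpos.le
    have hfac' : ∀ x : ℝ, (x • (1 : Mat3) - M).det =
        (x - a) * ((x - -β / 2) ^ 2 + r ^ 2) := by
      intro x
      rw [hfac, hr2]
      ring
    refine ⟨a, -β / 2, r, (Real.sqrt_pos.2 hpos).ne', hfac', ?_⟩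
    have hpoly : M.charpoly = ((Polynomial.X - Polynomial.C (-β / 2)) *
        (Polynomial.X - Polynomial.C (-β / 2)) + Polynomial.C (r ^ 2)) *
        (Polynomial.X - Polynomial.C a) := by
      refine Polynomial.funext fun x => ?_
      rw [← hdet, hfac']
      simp only [Polynomial.eval_mul, Polynomial.eval_add, Polynomial.eval_sub, Polynomial.eval_X,
        Polynomial.eval_C]
      ring
    have := Matrix.aeval_self_charpoly M
    rw [hpoly] at this
    simpa [Algebra.algebraMap_eq_smul_one, _root_.smul_pow] using this

theorem exists_eigenvector {M : Mat3} {a : ℝ} (h : (a • (1 : Mat3) - M).det = 0) :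
    ∃ v, v ≠ 0 ∧ M *ᵥ v = a • v := by
  obtain ⟨v, hv, h0⟩ := Matrix.exists_mulVec_eq_zero_iff.2 h
  refine ⟨v, hv, ?_⟩
  rw [sub_mulVec, smul_mulVec, one_mulVec] at h0
  exact (sub_eq_zero.1 h0).symm

theorem IsDiscretePlane.commute {Γ : Subgroup SL(3, ℝ)} {D : ℤ × ℤ → SL(3, ℝ)}
    (hD : IsDiscretePlane Γ D) (v w : ℤ × ℤ) :
    (D v : Mat3) * (D w : Mat3) = (D w : Mat3) * (D v : Mat3) := by
  rw [← Matrix.SpecialLinearGroup.coe_mul, ← Matrix.SpecialLinearGroup.coe_mul, ← hD.add,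
    ← hD.add, add_comm]

/-- The nine entrywise equations expressing that two matrices commute. -/
theorem commute_entries {A E : Mat3} (h : A * E = E * A) (i j : Fin 3) :
    A i 0 * E 0 j + A i 1 * E 1 j + A i 2 * E 2 j =
      E i 0 * A 0 j + E i 1 * A 1 j + E i 2 * A 2 j := by
  have := congrFun (congrFun h i) j
  simpa [Matrix.mul_apply, Fin.sum_univ_three] using this

theorem sub_smul_mulVec (M : Mat3) (a : ℝ) (x : Vec3) :
    (M - a • (1 : Mat3)) *ᵥ x = M *ᵥ x - a • x := by
  rw [sub_mulVec, smul_mulVec, one_mulVec]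

/-- In an eigenbasis of `D w₀` the commuting matrices are all diagonal. -/
theorem hasCircle_of_distinct {Γ : Subgroup SL(3, ℝ)}
    (hd : IsZariskiDense (Γ : Set SL(3, ℝ))) {D : ℤ × ℤ → SL(3, ℝ)} (hD : IsDiscretePlane Γ D)
    {w₀ : ℤ × ℤ} {a b c : ℝ} (hab : a ≠ b) (hac : a ≠ c) (hbc : b ≠ c)
    (hdet : ∀ x : ℝ, (x • (1 : Mat3) - (D w₀ : Mat3)).det = (x - a) * (x - b) * (x - c)) :
    HasCircle Γ := by
  obtain ⟨v₀, h₀, e₀⟩ := exists_eigenvector (M := (D w₀ : Mat3)) (a := a) (by rw [hdet]; ring)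
  obtain ⟨v₁, h₁, e₁⟩ := exists_eigenvector (M := (D w₀ : Mat3)) (a := b) (by rw [hdet]; ring)
  obtain ⟨v₂, h₂, e₂⟩ := exists_eigenvector (M := (D w₀ : Mat3)) (a := c) (by rw [hdet]; ring)
  obtain ⟨B, hB⟩ := exists_conj_of_basis (v₀ := v₀) (v₁ := v₁) (v₂ := v₂) (by
    intro x y z hxyz
    have h1 := congrArg (fun v => (D w₀ : Mat3) *ᵥ v) hxyz
    simp only [mulVec_add, mulVec_smul, e₀, e₁, e₂, mulVec_zero] at h1
    have h2 := congrArg (fun v => (D w₀ : Mat3) *ᵥ v) h1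
    simp only [mulVec_add, mulVec_smul, e₀, e₁, e₂, mulVec_zero] at h2
    have hz : (z * ((c - a) * (c - b))) • v₂ = 0 := by
      linear_combination (norm := module) h2 - (a + b) • h1 + (a * b) • hxyz
    have hy : (y * ((b - a) * (b - c))) • v₁ = 0 := by
      linear_combination (norm := module) h2 - (a + c) • h1 + (a * c) • hxyz
    have hx : (x * ((a - b) * (a - c))) • v₀ = 0 := by
      linear_combination (norm := module) h2 - (b + c) • h1 + (b * c) • hxyz
    have s1 := sub_ne_zero.2 hab
    have s2 := sub_ne_zero.2 hac
    have s3 := sub_ne_zero.2 hbc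
    have s4 := sub_ne_zero.2 hab.symm
    have s5 := sub_ne_zero.2 hac.symm
    have s6 := sub_ne_zero.2 hbc.symm
    simp only [smul_eq_zero, mul_eq_zero, h₀, h₁, h₂, s1, s2, s3, s4, s5, s6, or_false] at hx hy hz
    exact ⟨hx, hy, hz⟩)
  have hN := hB (D w₀) (diagonal ![a, b, c]) (by simp [e₀]) (by simp [e₁]) (by simp [e₂])
  refine hasCircle_of_conjGroup B ?_
  have hE := hD.conj B
  refine hasCircle_of_diagonal (isZariskiDense_conjGroup B hd) hE
    (d := fun w l => ((B⁻¹ * D w * B : SL(3, ℝ)) : Mat3) l l) fun w => ?_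
  have hc := commute_entries (hE.commute w₀ w)
  rw [hN] at hc
  ext i j
  by_cases hij : i = j
  · subst hij
    simp
  · rw [diagonal_apply_ne _ hij]
    have h1 := hc i j
    have s1 := sub_ne_zero.2 hab
    have s2 := sub_ne_zero.2 hac
    have s3 := sub_ne_zero.2 hbc
    fin_cases i <;> fin_cases j <;> first | exact absurd rfl hij | skip
    all_goals
      simp at h1 ⊢
    · exact (mul_eq_zero.1 (show (a - b) * _ = 0 by linear_combination h1)).resolve_left s1
    · exact (mul_eq_zero.1 (show (a - c) * _ = 0 by linear_combination h1)).resolve_left s2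
    · exact (mul_eq_zero.1 (show (a - b) * _ = 0 by linear_combination -h1)).resolve_left s1
    · exact (mul_eq_zero.1 (show (b - c) * _ = 0 by linear_combination h1)).resolve_left s3
    · exact (mul_eq_zero.1 (show (a - c) * _ = 0 by linear_combination -h1)).resolve_left s2
    · exact (mul_eq_zero.1 (show (b - c) * _ = 0 by linear_combination -h1)).resolve_left s3

/-- Regularity excludes (D - a)(D - b) = 0, so the eigenvalue a carries a genuine Jordan block.
Commuting with it forces the shape required by `hasCircle_of_shear`. -/
theorem hasCircle_of_double {Γ : Subgroup SL(3, ℝ)}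
    (hd : IsZariskiDense (Γ : Set SL(3, ℝ))) {D : ℤ × ℤ → SL(3, ℝ)} (hD : IsDiscretePlane Γ D)
    {w₀ : ℤ × ℤ} (hw₀ : w₀ ≠ 0) {a b : ℝ} (hab : a ≠ b)
    (hb : (b • (1 : Mat3) - (D w₀ : Mat3)).det = 0)
    (hCH : ((D w₀ : Mat3) - a • 1) * ((D w₀ : Mat3) - a • 1) * ((D w₀ : Mat3) - b • 1) = 0) :
    HasCircle Γ := by
  obtain ⟨v₂, h₂, e₂⟩ := exists_eigenvector hb
  have hne : ((D w₀ : Mat3) - a • 1) * ((D w₀ : Mat3) - b • 1) ≠ 0 := by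
    intro h0
    refine hw₀ (hD.regular w₀ a b hab ?_)
    rw [← h0]
    simp only [sub_mul, mul_sub, smul_mul_assoc, mul_smul_comm, one_mul, mul_one]
    module
  obtain ⟨x, hx⟩ := exists_mulVec_ne_zero hne
  set v₁ := ((D w₀ : Mat3) - b • 1) *ᵥ x with hv₁
  set v₀ := ((D w₀ : Mat3) - a • 1) *ᵥ v₁ with hv₀
  have h₀ : v₀ ≠ 0 := by
    rw [hv₀, hv₁, mulVec_mulVec]
    exact hx
  have e₁ : (D w₀ : Mat3) *ᵥ v₁ = v₀ + a • v₁ := by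
    rw [hv₀, sub_smul_mulVec]
    abel
  have e₀ : (D w₀ : Mat3) *ᵥ v₀ = a • v₀ := by
    rw [← sub_eq_zero, ← sub_smul_mulVec, hv₀, hv₁, mulVec_mulVec, mulVec_mulVec, hCH,
      zero_mulVec]
  obtain ⟨B, hB⟩ := exists_conj_of_basis (v₀ := v₀) (v₁ := v₁) (v₂ := v₂) (by
    intro x y z hxyz
    have h1 := congrArg (fun v => (D w₀ : Mat3) *ᵥ v) hxyz
    simp only [mulVec_add, mulVec_smul, e₀, e₁, e₂, mulVec_zero] at h1
    have h2 := congrArg (fun v => (D w₀ : Mat3) *ᵥ v) h1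
    simp only [mulVec_add, mulVec_smul, e₀, e₁, e₂, mulVec_zero] at h2
    have s1 := sub_ne_zero.2 hab.symm
    have hz : (z * ((b - a) * (b - a))) • v₂ = 0 := by
      linear_combination (norm := module) h2 - (2 * a) • h1 + (a * a) • hxyz
    simp only [smul_eq_zero, mul_eq_zero, h₂, s1, or_false] at hz
    subst hz
    have hy : y • v₀ = 0 := by
      linear_combination (norm := module) h1 - a • hxyz
    simp only [smul_eq_zero, h₀, or_false] at hy
    subst hy
    have hx : x • v₀ = 0 := by
      linear_combination (norm := module) hxyz
    simp only [smul_eq_zero, h₀, or_false] at hx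
    exact ⟨hx, rfl, rfl⟩)
  have hN := hB (D w₀) !![a, 1, 0; 0, a, 0; 0, 0, b] (by simp [e₀]) (by simp [e₁])
    (by simp [e₂])
  refine hasCircle_of_conjGroup B ?_
  have hE := hD.conj B
  refine hasCircle_of_shear (isZariskiDense_conjGroup B hd) hE
    (α := fun w => ((B⁻¹ * D w * B : SL(3, ℝ)) : Mat3) 0 0)
    (β := fun w => ((B⁻¹ * D w * B : SL(3, ℝ)) : Mat3) 0 1)
    (γ := fun w => ((B⁻¹ * D w * B : SL(3, ℝ)) : Mat3) 2 2) fun w => ?_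
  have hc := commute_entries (hE.commute w₀ w)
  rw [hN] at hc
  set E := ((B⁻¹ * D w * B : SL(3, ℝ)) : Mat3) with hEdef
  have c02 := hc 0 2
  have c12 := hc 1 2
  have c20 := hc 2 0
  have c21 := hc 2 1
  have c00 := hc 0 0
  have c01 := hc 0 1
  simp at c02 c12 c20 c21 c00 c01
  have s1 := sub_ne_zero.2 hab
  have d12 : E 1 2 = 0 :=
    (mul_eq_zero.1 (show (a - b) * _ = 0 by linear_combination c12)).resolve_left s1
  have d02 : E 0 2 = 0 :=
    (mul_eq_zero.1 (show (a - b) * _ = 0 by linear_combination c02 - d12)).resolve_left s1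
  have d20 : E 2 0 = 0 :=
    (mul_eq_zero.1 (show (a - b) * _ = 0 by linear_combination -c20)).resolve_left s1
  have d21 : E 2 1 = 0 :=
    (mul_eq_zero.1 (show (a - b) * _ = 0 by linear_combination -c21 - d20)).resolve_left s1
  have d10 : E 1 0 = 0 := by linear_combination c00
  have d11 : E 1 1 = E 0 0 := by linear_combination c01
  ext i j
  fin_cases i <;> fin_cases j <;> simp [d12, d02, d20, d21, d10, d11]

/-- The centralizer of a full Jordan block consists of polynomials in it, and determinant one forces
the diagonal to be 1. -/
theorem hasCircle_of_triple {Γ : Subgroup SL(3, ℝ)}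
    (hd : IsZariskiDense (Γ : Set SL(3, ℝ))) {D : ℤ × ℤ → SL(3, ℝ)} (hD : IsDiscretePlane Γ D)
    {w₀ : ℤ × ℤ} (hne : ((D w₀ : Mat3) - (1 : ℝ) • 1) * ((D w₀ : Mat3) - (1 : ℝ) • 1) ≠ 0)
    (hCH : ((D w₀ : Mat3) - (1 : ℝ) • 1) * ((D w₀ : Mat3) - (1 : ℝ) • 1) *
      ((D w₀ : Mat3) - (1 : ℝ) • 1) = 0) :
    HasCircle Γ := by
  obtain ⟨v₂, hx⟩ := exists_mulVec_ne_zero hne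
  set v₁ := ((D w₀ : Mat3) - (1 : ℝ) • 1) *ᵥ v₂ with hv₁
  set v₀ := ((D w₀ : Mat3) - (1 : ℝ) • 1) *ᵥ v₁ with hv₀
  have h₀ : v₀ ≠ 0 := by
    rw [hv₀, hv₁, mulVec_mulVec]
    exact hx
  have e₂ : (D w₀ : Mat3) *ᵥ v₂ = v₁ + v₂ := by
    rw [hv₁, sub_smul_mulVec, one_smul]
    abel
  have e₁ : (D w₀ : Mat3) *ᵥ v₁ = v₀ + v₁ := by
    rw [hv₀, sub_smul_mulVec, one_smul]
    abel
  have e₀ : (D w₀ : Mat3) *ᵥ v₀ = v₀ := by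
    have : ((D w₀ : Mat3) - (1 : ℝ) • 1) *ᵥ v₀ = 0 := by
      rw [hv₀, hv₁, mulVec_mulVec, mulVec_mulVec, hCH, zero_mulVec]
    rwa [sub_smul_mulVec, one_smul, sub_eq_zero] at this
  obtain ⟨B, hB⟩ := exists_conj_of_basis (v₀ := v₀) (v₁ := v₁) (v₂ := v₂) (by
    intro x y z hxyz
    have h1 := congrArg (fun v => (D w₀ : Mat3) *ᵥ v) hxyz
    simp only [mulVec_add, mulVec_smul, e₀, e₁, e₂, mulVec_zero] at h1
    have h2 := congrArg (fun v => (D w₀ : Mat3) *ᵥ v) h1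
    simp only [mulVec_add, mulVec_smul, e₀, e₁, e₂, mulVec_zero] at h2
    have hz : z • v₀ = 0 := by
      linear_combination (norm := module) h2 - (2 : ℝ) • h1 + hxyz
    simp only [smul_eq_zero, h₀, or_false] at hz
    subst hz
    have hy : y • v₀ = 0 := by
      linear_combination (norm := module) h1 - hxyz
    simp only [smul_eq_zero, h₀, or_false] at hy
    subst hy
    have hx : x • v₀ = 0 := by
      linear_combination (norm := module) hxyz
    simp only [smul_eq_zero, h₀, or_false] at hx
    exact ⟨hx, rfl, rfl⟩)
  have hN := hB (D w₀) !![1, 1, 0; 0, 1, 1; 0, 0, 1] (by simp [e₀]) (by simp [e₁])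
    (by simp [e₂])
  refine hasCircle_of_conjGroup B ?_
  have hE := hD.conj B
  refine hasCircle_of_jordan (isZariskiDense_conjGroup B hd) hE
    (σ := fun w => ((B⁻¹ * D w * B : SL(3, ℝ)) : Mat3) 0 1)
    (τ := fun w => ((B⁻¹ * D w * B : SL(3, ℝ)) : Mat3) 0 2) (fun w => ?_)
    ⟨w₀, by rw [hN]; simp⟩
  have hc := commute_entries (hE.commute w₀ w)
  rw [hN] at hc
  have hdet : ((B⁻¹ * D w * B : SL(3, ℝ)) : Mat3).det = 1 := (B⁻¹ * D w * B).2
  set E := ((B⁻¹ * D w * B : SL(3, ℝ)) : Mat3) with hEdef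
  have c00 := hc 0 0
  have c01 := hc 0 1
  have c02 := hc 0 2
  have c10 := hc 1 0
  have c11 := hc 1 1
  have c12 := hc 1 2
  simp at c00 c01 c02 c10 c11 c12
  have d20 : E 2 0 = 0 := by linear_combination c10
  have d10 : E 1 0 = 0 := by linear_combination c00
  have d21 : E 2 1 = 0 := by linear_combination c11 + d10
  have d11 : E 1 1 = E 0 0 := by linear_combination c01
  have d12 : E 1 2 = E 0 1 := by linear_combination c02
  have d22 : E 2 2 = E 1 1 := by linear_combination c12
  have d00 : E 0 0 = 1 := by
    rw [det_fin_three, d20, d10, d21, d22, d11] at hdet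
    have : (E 0 0 - 1) * ((E 0 0 + 1 / 2) ^ 2 + 3 / 4) = 0 := by linear_combination hdet
    rcases mul_eq_zero.1 this with h | h
    · linarith
    · nlinarith [sq_nonneg (E 0 0 + 1 / 2)]
  ext i j
  fin_cases i <;> fin_cases j <;> simp [d12, d20, d21, d10, d11, d22, d00]

/-- Everything commuting with `D w₀` is a rotation-dilation p + iq on a plane together with a scalar
r = 1/(p² + q²). The single character log r bounds the whole matrix and is small for infinitely many
w, against discreteness. -/
theorem IsDiscretePlane.false_of_complex {Γ : Subgroup SL(3, ℝ)} {D : ℤ × ℤ → SL(3, ℝ)}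
    (hD : IsDiscretePlane Γ D) {w₀ : ℤ × ℤ} {a μ ν : ℝ} (hν : ν ≠ 0)
    (hdet : ∀ x : ℝ, (x • (1 : Mat3) - (D w₀ : Mat3)).det = (x - a) * ((x - μ) ^ 2 + ν ^ 2))
    (hCH : (((D w₀ : Mat3) - μ • 1) * ((D w₀ : Mat3) - μ • 1) + ν ^ 2 • 1) *
      ((D w₀ : Mat3) - a • 1) = 0) : False := by
  obtain ⟨v₂, h₂, e₂⟩ := exists_eigenvector (M := (D w₀ : Mat3)) (a := a) (by rw [hdet]; ring)
  have hne : (D w₀ : Mat3) - a • 1 ≠ 0 := by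
    intro h0
    have h1 : ∀ x : ℝ, (x - a) ^ 3 = (x - a) * ((x - μ) ^ 2 + ν ^ 2) := by
      intro x
      rw [← hdet, sub_eq_zero.1 h0, ← sub_smul, det_smul]
      simp
    have h2 := h1 (a + 1)
    have h3 := h1 (a - 1)
    have h4 : a - μ = 0 := by linear_combination (-1 / 4) * (h2 + h3)
    have h5 : ν ^ 2 = 0 := by
      have : a = μ := by linarith
      subst this
      linear_combination -h2
    exact hν (pow_eq_zero_iff (by norm_num) |>.1 h5)
  obtain ⟨z, hz⟩ := exists_mulVec_ne_zero hne
  set v₀ := ((D w₀ : Mat3) - a • 1) *ᵥ z with hv₀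
  set v₁ := ν⁻¹ • (((D w₀ : Mat3) - μ • 1) *ᵥ v₀) with hv₁
  have e₀ : (D w₀ : Mat3) *ᵥ v₀ = μ • v₀ + ν • v₁ := by
    rw [hv₁, smul_smul, mul_inv_cancel₀ hν, one_smul, sub_smul_mulVec]
    abel
  have e₁ : (D w₀ : Mat3) *ᵥ v₁ = -ν • v₀ + μ • v₁ := by
    have h1 : (((D w₀ : Mat3) - μ • 1) * ((D w₀ : Mat3) - μ • 1) + ν ^ 2 • 1) *ᵥ v₀ = 0 := by
      rw [hv₀, mulVec_mulVec, hCH, zero_mulVec]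
    rw [add_mulVec, ← mulVec_mulVec, smul_mulVec, one_mulVec, sub_smul_mulVec _ _ v₀, e₀,
      add_sub_cancel_left, mulVec_smul, sub_smul_mulVec] at h1
    have h2 : ν • ((D w₀ : Mat3) *ᵥ v₁ - μ • v₁ + ν • v₀) = 0 := by
      linear_combination (norm := module) h1
    replace h2 := (smul_eq_zero.1 h2).resolve_left hν
    linear_combination (norm := module) h2
  obtain ⟨B, hB⟩ := exists_conj_of_basis (v₀ := v₀) (v₁ := v₁) (v₂ := v₂) (by
    intro x y z hxyz
    have h1 := congrArg (fun v => (D w₀ : Mat3) *ᵥ v) hxyz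
    simp only [mulVec_add, mulVec_smul, e₀, e₁, e₂, mulVec_zero] at h1
    have h2 := congrArg (fun v => (D w₀ : Mat3) *ᵥ v) h1
    simp only [mulVec_add, mulVec_smul, e₀, e₁, e₂, mulVec_zero] at h2
    have hz : (z * ((a - μ) ^ 2 + ν ^ 2)) • v₂ = 0 := by
      linear_combination (norm := module) h2 - (2 * μ) • h1 + (μ ^ 2 + ν ^ 2) • hxyz
    have hpos : (a - μ) ^ 2 + ν ^ 2 ≠ 0 := by positivity
    simp only [smul_eq_zero, mul_eq_zero, h₂, hpos, or_false] at hz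
    subst hz
    have hxy : (ν * (x ^ 2 + y ^ 2)) • v₀ = 0 := by
      linear_combination (norm := module) (ν * x + y * μ) • hxyz - y • h1
    simp only [smul_eq_zero, mul_eq_zero, hz, hν, or_false, false_or] at hxy
    have hx : x = 0 := by nlinarith [sq_nonneg x, sq_nonneg y]
    have hy : y = 0 := by nlinarith [sq_nonneg x, sq_nonneg y]
    exact ⟨hx, hy, rfl⟩)
  have hN := hB (D w₀) !![μ, -ν, 0; ν, μ, 0; 0, 0, a] (by simp [e₀]) (by simp [e₁])
    (by simp [e₂])
  have hE := hD.conj B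
  have hform : ∀ w, ∃ p q r : ℝ, ((B⁻¹ * D w * B : SL(3, ℝ)) : Mat3) =
      !![p, -q, 0; q, p, 0; 0, 0, r] := by
    intro w
    have hc := commute_entries (hE.commute w₀ w)
    rw [hN] at hc
    set E := ((B⁻¹ * D w * B : SL(3, ℝ)) : Mat3) with hEdef
    have c00 := hc 0 0
    have c01 := hc 0 1
    have c02 := hc 0 2
    have c12 := hc 1 2
    have c20 := hc 2 0
    have c21 := hc 2 1
    simp at c00 c01 c02 c12 c20 c21
    have hpos : (μ - a) ^ 2 + ν ^ 2 ≠ 0 := by positivity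
    have d02 : E 0 2 = 0 := (mul_eq_zero.1 (show ((μ - a) ^ 2 + ν ^ 2) * _ = 0 by
      linear_combination (μ - a) * c02 + ν * c12)).resolve_left hpos
    have d12 : E 1 2 = 0 := (mul_eq_zero.1 (show ((μ - a) ^ 2 + ν ^ 2) * _ = 0 by
      linear_combination (μ - a) * c12 - ν * c02)).resolve_left hpos
    have d20 : E 2 0 = 0 := (mul_eq_zero.1 (show ((μ - a) ^ 2 + ν ^ 2) * _ = 0 by
      linear_combination -(μ - a) * c20 + ν * c21)).resolve_left hpos
    have d21 : E 2 1 = 0 := (mul_eq_zero.1 (show ((μ - a) ^ 2 + ν ^ 2) * _ = 0 by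
      linear_combination -(μ - a) * c21 - ν * c20)).resolve_left hpos
    have d01 : E 0 1 = -E 1 0 := by
      have : ν * (E 0 1 + E 1 0) = 0 := by linear_combination -c00
      linarith [(mul_eq_zero.1 this).resolve_left hν]
    have d11 : E 1 1 = E 0 0 := by
      have : ν * (E 1 1 - E 0 0) = 0 := by linear_combination -c01
      linarith [(mul_eq_zero.1 this).resolve_left hν]
    refine ⟨E 0 0, E 1 0, E 2 2, ?_⟩
    ext i j
    fin_cases i <;> fin_cases j <;> simp [d12, d20, d21, d01, d11, d02]
  choose p q r hpqr using hform
  have hdet' : ∀ w, (p w ^ 2 + q w ^ 2) * r w = 1 := by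
    intro w
    have h1 : ((B⁻¹ * D w * B : SL(3, ℝ)) : Mat3).det = 1 := (B⁻¹ * D w * B).2
    rw [hpqr, det_fin_three] at h1
    simp at h1
    linarith
  have hr0 : ∀ w, 0 < r w := by
    intro w
    have h1 := hdet' w
    by_contra hneg
    nlinarith [sq_nonneg (p w), sq_nonneg (q w)]
  have hmul : ∀ v w, r (v + w) = r v * r w := by
    intro v w
    have h1 := congrArg (fun g : SL(3, ℝ) => (g : Mat3)) (hE.add v w)
    simp only [Matrix.SpecialLinearGroup.coe_mul _ (B⁻¹ * D w * B), hpqr] at h1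
    have h22 := congrFun (congrFun h1 2) 2
    simpa [Matrix.mul_apply, Fin.sum_univ_three] using h22
  let ψ : ℤ × ℤ →+ ℝ := AddMonoidHom.mk' (fun w => Real.log (r w)) (by
    intro v w
    rw [hmul, Real.log_mul (hr0 v).ne' (hr0 w).ne'])
  refine infinite_setOf_abs_le ψ one_pos ((hE.fin (Real.exp 1)).subset fun w hw => ?_)
  have hw' : |Real.log (r w)| ≤ 1 := hw
  rw [abs_le] at hw'
  have hr1 : r w ≤ Real.exp 1 := by
    rw [← Real.exp_log (hr0 w)]
    exact Real.exp_le_exp.2 hw'.2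
  have hr2 : Real.exp (-1) ≤ r w := by
    rw [← Real.exp_log (hr0 w)]
    exact Real.exp_le_exp.2 hw'.1
  have hpq : p w ^ 2 + q w ^ 2 ≤ Real.exp 1 := by
    have h1 := hdet' w
    have h2 : Real.exp (-1) * Real.exp 1 = 1 := by rw [← Real.exp_add]; simp
    have h3 := sq_nonneg (p w)
    have h4 := sq_nonneg (q w)
    have h5 := Real.exp_pos 1
    have h6 : (p w ^ 2 + q w ^ 2) * Real.exp (-1) ≤ 1 :=
      (mul_le_mul_of_nonneg_left hr2 (by positivity)).trans_eq h1
    nlinarith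
  have he : 1 ≤ Real.exp 1 := Real.one_le_exp (by norm_num)
  have hp1 : |p w| ≤ Real.exp 1 := abs_le_of_sq_le_sq (by nlinarith [sq_nonneg (q w)]) (by linarith)
  have hq1 : |q w| ≤ Real.exp 1 := abs_le_of_sq_le_sq (by nlinarith [sq_nonneg (p w)]) (by linarith)
  have hr3 : |r w| ≤ Real.exp 1 := by rwa [abs_of_pos (hr0 w)]
  have hE0 := Real.exp_pos 1
  intro i j
  rw [hpqr]
  fin_cases i <;> fin_cases j <;> simp <;> first | assumption | linarith

/-! ### Planes all of whose elements satisfy (g - 1)² = 0. -/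

/-- The commuting square-zero matrices `N₁` and `N₂` have rank one, so they share either their
kernel or their image; these are the two normal forms. -/
theorem hasCircle_of_linear {Γ : Subgroup SL(3, ℝ)}
    (hd : IsZariskiDense (Γ : Set SL(3, ℝ))) {D : ℤ × ℤ → SL(3, ℝ)} (hmem : ∀ w, D w ∈ Γ)
    {N₁ N₂ : Mat3} (hf : ∀ w, (D w : Mat3) = 1 + (w.1 : ℝ) • N₁ + (w.2 : ℝ) • N₂)
    (h11 : N₁ * N₁ = 0) (h12 : N₁ * N₂ = 0) (h21 : N₂ * N₁ = 0) (h22 : N₂ * N₂ = 0)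
    (hne : N₁ ≠ 0) (hind : ∀ c : ℝ, N₂ - c • N₁ ≠ 0) : HasCircle Γ := by
  have hact : ∀ w x, (D w : Mat3) *ᵥ x = x + (w.1 : ℝ) • (N₁ *ᵥ x) + (w.2 : ℝ) • (N₂ *ᵥ x) := by
    intro w x
    rw [hf, add_mulVec, add_mulVec, one_mulVec, smul_mulVec, smul_mulVec]
  have k11 : ∀ x, N₁ *ᵥ (N₁ *ᵥ x) = 0 := fun x => by rw [mulVec_mulVec, h11, zero_mulVec]
  have k12 : ∀ x, N₁ *ᵥ (N₂ *ᵥ x) = 0 := fun x => by rw [mulVec_mulVec, h12, zero_mulVec]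
  have k21 : ∀ x, N₂ *ᵥ (N₁ *ᵥ x) = 0 := fun x => by rw [mulVec_mulVec, h21, zero_mulVec]
  have k22 : ∀ x, N₂ *ᵥ (N₂ *ᵥ x) = 0 := fun x => by rw [mulVec_mulVec, h22, zero_mulVec]
  -- Independent images of a single x lead to translations. If the images are always dependent, both
  -- matrices turn out to have the same image line.
  by_cases hx : ∃ x, ∀ a b : ℝ, a • (N₁ *ᵥ x) + b • (N₂ *ᵥ x) = 0 → a = 0 ∧ b = 0
  · obtain ⟨x, hx⟩ := hx
    have hx1 : N₁ *ᵥ x ≠ 0 := by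
      intro h0
      exact one_ne_zero (hx 1 0 (by rw [h0]; simp)).1
    obtain ⟨B, hB⟩ := exists_conj_of_basis (v₀ := N₁ *ᵥ x) (v₁ := N₂ *ᵥ x) (v₂ := x) (by
      intro a b c habc
      have h1 := congrArg (fun v => N₁ *ᵥ v) habc
      simp only [mulVec_add, mulVec_smul, k11, k12, mulVec_zero, smul_zero, zero_add,
        smul_eq_zero, hx1, or_false] at h1
      subst h1
      rw [zero_smul, add_zero] at habc
      obtain ⟨h1, h2⟩ := hx a b habc
      exact ⟨h1, h2, rfl⟩)
    refine hasCircle_of_conjGroup B (hasCircle_of_translations (isZariskiDense_conjGroup B hd)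
      (D := fun w => B⁻¹ * D w * B) (fun w => ?_) fun w => ?_)
    · exact ⟨D w, hmem w, conj_inv_apply B (D w)⟩
    · refine hB _ _ ?_ ?_ ?_
      · simp [hact, k11, k21]
      · simp [hact, k12, k22]
      · simp [hact]
        module
  · push Not at hx
    obtain ⟨x₀, hx₀⟩ := exists_mulVec_ne_zero hne
    set v := N₁ *ᵥ x₀ with hv
    obtain ⟨c, hc⟩ : ∃ c : ℝ, N₂ *ᵥ x₀ = c • v := by
      obtain ⟨a, b, h0, hab⟩ := hx x₀
      rw [← hv] at h0
      have hb : b ≠ 0 := by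
        intro hb
        subst hb
        have ha : a = 0 := by simpa [hx₀] using h0
        exact hab ha rfl
      refine ⟨-a / b, smul_right_injective _ hb ?_⟩
      change b • (N₂ *ᵥ x₀) = b • ((-a / b) • v)
      rw [smul_smul, mul_div_cancel₀ _ hb]
      linear_combination (norm := module) h0
    obtain ⟨y, hy⟩ := exists_mulVec_ne_zero (hind c)
    set u := (N₂ - c • N₁) *ᵥ y with hu
    have hu' : N₂ *ᵥ y = u + c • (N₁ *ᵥ y) := by
      rw [hu, sub_mulVec, smul_mulVec, sub_add_cancel]
    obtain ⟨d, hd1⟩ : ∃ d : ℝ, N₁ *ᵥ y = d • u := by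
      obtain ⟨a, b, h0, hab⟩ := hx y
      rw [hu'] at h0
      have hs : a + b * c ≠ 0 := by
        intro hs
        have h1 : b • u = 0 := by
          have h2 : (a + b * c) • (N₁ *ᵥ y) = 0 := by rw [hs, zero_smul]
          linear_combination (norm := module) h0 - h2
        have hb : b = 0 := by simpa [hy] using h1
        subst hb
        exact hab (by linarith) rfl
      refine ⟨-b / (a + b * c), smul_right_injective _ hs ?_⟩
      change (a + b * c) • (N₁ *ᵥ y) = (a + b * c) • ((-b / (a + b * c)) • u)
      rw [smul_smul, mul_div_cancel₀ _ hs]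
      linear_combination (norm := module) h0
    -- Dependence at the sum x₀ + y forces v and u onto one line.
    obtain ⟨e, he⟩ : ∃ e : ℝ, v = e • u := by
      obtain ⟨a, b, h0, hab⟩ := hx (x₀ + y)
      rw [mulVec_add, mulVec_add, ← hv, hc, hu', hd1] at h0
      have hs : a + b * c ≠ 0 := by
        intro hs
        have h1 : b • u = 0 := by
          have h2 : (a + b * c) • (v + d • u) = 0 := by rw [hs, zero_smul]
          linear_combination (norm := module) h0 - h2
        have hb : b = 0 := by simpa [hy] using h1
        subst hb
        exact hab (by linarith) rfl
      refine ⟨-((a + b * c) * d + b) / (a + b * c), smul_right_injective _ hs ?_⟩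
      change (a + b * c) • v = (a + b * c) • ((-((a + b * c) * d + b) / (a + b * c)) • u)
      rw [smul_smul, mul_div_cancel₀ _ hs]
      linear_combination (norm := module) h0
    have hv1 : N₁ *ᵥ v = 0 := k11 x₀
    have hv2 : N₂ *ᵥ v = 0 := k21 x₀
    clear_value u v
    -- The vectors z and x₁ are chosen dual to N₁, N₂: N₁ kills z and sends x₁ to v, while N₂ kills
    -- x₁ and sends z to v.
    set z := e • y - d • x₀ with hz
    have hz1 : N₁ *ᵥ z = 0 := by
      rw [hz, mulVec_sub, mulVec_smul, mulVec_smul, hd1, ← hv, he]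
      module
    have hz2 : N₂ *ᵥ z = v := by
      rw [hz, mulVec_sub, mulVec_smul, mulVec_smul, hu', hd1, hc, he]
      module
    set x₁ := x₀ - c • z with hx₁
    have hx1 : N₁ *ᵥ x₁ = v := by
      rw [hx₁, mulVec_sub, mulVec_smul, hz1, ← hv, smul_zero, sub_zero]
    have hx2 : N₂ *ᵥ x₁ = 0 := by
      rw [hx₁, mulVec_sub, mulVec_smul, hz2, hc, sub_self]
    obtain ⟨B, hB⟩ := exists_conj_of_basis (v₀ := v) (v₁ := x₁) (v₂ := z) (by
      intro α β γ hsum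
      have h1 := congrArg (fun v => N₁ *ᵥ v) hsum
      have h2 := congrArg (fun v => N₂ *ᵥ v) hsum
      simp only [mulVec_add, mulVec_smul, hv1, hx1, hz1, mulVec_zero, smul_zero, zero_add,
        add_zero, smul_eq_zero, hx₀, or_false] at h1
      simp only [mulVec_add, mulVec_smul, hv2, hx2, hz2, mulVec_zero, smul_zero, zero_add,
        add_zero, smul_eq_zero, hx₀, or_false] at h2
      subst h1 h2
      simp only [zero_smul, add_zero, smul_eq_zero, hx₀, or_false] at hsum
      exact ⟨hsum, rfl, rfl⟩)
    refine hasCircle_of_conjGroup B (hasCircle_of_central (isZariskiDense_conjGroup B hd)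
      (D := fun w => B⁻¹ * D w * B) (fun w => ?_) fun w => ?_)
    · exact ⟨D w, hmem w, conj_inv_apply B (D w)⟩
    · refine hB _ _ ?_ ?_ ?_
      · simp [hact, hv1, hv2]
      · simp [hact, hx1, hx2]
        abel
      · simp [hact, hz1, hz2]
        abel

/-- With E = D - 1, expanding E(v + w)² = 0 gives E(v)E(w) = 0, so E is additive. If E(0,1) were a
multiple of E(1,0), a single character would control D and contradict discreteness. -/
theorem IsDiscretePlane.hasCircle_of_unipotent {Γ : Subgroup SL(3, ℝ)}
    (hd : IsZariskiDense (Γ : Set SL(3, ℝ))) {D : ℤ × ℤ → SL(3, ℝ)} (hD : IsDiscretePlane Γ D)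
    (hsq : ∀ w, ((D w : Mat3) - (1 : ℝ) • 1) * ((D w : Mat3) - (1 : ℝ) • 1) = 0) :
    HasCircle Γ := by
  set E : ℤ × ℤ → Mat3 := fun w => (D w : Mat3) - (1 : ℝ) • 1 with hE
  have hDE : ∀ w, (D w : Mat3) = 1 + E w := by
    intro w
    simp [hE]
  have hcomm : ∀ v w, E v * E w = E w * E v := by
    intro v w
    simp only [hE, sub_mul, mul_sub, hD.commute v w, one_smul, one_mul, mul_one]
    abel
  have hadd' : ∀ v w, E (v + w) = E v + E w + E v * E w := by
    intro v w
    have h1 := congrArg (fun g : SL(3, ℝ) => (g : Mat3)) (hD.add v w)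
    simp only [Matrix.SpecialLinearGroup.coe_mul, hDE, mul_add, add_mul, mul_one, one_mul] at h1
    linear_combination (norm := abel) h1
  have hzero : ∀ v w, E v * E w = 0 := by
    intro v w
    have h1 := hsq (v + w)
    change E (v + w) * E (v + w) = 0 at h1
    have h2 : E v * E v = 0 := hsq v
    have h3 : E w * E w = 0 := hsq w
    have h4 : E (v + w) * E (v + w) = (2 : ℝ) • (E v * E w) := by
      have a1 : E v * (E v * E w) = 0 := by rw [← mul_assoc, h2, zero_mul]
      have a2 : E w * (E v * E w) = 0 := by rw [hcomm v w, ← mul_assoc, h3, zero_mul]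
      have a3 : E v * E w * E v = 0 := by rw [mul_assoc, hcomm w v, a1]
      have a4 : E v * E w * E w = 0 := by rw [mul_assoc, h3, mul_zero]
      have a5 : E v * E w * (E v * E w) = 0 := by rw [← mul_assoc, a3, zero_mul]
      rw [hadd']
      simp only [mul_add, add_mul, h2, h3, a1, a2, a3, a4, a5, hcomm w v]
      module
    rw [h4] at h1
    exact (smul_eq_zero.1 h1).resolve_left two_ne_zero
  have hadd : ∀ v w, E (v + w) = E v + E w := by
    intro v w
    rw [hadd', hzero, add_zero]
  have hlin : ∀ w, (D w : Mat3) = 1 + (w.1 : ℝ) • E (1, 0) + (w.2 : ℝ) • E (0, 1) := by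
    intro w
    ext i j
    have h1 := addMonoidHom_int_prod_apply (AddMonoidHom.mk' (fun w => E w i j) (by
      intro v w
      rw [hadd, Matrix.add_apply])) w
    simp only [AddMonoidHom.mk'_apply] at h1
    rw [hDE]
    simp only [Matrix.add_apply, Matrix.smul_apply, smul_eq_mul, h1]
    ring
  have hinj : ∀ w, E w = 0 → w = 0 := by
    intro w hw
    exact hD.eq_zero_of_coe_eq_one (by rw [hDE, hw, add_zero])
  refine hasCircle_of_linear hd hD.mem hlin (hzero _ _) (hzero _ _) (hzero _ _) (hzero _ _)
    (fun h0 => ?_) fun c hc => ?_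
  · simpa using congrArg Prod.fst (hinj _ h0)
  · let ψ : ℤ × ℤ →+ ℝ := AddMonoidHom.mk' (fun w => w.1 + w.2 * c) (by
      intro v w
      push_cast [Prod.fst_add, Prod.snd_add]
      ring)
    obtain ⟨K, hK⟩ : ∃ K : ℝ, ∀ i j, |E (1, 0) i j| ≤ K := by
      refine ⟨∑ i, ∑ j, |E (1, 0) i j|, fun i j => ?_⟩
      refine (Finset.single_le_sum (f := fun j => |E (1, 0) i j|)
        (fun _ _ => abs_nonneg _) (Finset.mem_univ j)).trans ?_
      exact Finset.single_le_sum (f := fun i => ∑ j, |E (1, 0) i j|)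
        (fun _ _ => Finset.sum_nonneg fun _ _ => abs_nonneg _) (Finset.mem_univ i)
    refine infinite_setOf_abs_le ψ one_pos ((hD.fin (1 + K)).subset fun w hw i j => ?_)
    have hw' : |(w.1 : ℝ) + w.2 * c| ≤ 1 := hw
    have h1 : (D w : Mat3) = 1 + ((w.1 : ℝ) + w.2 * c) • E (1, 0) := by
      rw [hlin, sub_eq_zero.1 hc]
      module
    rw [h1, Matrix.add_apply, Matrix.smul_apply, smul_eq_mul]
    refine (abs_add_le _ _).trans (add_le_add ?_ ?_)
    · rw [Matrix.one_apply]
      split <;> simp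
    · rw [abs_mul]
      calc _ ≤ 1 * K := mul_le_mul hw' (hK i j) (abs_nonneg _) zero_le_one
        _ = K := one_mul K

/-! ### Case distinction and translation of the hypotheses. -/

theorem IsDiscretePlane.hasCircle {Γ : Subgroup SL(3, ℝ)}
    (hd : IsZariskiDense (Γ : Set SL(3, ℝ))) {D : ℤ × ℤ → SL(3, ℝ)} (hD : IsDiscretePlane Γ D) :
    HasCircle Γ := by
  by_cases hsq : ∀ w, ((D w : Mat3) - (1 : ℝ) • 1) * ((D w : Mat3) - (1 : ℝ) • 1) = 0
  · exact hD.hasCircle_of_unipotent hd hsq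
  push Not at hsq
  obtain ⟨w₀, hw⟩ := hsq
  have hw₀ : w₀ ≠ 0 := by
    rintro rfl
    have h1 : D 0 = 1 := by
      have := hD.add 0 0
      rwa [add_zero, right_eq_mul] at this
    exact hw (by rw [h1]; simp)
  have hcomm : ∀ x y : ℝ, ((D w₀ : Mat3) - x • 1) * ((D w₀ : Mat3) - y • 1) =
      ((D w₀ : Mat3) - y • 1) * ((D w₀ : Mat3) - x • 1) := by
    intro x y
    simp only [sub_mul, mul_sub, smul_mul_assoc, mul_smul_comm, one_mul, mul_one]
    module
  rcases exists_charpoly_factor (D w₀ : Mat3) with ⟨a, b, c, hdet, hCH⟩ | ⟨a, μ, ν, hν, hdet, hCH⟩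
  · by_cases hab : a = b
    · subst hab
      by_cases hac : a = c
      · subst hac
        have h1 := hdet 0
        rw [zero_smul, zero_sub, det_neg, (D w₀).2] at h1
        have ha : a = 1 := by
          -- This is a³ - 1 = 0 with the quadratic factor written as a positive expression.
          have h2 : (a - 1) * ((a + 1 / 2) ^ 2 + 3 / 4) = 0 := by
            simp at h1
            linear_combination h1
          rcases mul_eq_zero.1 h2 with h | h
          · linarith
          · nlinarith [sq_nonneg (a + 1 / 2)]
        subst ha
        exact hasCircle_of_triple hd hD hw hCH
      · exact hasCircle_of_double hd hD hw₀ hac (by rw [hdet]; ring) hCH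
    · by_cases hac : a = c
      · subst hac
        refine hasCircle_of_double hd hD hw₀ hab (by rw [hdet]; ring) ?_
        rw [mul_assoc, hcomm a b, ← mul_assoc, hCH]
      · by_cases hbc : b = c
        · subst hbc
          refine hasCircle_of_double hd hD hw₀ (Ne.symm hab) (by rw [hdet]; ring) ?_
          rw [mul_assoc, hcomm b a, ← mul_assoc, hcomm b a, hCH]
        · exact hasCircle_of_distinct hd hD hab hac hbc hdet
  · exact (hD.false_of_complex hν hdet hCH).elim

theorem isCompact_setOf_abs_entry_le (C : ℝ) :
    IsCompact {g : SL(3, ℝ) | ∀ i j, |(g : Mat3) i j| ≤ C} := by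
  have hcl : IsClosedEmbedding (fun g : SL(3, ℝ) => (g : Mat3)) := by
    refine ⟨IsEmbedding.subtypeVal, ?_⟩
    have : Set.range (fun g : SL(3, ℝ) => (g : Mat3)) = {M : Mat3 | M.det = 1} :=
      Subtype.range_coe
    rw [this]
    exact isClosed_eq (by fun_prop) continuous_const
  have hbox : IsCompact (Set.univ.pi fun _ : Fin 3 => Set.univ.pi fun _ : Fin 3 =>
      Set.Icc (-C) C) := isCompact_univ_pi fun _ => isCompact_univ_pi fun _ => isCompact_Icc
  have := hcl.isCompact_preimage (K := (Set.univ.pi fun _ : Fin 3 => Set.univ.pi fun _ : Fin 3 =>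
      Set.Icc (-C) C : Set Mat3)) hbox
  convert this using 1
  ext g
  exact ⟨fun h i _ j _ => abs_le.1 (h i j), fun h i j => abs_le.2 (h i trivial j trivial)⟩

/-- A squarefree annihilating polynomial gives semisimplicity, and three eigenvalues taken from {a,
b} cannot be pairwise distinct. -/
theorem isSingularSemisimple_of_quadratic {g : SL(3, ℝ)} {a b : ℝ} (hab : a ≠ b)
    (h : (g : Mat3) * (g : Mat3) - (a + b) • (g : Mat3) + (a * b) • (1 : Mat3) = 0) :
    IsSingularSemisimple g := by
  constructor
  · refine Module.End.isSemisimple_of_squarefree_aeval_eq_zero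
      (p := (Polynomial.X - Polynomial.C a) * (Polynomial.X - Polynomial.C b)) ?_ ?_
    · refine Polynomial.Separable.squarefree ?_
      exact (Polynomial.separable_X_sub_C).mul Polynomial.separable_X_sub_C
        (Polynomial.isCoprime_X_sub_C_of_isUnit_sub (sub_ne_zero.2 hab).isUnit)
    · have h1 : Polynomial.aeval (Matrix.toLin' (g : Mat3))
          ((Polynomial.X - Polynomial.C a) * (Polynomial.X - Polynomial.C b)) =
          Matrix.toLin' (Polynomial.aeval (g : Mat3)
          ((Polynomial.X - Polynomial.C a) * (Polynomial.X - Polynomial.C b))) :=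
        Polynomial.aeval_algHom_apply (Matrix.toLinAlgEquiv' : Mat3 ≃ₐ[ℝ] _).toAlgHom _ _
      rw [h1, ← map_zero Matrix.toLin', ← h]
      congr 1
      simp only [map_mul, map_sub, Polynomial.aeval_X, Polynomial.aeval_C,
        Algebra.algebraMap_eq_smul_one, sub_mul, mul_sub, smul_mul_assoc, mul_smul_comm, one_mul,
        mul_one]
      module
  · intro hreg
    set M : Matrix (Fin 3) (Fin 3) ℂ := (g : Mat3).map Complex.ofReal with hM
    have hMq : M * M - ((a : ℂ) + b) • M + ((a : ℂ) * b) • (1 : Matrix (Fin 3) (Fin 3) ℂ) = 0 := by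
      have h1 := congrArg (fun N : Mat3 => N.map Complex.ofReal) h
      ext i j
      have h2 := congrFun (congrFun h1 i) j
      simp only [Matrix.map_apply, Matrix.add_apply, Matrix.sub_apply, Matrix.smul_apply,
        Matrix.mul_apply, Fin.sum_univ_three, smul_eq_mul, Matrix.zero_apply, hM] at h2 ⊢
      push_cast at h2
      rw [← h2]
      congr 2
      simp [Matrix.one_apply, apply_ite]
    have hcard : Multiset.card M.charpoly.roots = 3 := by
      rw [IsAlgClosed.card_roots_eq_natDegree, Matrix.charpoly_natDegree_eq_dim, Fintype.card_fin]
    have hroot : ∀ z ∈ M.charpoly.roots, z ∈ ({(a : ℂ), (b : ℂ)} : Finset ℂ) := by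
      intro z hz
      have h1 : (z • (1 : Matrix (Fin 3) (Fin 3) ℂ) - M).det = 0 := by
        have := (Polynomial.mem_roots'.1 hz).2
        rwa [Polynomial.IsRoot, Matrix.eval_charpoly, scalar_apply, ← smul_one_eq_diagonal] at this
      obtain ⟨v, hv, h0⟩ := Matrix.exists_mulVec_eq_zero_iff.2 h1
      rw [sub_mulVec, smul_mulVec, one_mulVec, sub_eq_zero] at h0
      have h2 := congrArg (fun N => N *ᵥ v) hMq
      simp only [add_mulVec, sub_mulVec, smul_mulVec, ← mulVec_mulVec, one_mulVec, ← h0,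
        mulVec_smul, zero_mulVec] at h2
      have h3 : ((z - a) * (z - b)) • v = 0 := by
        linear_combination (norm := module) h2
      have h4 := (smul_eq_zero.1 h3).resolve_right hv
      rcases mul_eq_zero.1 h4 with h5 | h5
      · simp [sub_eq_zero.1 h5]
      · simp [sub_eq_zero.1 h5]
    have hsub : (⟨M.charpoly.roots, hreg⟩ : Finset ℂ) ⊆ {(a : ℂ), (b : ℂ)} := hroot
    have h1 := (Finset.card_le_card hsub).trans Finset.card_le_two
    change Multiset.card M.charpoly.roots ≤ 2 at h1
    omega

theorem isDiscretePlane_of_mulEquiv {Γ Δ : Subgroup SL(3, ℝ)} [DiscreteTopology Γ] (hΔ : Δ ≤ Γ)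
    (e : Δ ≃* Multiplicative (ℤ × ℤ)) (h : ∀ g ∈ Δ, g ≠ 1 → ¬ IsSingularSemisimple g) :
    IsDiscretePlane Γ fun w => (e.symm (Multiplicative.ofAdd w) : SL(3, ℝ)) where
  mem w := hΔ (e.symm _).2
  add v w := by rw [ofAdd_add, map_mul, Subgroup.coe_mul]
  fin C := by
    -- A discrete subgroup is closed, so it meets the compact set of matrices with bounded entries
    -- in a finite set.
    have hΓ : IsClosed (Γ : Set SL(3, ℝ)) := Subgroup.isClosed_of_discrete
    have hfin := ((isCompact_setOf_abs_entry_le C).inter_right hΓ).finite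
      ((show IsDiscrete (Γ : Set SL(3, ℝ)) from ⟨‹_›⟩).mono Set.inter_subset_right)
    refine Set.Finite.of_injOn (f := fun w => (e.symm (Multiplicative.ofAdd w) : SL(3, ℝ)))
      (fun w hw => ?_) ?_ hfin
    · exact ⟨hw, hΔ (e.symm _).2⟩
    exact (Subtype.val_injective.comp
      (e.symm.injective.comp Multiplicative.ofAdd.injective)).injOn
  regular w a b hab hq := by
    by_contra hw
    refine h _ (e.symm _).2 (fun h1 => hw ?_) (isSingularSemisimple_of_quadratic hab hq)
    rw [OneMemClass.coe_eq_one, EmbeddingLike.map_eq_one_iff] at h1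
    exact h1

end

theorem proposition5p7 (Γ : Subgroup SL(3, ℝ)) (hdiscrete : DiscreteTopology Γ)
    (hdense : IsZariskiDense (Γ : Set SL(3, ℝ)))
    (hZ2 : ∃ Δ : Subgroup SL(3, ℝ), Δ ≤ Γ ∧ Nonempty (Δ ≃* Multiplicative (ℤ × ℤ)) ∧
      ∀ g ∈ Δ, g ≠ 1 → ¬ IsSingularSemisimple g) :
    MulAction.IsMinimal Γ (SL(3, ℝ) ⧸ minimalParabolic) := by
  obtain ⟨Δ, hΔ, ⟨e⟩, hreg⟩ := hZ2
  have hD := isDiscretePlane_of_mulEquiv hΔ e hreg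
  exact isMinimal_of_hasCircle (hD.hasCircle hdense)
    (hD.dual.hasCircle (isZariskiDense_dualGroup hdense))
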